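/- **Theorem (Soundness of the ECLNL calculus).** *Models.* An ECLNL model consists of: a cartesian closed category $\mathbf V$ with finite coproducts, enriched over itself (the self-enrichment $\mathscr V$), the coproducts being $\mathbf V$-enriched; a $\mathbf V$-symmetric monoidal closed category $\mathscr C$ with $\mathbf V$-copowers $X\odot A$ and finite $\mathbf V$-coproducts, with underlying category $(\mathbf C,\otimes,I,\multimap,+,0)$; a $\mathbf V$-adjunction $(-\odot I)\dashv\mathscr C(I,-)$ between $\mathscr V$ and $\mathscr C$ whose underlying adjunction $F\dashv G$ (unit $\eta$, counit $\epsilon$) is a symmetric monoidal adjunction, with $F$ strong symmetric monoidal; a symmetric monoidal category $\mathbf M$ and a strong symmetric monoidal functor $E:\mathbf M\to\mathbf C$. Put $!=FG$. There are isomorphisms $G(A\multimap B)=\mathscr C(I,A\multimap B)\cong\mathscr C(A,B)$ and $\Psi:\mathbf C(A,B)\cong\mathbf C(I,A\multimap B)\cong\mathbf C(F1,A\multimap B)\cong\mathbf V(1,G(A\multimap B))\cong\mathbf V(1,\mathscr C(A,B))$. *Types.* Fix a set $W$ of wire types $\alpha$ with objects $[\![\alpha]\!]_{\mathbf M}$ of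 $\mathbf M$. M-types are $T,U::=\alpha\mid I\mid T\otimes U$; types are $A,B::=0\mid A+B\mid I\mid A\otimes B\mid A\multimap B\mid{!A}\mid\alpha\mid\mathrm{Diag}(T,U)$; intuitionistic types are $P,R::=0\mid P+R\mid I\mid P\otimes R\mid{!A}\mid\mathrm{Diag}(T,U)$. Types are interpreted in $\mathbf C$ by $[\![\alpha]\!]=E[\![\alpha]\!]_{\mathbf M}$, $[\![\mathrm{Diag}(T,U)]\!]=F(\mathscr C([\![T]\!],[\![U]\!]))$, and by the operation of $\mathbf C$ of the same name in the other cases. For $P$ intuitionistic there is a canonical isomorphism $[\![P]\!]\cong F(X_P)$, defined by induction on $P$; it induces discarding $\diamond:[\![P]\!]\to I$, copying $\Delta:[\![P]\!]\to[\![P]\!]\otimes[\![P]\!]$ and $\mathbf{lift}:[\![P]\!]\to{![\![P]\!]}$ as $F$ of $X_P\to1$, of the diagonal, and of $\eta_{X_P}$. A morphism $[\![P]\!]\to[\![R]\!]$ is intuitionistic if, up to the canonical isomorphisms, it is $F(f')$ for some $f':X_P\to X_R$. *Diagrams.* A label context $Q=\ell_1:\alpha_1,\dots,\ell_n:\alpha_n$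 is a function from a finite subset of a countably infinite set of labels to $W$; $[\![Q]\!]_{\mathbf M}$ and $[\![Q]\!]$ are the tensor products of the interpretations of the $\alpha_i$. A labelled string diagram $S:Q\to Q'$ is a morphism $[\![Q]\!]_{\mathbf M}\to[\![Q']\!]_{\mathbf M}$, and $[\![S]\!]:[\![Q]\!]\cong E[\![Q]\!]_{\mathbf M}\xrightarrow{E(S)}E[\![Q']\!]_{\mathbf M}\cong[\![Q']\!]$. *Terms.* Fix a set of constants $c$, each with a type $A_c$ and an interpretation $[\![c]\!]:I\to[\![A_c]\!]$ which is an intuitionistic morphism whenever $A_c$ is an intuitionistic type. Terms, up to renaming of bound variables, are $x$, $c$, $\mathrm{let}\,x=m\,\mathrm{in}\,n$, $\square_Cm$, $\mathrm{left}_{A,B}m$, $\mathrm{right}_{A,B}m$, $\mathrm{case}\,m\,\mathrm{of}\,\{\mathrm{left}\,x\to n\mid\mathrm{right}\,y\to p\}$, $*$, $m;n$, $\langle m,n\rangle$, $\mathrm{let}\,\langle x,y\rangle=m\,\mathrm{in}\,n$, $\lambda x^A.m$, $mn$, $\mathrm{lift}\,m$, $\mathrm{force}\,m$, $\ell$, $\mathrm{box}_Tm$,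 $\mathrm{apply}(m,n)$, $(\vec\ell,S,\vec\ell')$, where label tuples are $\vec\ell,\vec k::=\ell\mid*\mid\langle\vec\ell,\vec k\rangle$. *Typing* $\Gamma;Q\vdash m:A$. Let $\Phi$ range over variable contexts with only intuitionistic types. Axioms: $\Phi,x:A;\emptyset\vdash x:A$; $\Phi;\ell:\alpha\vdash\ell:\alpha$; $\Phi;\emptyset\vdash c:A_c$; $\Phi;\emptyset\vdash*:I$; and $\Phi;\emptyset\vdash(\vec\ell,S,\vec\ell'):\mathrm{Diag}(T,U)$ if $S:Q\to Q'$, $\emptyset;Q\vdash\vec\ell:T$ and $\emptyset;Q'\vdash\vec\ell':U$. Rules with one premise keep $\Gamma;Q$: from $m:0$ infer $\square_Cm:C$; from $m:A$ (resp. $m:B$) infer $\mathrm{left}_{A,B}m:A+B$ (resp. $\mathrm{right}_{A,B}m:A+B$); from $\Gamma,x:A;Q\vdash m:B$ infer $\lambda x^A.m:A\multimap B$; from $m:{!A}$ infer $\mathrm{force}\,m:A$; from $m:{!(T\multimap U)}$ infer $\mathrm{box}_Tm:\mathrm{Diag}(T,U)$; and from $\Phi;\emptyset\vdash m:A$ infer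 $\Phi;\emptyset\vdash\mathrm{lift}\,m:{!A}$. The other rules have conclusion in $\Phi,\Gamma_1,\Gamma_2;Q_1,Q_2$ (disjoint unions), first premise in $\Phi,\Gamma_1;Q_1$ and remaining premises in $\Phi,\Gamma_2;Q_2$ (plus bound variables); they are the usual ones for $\mathrm{let}$, $\mathrm{case}$, $m;n$ (with $m:I$), pairs, $\mathrm{let}\,\langle x,y\rangle$ and application, and $m:\mathrm{Diag}(T,U)$, $n:T$ give $\mathrm{apply}(m,n):U$. *Denotation.* A derivation of $\Gamma;Q\vdash m:A$ is interpreted by a morphism $[\![\Gamma]\!]\otimes[\![Q]\!]\to[\![A]\!]$ of $\mathbf C$, by induction. In rules with several premises $[\![\Phi]\!]$ is copied by $\Delta$ and the factors are distributed by symmetries; axioms discard $[\![\Phi]\!]$ by $\diamond$; linear connectives and sums are interpreted by the structure of $\mathbf C$; $[\![\mathrm{lift}\,m]\!]={![\![m]\!]}\circ\mathbf{lift}$ and $[\![\mathrm{force}\,m]\!]=\epsilon\circ[\![m]\!]$; $[\![\mathrm{box}_Tm]\!]$ is $[\![m]\!]$ followed by $!([\![T]\!]\multimap[\![U]\!])\cong[\![\mathrm{Diag}(T,U)]\!]$;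 $[\![\mathrm{apply}(m,n)]\!]$ is $[\![m]\!]\otimes[\![n]\!]$ followed by the inverse of this isomorphism, $\epsilon$ and evaluation; and $[\![(\vec\ell,S,\vec\ell')]\!]$ is $[\![\Phi]\!]\xrightarrow{\diamond}I\cong F1\xrightarrow{F(\Psi([\![\vec\ell']\!]\circ[\![S]\!]\circ[\![\vec\ell]\!]^{-1}))}[\![\mathrm{Diag}(T,U)]\!]$. *Configurations.* A configuration is a pair $(S,m)$ of a labelled string diagram and a term. $Q\vdash(S,m):A;Q'$ means that there is $Q''$ disjoint from $Q'$ with $S:Q\to Q''\cup Q'$ and $\emptyset;Q''\vdash m:A$; its interpretation $[\![(S,m)]\!]$ is $[\![Q]\!]\xrightarrow{[\![S]\!]}[\![Q'']\!]\otimes[\![Q']\!]\xrightarrow{[\![m]\!]\otimes\mathrm{id}}[\![A]\!]\otimes[\![Q']\!].$ *Evaluation* $(S,m)\Downarrow(S',v)$ is the least relation closed under the following rules. The terms $c$, $*$, $\ell$, $\lambda x^A.m$, $\mathrm{lift}\,m$, $(\vec\ell,D,\vec\ell')$ evaluate to themselves, leaving $S$ unchanged; $\mathrm{let}$, $\mathrm{left}$,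 $\mathrm{right}$, $\mathrm{case}$, $m;n$, pairs, $\mathrm{let}\,\langle x,y\rangle$ and application follow the standard call-by-value left-to-right rules, threading the diagram; if $(S,m)\Downarrow(S',\mathrm{lift}\,m')$ and $(S',m')\Downarrow(S'',v)$, then $(S,\mathrm{force}\,m)\Downarrow(S'',v)$; if $(S,m)\Downarrow(S',\mathrm{lift}\,n)$, $\emptyset;Q_0\vdash\vec\ell:T$ with fresh labels, and $(\mathrm{id}_{Q_0},n\vec\ell)\Downarrow(D,\vec\ell')$, then $(S,\mathrm{box}_Tm)\Downarrow(S',(\vec\ell,D,\vec\ell'))$; if $(S,m)\Downarrow(S',(\vec\ell,D,\vec\ell'))$ and $(S',n)\Downarrow(S'',\vec k)$, then $(S,\mathrm{apply}(m,n))\Downarrow(S''',\vec k')$ whenever the labels of $\vec\ell$, $\vec\ell'$ are exactly the inputs and the outputs of $D$, $(\vec k,D',\vec k')$ is a renaming of $(\vec\ell,D,\vec\ell')$ with $\vec k'$ fresh, the labels of $\vec k$ are among the outputs of $S''$, and $S'''$ is $S''$ followed by $D'$ on these outputs and the identity on the others. *Claim.* In every ECLNL model: if $Q\vdash(S,m):A;Q'$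 and $(S,m)\Downarrow(S',v)$, then $Q\vdash(S',v):A;Q'$ and $$[\![(S,m)]\!]=[\![(S',v)]\!]:[\![Q]\!]\to[\![A]\!]\otimes[\![Q']\!],$$ for all choices of the derivations of the two judgements by which the two sides are defined. -/

import Mathlib

open CategoryTheory MonoidalCategory Limits Opposite

universe v u v₁ u₁ v₂ u₂ v₃ u₃ w k

namespace ECLNL

/-! ## Enriched category theory

`EnrichedOrdinaryCategory V C` (Mathlib) is a `V`-category together with its underlying ordinary
category `C`; `X ⟶[V] Y` is the hom object. Enriched structure is put on ordinary functors,
adjunctions, ... ; the ordinary datum is always required to be the underlying one. -/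

section Enriched

-- the self-enrichment of a monoidal closed category
attribute [local instance] MonoidalClosed.enrichedCategorySelf
  MonoidalClosed.enrichedOrdinaryCategorySelf

variable (V : Type u) [Category.{v} V] [MonoidalCategory V]

/-- A `V`-functor whose underlying functor is `F`. -/
structure VFunctor {A : Type u₁} [Category.{v₁} A] [EnrichedOrdinaryCategory V A]
    {B : Type u₂} [Category.{v₂} B] [EnrichedOrdinaryCategory V B] (F : A ⥤ B) where
  map (X Y : A) : (X ⟶[V] Y) ⟶ (F.obj X ⟶[V] F.obj Y)
  map_id (X : A) : eId V X ≫ map X X = eId V (F.obj X)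
  map_comp (X Y Z : A) :
    eComp V X Y Z ≫ map X Z = (map X Y ⊗ₘ map Y Z) ≫ eComp V (F.obj X) (F.obj Y) (F.obj Z)
  map_underlying {X Y : A} (f : X ⟶ Y) : eHomEquiv V (F.map f) = eHomEquiv V f ≫ map X Y

/-- A `V`-adjunction between `V`-functors whose underlying adjunction is `adj`: isomorphisms
`ℬ(F X, Y) ≅ 𝒜(X, G Y)` that are `V`-natural in `X` and in `Y`. -/
structure VAdjunction {A : Type u₁} [Category.{v₁} A] [EnrichedOrdinaryCategory V A]
    {B : Type u₂} [Category.{v₂} B] [EnrichedOrdinaryCategory V B] {F : A ⥤ B} {G : B ⥤ A}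
    (Fe : VFunctor V F) (Ge : VFunctor V G) (adj : F ⊣ G) where
  homIso (X : A) (Y : B) : (F.obj X ⟶[V] Y) ≅ (X ⟶[V] G.obj Y)
  natural_left (X' X : A) (Y : B) :
    (Fe.map X' X ▷ (F.obj X ⟶[V] Y)) ≫ eComp V _ _ _ ≫ (homIso X' Y).hom =
      ((X' ⟶[V] X) ◁ (homIso X Y).hom) ≫ eComp V _ _ _
  natural_right (X : A) (Y Y' : B) :
    eComp V _ _ _ ≫ (homIso X Y').hom =
      ((homIso X Y).hom ⊗ₘ Ge.map Y Y') ≫ eComp V _ _ _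
  underlying {X : A} {Y : B} (f : F.obj X ⟶ Y) :
    eHomEquiv V (adj.homEquiv X Y f) = eHomEquiv V f ≫ (homIso X Y).hom

/-- A `V`-copower `X ⊙ A`: an object with isomorphisms `𝒞(X ⊙ A, B) ≅ 𝒱(X, 𝒞(A, B))`,
`V`-natural in `B`. Naturality is stated on `𝒞(X ⊙ A, B) ⊗ 𝒞(B, B')`. -/
structure VCopower [MonoidalClosed V] {C : Type u₁} [Category.{v₁} C]
    [EnrichedOrdinaryCategory V C] (X : V) (A : C) where
  obj : C
  iso (B : C) : (obj ⟶[V] B) ≅ (ihom X).obj (A ⟶[V] B)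
  natural (B B' : C) :
    eComp V obj B B' ≫ (iso B').hom =
      ((iso B).hom ⊗ₘ MonoidalClosed.curry (eComp V A B B')) ≫ MonoidalClosed.comp X _ _

/-- The finite coproducts of `C` are `V`-coproducts: precomposition with the injections
exhibits `𝒞(0, X)` as a terminal object and `𝒞(A + B, X)` as a product of `𝒞(A, X)` and
`𝒞(B, X)`. (The precomposition maps are `V`-natural in `X`, and by the enriched Yoneda lemma
every `V`-natural isomorphism of this shape arises so.) -/
structure VCoproducts (C : Type u₁) [Category.{v₁} C] [EnrichedOrdinaryCategory V C]
    [HasFiniteCoproducts C] : Prop where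
  initial (X : C) : Nonempty (IsTerminal ((⊥_ C) ⟶[V] X : V))
  binary (A B X : C) : Nonempty (IsLimit (BinaryFan.mk
    (eHomWhiskerRight V (coprod.inl : A ⟶ A ⨿ B) X)
    (eHomWhiskerRight V (coprod.inr : B ⟶ A ⨿ B) X)))

/-- A `V`-symmetric monoidal structure with underlying symmetric monoidal category `C`:
the tensor product is a `V`-functor `𝒞 ⊗ 𝒞 → 𝒞`, and the associator, the unitors and the braiding
are `V`-natural. -/
structure VSymmetricMonoidal [BraidedCategory V] (C : Type u₁) [Category.{v₁} C]
    [EnrichedOrdinaryCategory V C] [MonoidalCategory C] [SymmetricCategory C] where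
  tensor (X X' Y Y' : C) : (X ⟶[V] X') ⊗ (Y ⟶[V] Y') ⟶ ((X ⊗ Y) ⟶[V] (X' ⊗ Y'))
  tensor_id (X Y : C) :
    (eId V X ⊗ₘ eId V Y) ≫ tensor X X Y Y = (λ_ (𝟙_ V)).hom ≫ eId V (X ⊗ Y)
  tensor_comp (X X' X'' Y Y' Y'' : C) :
    (tensor X X' Y Y' ⊗ₘ tensor X' X'' Y' Y'') ≫ eComp V _ _ _ =
      tensorμ _ _ _ _ ≫ (eComp V X X' X'' ⊗ₘ eComp V Y Y' Y'') ≫ tensor X X'' Y Y''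
  tensor_underlying {X X' Y Y' : C} (f : X ⟶ X') (g : Y ⟶ Y') :
    (eHomEquiv V f ⊗ₘ eHomEquiv V g) ≫ tensor X X' Y Y' =
      (λ_ (𝟙_ V)).hom ≫ eHomEquiv V (f ⊗ₘ g)
  associator_natural (X X' Y Y' Z Z' : C) :
    (tensor X X' Y Y' ▷ _) ≫ tensor _ _ Z Z' ≫ eHomWhiskerLeft V _ (α_ X' Y' Z').hom =
      (α_ _ _ _).hom ≫ (_ ◁ tensor Y Y' Z Z') ≫ tensor X X' _ _ ≫
        eHomWhiskerRight V (α_ X Y Z).hom _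
  leftUnitor_natural (X X' : C) :
    (λ_ (X ⟶[V] X')).inv ≫ (eId V (𝟙_ C) ▷ _) ≫ tensor _ _ X X' ≫
      eHomWhiskerLeft V _ (λ_ X').hom = eHomWhiskerRight V (λ_ X).hom X'
  rightUnitor_natural (X X' : C) :
    (ρ_ (X ⟶[V] X')).inv ≫ (_ ◁ eId V (𝟙_ C)) ≫ tensor X X' _ _ ≫
      eHomWhiskerLeft V _ (ρ_ X').hom = eHomWhiskerRight V (ρ_ X).hom X'
  braiding_natural (X X' Y Y' : C) :
    tensor X X' Y Y' ≫ eHomWhiskerLeft V _ (β_ X' Y').hom =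
      (β_ _ _).hom ≫ tensor Y Y' X X' ≫ eHomWhiskerRight V (β_ X Y).hom _

variable {V}

/-- The `V`-functor `A ⊗ -` of a `V`-symmetric monoidal category. -/
def VSymmetricMonoidal.tensorLeft [BraidedCategory V] {C : Type u₁} [Category.{v₁} C]
    [EnrichedOrdinaryCategory V C] [MonoidalCategory C] [SymmetricCategory C]
    (s : VSymmetricMonoidal V C) (A : C) : VFunctor V (MonoidalCategory.tensorLeft A) where
  map X Y := (λ_ (X ⟶[V] Y)).inv ≫ (eId V A ▷ _) ≫ s.tensor A A X Y
  map_id X := by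
    have h := s.tensor_id A X
    rw [tensorHom_def'] at h
    rw [leftUnitor_inv_naturality_assoc, ← Category.assoc (_ ◁ _), h]
    simp
  map_comp X Y Z := by
    have h : (eId V A ⊗ₘ eId V A) ≫ eComp V A A A = (λ_ (𝟙_ V)).hom ≫ eId V A := by
      have := e_id_comp V A A
      rw [tensorHom_def']
      rw [← cancel_epi (λ_ (𝟙_ V)).inv]
      simp [this]
    have h2 := s.tensor_comp A A A X Y Z
    have e : ∀ X Y, (λ_ (X ⟶[V] Y : V)).inv ≫ (eId V A ▷ _) ≫ s.tensor A A X Y =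
      ((λ_ (X ⟶[V] Y : V)).inv ≫ (eId V A ▷ _)) ≫ s.tensor A A X Y := by simp
    rw [e X Y, e Y Z, ← tensorHom_comp_tensorHom, Category.assoc]
    change _ = _ ≫ _ ≫ eComp V (A ⊗ X) (A ⊗ Y) (A ⊗ Z)
    rw [h2, ← tensorHom_comp_tensorHom, Category.assoc]
    simp only [← tensorHom_id]
    rw [tensorμ_natural_assoc, tensorHom_comp_tensorHom_assoc, h, tensorHom_id,
      leftUnitor_inv_naturality_assoc, MonoidalCategory.id_tensorHom,
      ← tensorHom_def'_assoc]
    have h3 : ((λ_ (X ⟶[V] Y : V)).inv ⊗ₘ (λ_ (Y ⟶[V] Z : V)).inv) ≫ tensorμ _ _ _ _ ≫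
        ((λ_ (𝟙_ V)).hom ▷ _) = (λ_ _).inv := by
      rw [tensorμ, braiding_tensorUnit_right]
      monoidal
    rw [← h3, MonoidalCategory.whiskerLeft_id, Category.id_comp]
    simp only [MonoidalCategory.tensorHom_def, comp_whiskerRight, Category.assoc]
  map_underlying {X Y} f := by
    have h := s.tensor_underlying (𝟙 A) f
    rw [tensorHom_def', eHomEquiv_id, id_tensorHom] at h
    rw [leftUnitor_inv_naturality_assoc, ← Category.assoc (_ ◁ _), h]
    simp

lemma eCoyoneda_id [MonoidalClosed V] {C : Type u₁} [Category.{v₁} C]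
    [EnrichedOrdinaryCategory V C] (A X : C) :
    eId V X ≫ MonoidalClosed.curry (eComp V A X X) = MonoidalClosed.id (A ⟶[V] X) := by
  have := e_comp_id V A X
  rw [MonoidalClosed.id_eq, ← MonoidalClosed.curry_natural_left]
  congr 1
  rw [← cancel_epi (ρ_ _).inv, this]
  simp

lemma eCoyoneda_comp [MonoidalClosed V] {C : Type u₁} [Category.{v₁} C]
    [EnrichedOrdinaryCategory V C] (A X Y Z : C) :
    eComp V X Y Z ≫ MonoidalClosed.curry (eComp V A X Z) =
      (MonoidalClosed.curry (eComp V A X Y) ⊗ₘ MonoidalClosed.curry (eComp V A Y Z)) ≫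
        MonoidalClosed.comp _ _ _ := by
  apply MonoidalClosed.uncurry_injective
  rw [MonoidalClosed.uncurry_natural_left, MonoidalClosed.uncurry_curry,
    MonoidalClosed.uncurry_natural_left, MonoidalClosed.comp_eq, MonoidalClosed.uncurry_curry,
    MonoidalClosed.compTranspose_eq, MonoidalCategory.tensorHom_def, MonoidalCategory.whiskerLeft_comp,
    Category.assoc, associator_inv_naturality_right_assoc, whisker_exchange_assoc,
    associator_inv_naturality_middle_assoc, ← comp_whiskerRight_assoc,
    ← MonoidalClosed.uncurry_eq, MonoidalClosed.uncurry_curry]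
  dsimp only [Functor.id_obj]
  rw [← MonoidalClosed.uncurry_eq, MonoidalClosed.uncurry_curry, e_assoc]

lemma eCoyoneda_underlying [MonoidalClosed V] {C : Type u₁} [Category.{v₁} C]
    [EnrichedOrdinaryCategory V C] (A : C) {X Y : C} (f : X ⟶ Y) :
    MonoidalClosed.curry' (eHomWhiskerLeft V A f) =
      eHomEquiv V f ≫ MonoidalClosed.curry (eComp V A X Y) := by
  rw [← MonoidalClosed.curry_natural_left, MonoidalClosed.curry', eHomWhiskerLeft]
  simp

/-- The `V`-functor `𝒞(A, -) : 𝒞 → 𝒱` into the self-enrichment of `V`. -/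
def eCoyonedaVFunctor [MonoidalClosed V] {C : Type u₁} [Category.{v₁} C]
    [EnrichedOrdinaryCategory V C] (A : C) : VFunctor V (eCoyoneda V A) where
  map X Y := MonoidalClosed.curry (eComp V A X Y)
  map_id X := eCoyoneda_id A X
  map_comp X Y Z := eCoyoneda_comp A X Y Z
  map_underlying f := eCoyoneda_underlying A f

end Enriched

/-! ## Models -/

section Models

attribute [local instance] MonoidalClosed.enrichedCategorySelf
  MonoidalClosed.enrichedOrdinaryCategorySelf

/-- An enriched CLNL model on a cartesian closed category `V` (with its self-enrichment) and a
`V`-category with underlying category `C`. The functor `F` is (the underlying functor of)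
`- ⊙ I`: by `eadj`, `F X` is a `V`-copower of the tensor unit `I` by `X`, `V`-naturally in `X`.
Its right adjoint is (the underlying functor of) `𝒞(I, -)`. -/
structure EnrichedCLNLModel
    (V : Type u₁) [Category.{v₁} V] [CartesianMonoidalCategory V] [BraidedCategory V]
    [MonoidalClosed V] [HasFiniteCoproducts V]
    (C : Type u₂) [Category.{v₂} C] [EnrichedOrdinaryCategory V C] [MonoidalCategory C]
    [SymmetricCategory C] [MonoidalClosed C] [HasFiniteCoproducts C] where
  vCoproducts : VCoproducts V V
  symmetricMonoidal : VSymmetricMonoidal V C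
  /-- the internal hom is a `V`-functor, -/
  ihomVFunctor (A : C) : VFunctor V (ihom A)
  /-- which is right `V`-adjoint to tensoring with `A`. -/
  ihomVAdjunction (A : C) :
    VAdjunction V (symmetricMonoidal.tensorLeft A) (ihomVFunctor A) (ihom.adjunction A)
  copower (X : V) (A : C) : VCopower V X A
  coproducts : VCoproducts V C
  F : V ⥤ C
  FVFunctor : VFunctor V F
  adj : F ⊣ eCoyoneda V (𝟙_ C)
  eadj : VAdjunction V FVFunctor (eCoyonedaVFunctor (𝟙_ C)) adj
  /-- `F` is strong symmetric monoidal, -/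
  braidedF : F.Braided
  /-- its right adjoint is lax symmetric monoidal, -/
  laxBraidedG : (eCoyoneda V (𝟙_ C)).LaxBraided
  /-- and the adjunction is monoidal. -/
  isMonoidal_adj : adj.IsMonoidal

/-- An ECLNL model: an enriched CLNL model, a symmetric monoidal category `M` and a strong
symmetric monoidal functor `E : M ⥤ C`. -/
structure Model
    (V : Type u₁) [Category.{v₁} V] [CartesianMonoidalCategory V] [BraidedCategory V]
    [MonoidalClosed V] [HasFiniteCoproducts V]
    (C : Type u₂) [Category.{v₂} C] [EnrichedOrdinaryCategory V C] [MonoidalCategory C]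
    [SymmetricCategory C] [MonoidalClosed C] [HasFiniteCoproducts C]
    (M : Type u₃) [Category.{v₃} M] [MonoidalCategory M] [SymmetricCategory M]
    extends EnrichedCLNLModel V C where
  E : M ⥤ C
  braidedE : E.Braided

end Models

/-! ## Tensor products of lists and shuffles -/

section Lists

variable {α : Type w}

/-- `Shuffle l l₁ l₂`: the list `l` is an interleaving of `l₁` and `l₂`. -/
inductive Shuffle : List α → List α → List α → Type w
  | nil : Shuffle [] [] []
  | left (a : α) {l l₁ l₂ : List α} : Shuffle l l₁ l₂ → Shuffle (a :: l) (a :: l₁) l₂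
  | right (a : α) {l l₁ l₂ : List α} : Shuffle l l₁ l₂ → Shuffle (a :: l) l₁ (a :: l₂)

variable {D : Type u} [Category.{v} D] [MonoidalCategory D]

/-- `f a₁ ⊗ (f a₂ ⊗ ( ⋯ ⊗ I))`. -/
def tensorList (f : α → D) : List α → D
  | [] => 𝟙_ D
  | a :: l => f a ⊗ tensorList f l

/-- The symmetry `X ⊗ (Y ⊗ Z) ≅ Y ⊗ (X ⊗ Z)`. -/
def swapIso [BraidedCategory D] (X Y Z : D) : X ⊗ (Y ⊗ Z) ≅ Y ⊗ (X ⊗ Z) :=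
  (α_ X Y Z).symm ≪≫ whiskerRightIso (β_ X Y) Z ≪≫ α_ Y X Z

/-- The canonical isomorphism that reorders the tensor factors along a shuffle. -/
def Shuffle.iso [BraidedCategory D] (f : α → D) : {l l₁ l₂ : List α} → Shuffle l l₁ l₂ →
    (tensorList f l ≅ tensorList f l₁ ⊗ tensorList f l₂)
  | _, _, _, .nil => (λ_ (𝟙_ D)).symm
  | _, _, _, .left a s => whiskerLeftIso (f a) (s.iso f) ≪≫ (α_ _ _ _).symm
  | _, _, _, .right a s => whiskerLeftIso (f a) (s.iso f) ≪≫ swapIso _ _ _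

/-- A strong monoidal functor preserves tensor products of lists. -/
def tensorListIso {D' : Type u₁} [Category.{v₁} D'] [MonoidalCategory D'] (E : D ⥤ D')
    [E.Monoidal] (f : α → D) : (l : List α) →
      (tensorList (fun a => E.obj (f a)) l ≅ E.obj (tensorList f l))
  | [] => Functor.Monoidal.εIso E
  | _ :: l => whiskerLeftIso _ (tensorListIso E f l) ≪≫ Functor.Monoidal.μIso E _ _

end Lists

/-! ## Types, label contexts and labelled string diagrams -/

section Calculus

/-- M-types: `T, U ::= α | I | T ⊗ U`. -/
inductive MTy (W : Type w) : Type w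
  | wire (α : W)
  | unit
  | tensor (T U : MTy W)

/-- Types: `A, B ::= 0 | A + B | I | A ⊗ B | A ⊸ B | !A | α | Diag(T, U)`. -/
inductive Ty (W : Type w) : Type w
  | zero
  | sum (A B : Ty W)
  | unit
  | tensor (A B : Ty W)
  | lolli (A B : Ty W)
  | bang (A : Ty W)
  | wire (α : W)
  | diag (T U : MTy W)

/-- M-types are types. -/
def MTy.toTy {W : Type w} : MTy W → Ty W
  | .wire α => .wire α
  | .unit => .unit
  | .tensor T U => .tensor T.toTy U.toTy

/-- Intuitionistic types: `P, R ::= 0 | P + R | I | P ⊗ R | !A | Diag(T, U)`. -/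
def Ty.IsInt {W : Type w} : Ty W → Prop
  | .zero => True
  | .sum A B => A.IsInt ∧ B.IsInt
  | .unit => True
  | .tensor A B => A.IsInt ∧ B.IsInt
  | .lolli _ _ => False
  | .bang _ => True
  | .wire _ => False
  | .diag _ _ => True

/-- A label context: a function from a finite set of labels to wire types, given by its graph,
listed in increasing order of the labels. The countably infinite set of labels is `ℕ`. -/
@[ext] structure LabelCtx (W : Type w) where
  entries : List (ℕ × W)
  sorted : entries.Pairwise (fun a b => a.1 < b.1)

namespace LabelCtx

variable {W : Type w}

/-- The empty label context. -/
def empty : LabelCtx W := ⟨[], List.Pairwise.nil⟩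

/-- The label context `ℓ : α`. -/
def single (ℓ : ℕ) (α : W) : LabelCtx W := ⟨[(ℓ, α)], List.pairwise_singleton _ _⟩

/-- The domain of a label context. -/
def labels (Q : LabelCtx W) : Set ℕ := {ℓ | ∃ α, (ℓ, α) ∈ Q.entries}

/-- `Q.Split Q₁ Q₂`: `Q` is the union of the disjoint label contexts `Q₁` and `Q₂`. -/
abbrev Split (Q Q₁ Q₂ : LabelCtx W) : Type w := Shuffle Q.entries Q₁.entries Q₂.entries

/-- `⟦Q⟧ = ⟦α₁⟧ ⊗ ⋯ ⊗ ⟦αₙ⟧`, for a given interpretation of the wire types. -/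
def den {D : Type u} [Category.{v} D] [MonoidalCategory D] (f : W → D) (Q : LabelCtx W) : D :=
  tensorList (fun e : ℕ × W => f e.2) Q.entries

/-- `⟦Q₁, Q₂⟧ ≅ ⟦Q₁⟧ ⊗ ⟦Q₂⟧`. -/
def splitIso {D : Type u} [Category.{v} D] [MonoidalCategory D] [BraidedCategory D] (f : W → D)
    {Q Q₁ Q₂ : LabelCtx W} (s : Q.Split Q₁ Q₂) : Q.den f ≅ Q₁.den f ⊗ Q₂.den f :=
  Shuffle.iso (fun e : ℕ × W => f e.2) s

end LabelCtx

/-- Interpretation of M-types, for a given interpretation of the wire types. -/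
def MTy.den {D : Type u} [Category.{v} D] [MonoidalCategory D] {W : Type w} (f : W → D) :
    MTy W → D
  | .wire α => f α
  | .unit => 𝟙_ D
  | .tensor T U => T.den f ⊗ U.den f

/-- Label tuples: `ℓ⃗, k⃗ ::= ℓ | * | ⟨ℓ⃗, k⃗⟩`. -/
inductive LTuple : Type
  | label (ℓ : ℕ)
  | star
  | pair (l k : LTuple)

/-- Typing `∅; Q ⊢ ℓ⃗ : T` of label tuples: the rules (label), (*) and (pair). -/
inductive LTyping {W : Type w} : LabelCtx W → LTuple → MTy W → Type w
  | label (ℓ : ℕ) (α : W) : LTyping (.single ℓ α) (.label ℓ) (.wire α)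
  | star : LTyping .empty .star .unit
  | pair {Q Q₁ Q₂ : LabelCtx W} {l k : LTuple} {T U : MTy W} (s : Q.Split Q₁ Q₂) :
      LTyping Q₁ l T → LTyping Q₂ k U → LTyping Q (.pair l k) (.tensor T U)

/-- The isomorphism `⟦ℓ⃗⟧ : ⟦Q⟧ ≅ ⟦T⟧`. -/
def LTyping.iso {D : Type u} [Category.{v} D] [MonoidalCategory D] [BraidedCategory D]
    {W : Type w} (f : W → D) : {Q : LabelCtx W} → {l : LTuple} → {T : MTy W} →
      LTyping Q l T → (Q.den f ≅ T.den f)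
  | _, _, _, .label _ α => ρ_ (f α)
  | _, _, _, .star => Iso.refl (𝟙_ D)
  | _, _, _, .pair s h h' => LabelCtx.splitIso f s ≪≫ (h.iso f ⊗ᵢ h'.iso f)

/-- The wire types with their interpretation in the objects of `M`, and the constants of the
language with their types. -/
structure Signature (M : Type u₃) where
  W : Type w
  wire : W → M
  Const : Type k
  constTy : Const → Ty W

variable {M : Type u₃} [Category.{v₃} M] [MonoidalCategory M]

/-- The morphisms `Q ⟶ Q'` of the category `M_L` of labelled string diagrams. -/
abbrev DiagramHom (Sg : Signature.{u₃, w, k} M) (Q Q' : LabelCtx Sg.W) : Type v₃ :=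
  Q.den Sg.wire ⟶ Q'.den Sg.wire

/-- A labelled string diagram, with arbitrary inputs and outputs. -/
structure LDiagram (Sg : Signature.{u₃, w, k} M) where
  dom : LabelCtx Sg.W
  cod : LabelCtx Sg.W
  hom : DiagramHom Sg dom cod

/-- A labelled string diagram with inputs `Q`. -/
structure Diagram (Sg : Signature.{u₃, w, k} M) (Q : LabelCtx Sg.W) where
  cod : LabelCtx Sg.W
  hom : DiagramHom Sg Q cod

/-- The identity diagram. -/
def Diagram.id (Sg : Signature.{u₃, w, k} M) (Q : LabelCtx Sg.W) : Diagram Sg Q := ⟨Q, 𝟙 _⟩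

/-! ## Terms

Terms are taken up to renaming of bound variables: variables are de Bruijn indices. -/

/-- Terms. In `let_ m n`, `lam A m` and the branches of `case` one variable is bound;
`letPair m n` is `let ⟨x, y⟩ = m in n`, where `y` has index `0` and `x` has index `1` in `n`. -/
inductive Term (Sg : Signature.{u₃, w, k} M) : Type (max v₃ w k)
  | var (i : ℕ)
  | const (c : Sg.Const)
  | let_ (m n : Term Sg)
  | initial (C : Ty Sg.W) (m : Term Sg)
  | left (A B : Ty Sg.W) (m : Term Sg)
  | right (A B : Ty Sg.W) (m : Term Sg)
  | case (m n p : Term Sg)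
  | star
  | seq (m n : Term Sg)
  | pair (m n : Term Sg)
  | letPair (m n : Term Sg)
  | lam (A : Ty Sg.W) (m : Term Sg)
  | app (m n : Term Sg)
  | lift (m : Term Sg)
  | force (m : Term Sg)
  | label (ℓ : ℕ)
  | box (T : MTy Sg.W) (m : Term Sg)
  | apply (m n : Term Sg)
  | diag (l : LTuple) (S : LDiagram Sg) (l' : LTuple)

/-- Label tuples are terms. -/
def LTuple.toTerm (Sg : Signature.{u₃, w, k} M) : LTuple → Term Sg
  | .label ℓ => .label ℓ
  | .star => .star
  | .pair l l' => .pair (l.toTerm Sg) (l'.toTerm Sg)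

/-- The labels that occur in a label tuple. -/
def LTuple.labels : LTuple → Set ℕ
  | .label ℓ => {ℓ}
  | .star => ∅
  | .pair l l' => l.labels ∪ l'.labels

namespace Term

variable {Sg : Signature.{u₃, w, k} M}

/-- The labels that occur in a term. -/
def labels : Term Sg → Set ℕ
  | var _ => ∅
  | const _ => ∅
  | let_ m n => m.labels ∪ n.labels
  | initial _ m => m.labels
  | left _ _ m => m.labels
  | right _ _ m => m.labels
  | case m n p => m.labels ∪ n.labels ∪ p.labels
  | star => ∅
  | seq m n => m.labels ∪ n.labels
  | pair m n => m.labels ∪ n.labels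
  | letPair m n => m.labels ∪ n.labels
  | lam _ m => m.labels
  | app m n => m.labels ∪ n.labels
  | lift m => m.labels
  | force m => m.labels
  | label ℓ => {ℓ}
  | box _ m => m.labels
  | apply m n => m.labels ∪ n.labels
  | diag l S l' => l.labels ∪ S.dom.labels ∪ S.cod.labels ∪ l'.labels

/-- Lift a renaming under a binder. -/
def upr (r : ℕ → ℕ) : ℕ → ℕ
  | 0 => 0
  | i + 1 => r i + 1

/-- Renaming of free variables. -/
def rename : (ℕ → ℕ) → Term Sg → Term Sg
  | r, var i => var (r i)
  | _, const c => const c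
  | r, let_ m n => let_ (rename r m) (rename (upr r) n)
  | r, initial C m => initial C (rename r m)
  | r, left A B m => left A B (rename r m)
  | r, right A B m => right A B (rename r m)
  | r, case m n p => case (rename r m) (rename (upr r) n) (rename (upr r) p)
  | _, star => star
  | r, seq m n => seq (rename r m) (rename r n)
  | r, pair m n => pair (rename r m) (rename r n)
  | r, letPair m n => letPair (rename r m) (rename (upr (upr r)) n)
  | r, lam A m => lam A (rename (upr r) m)
  | r, app m n => app (rename r m) (rename r n)
  | r, lift m => lift (rename r m)
  | r, force m => force (rename r m)
  | _, label ℓ => label ℓ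
  | r, box T m => box T (rename r m)
  | r, apply m n => apply (rename r m) (rename r n)
  | _, diag l S l' => diag l S l'

/-- Lift a substitution under a binder. -/
def ups (σ : ℕ → Term Sg) : ℕ → Term Sg
  | 0 => var 0
  | i + 1 => rename Nat.succ (σ i)

/-- Simultaneous capture-avoiding substitution. -/
def subst : (ℕ → Term Sg) → Term Sg → Term Sg
  | σ, var i => σ i
  | _, const c => const c
  | σ, let_ m n => let_ (subst σ m) (subst (ups σ) n)
  | σ, initial C m => initial C (subst σ m)
  | σ, left A B m => left A B (subst σ m)
  | σ, right A B m => right A B (subst σ m)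
  | σ, case m n p => case (subst σ m) (subst (ups σ) n) (subst (ups σ) p)
  | _, star => star
  | σ, seq m n => seq (subst σ m) (subst σ n)
  | σ, pair m n => pair (subst σ m) (subst σ n)
  | σ, letPair m n => letPair (subst σ m) (subst (ups (ups σ)) n)
  | σ, lam A m => lam A (subst (ups σ) m)
  | σ, app m n => app (subst σ m) (subst σ n)
  | σ, lift m => lift (subst σ m)
  | σ, force m => force (subst σ m)
  | _, label ℓ => label ℓ
  | σ, box T m => box T (subst σ m)
  | σ, apply m n => apply (subst σ m) (subst σ n)
  | _, diag l S l' => diag l S l'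

/-- Extend a substitution by a term for the variable with index `0`. -/
def scons (v : Term Sg) (σ : ℕ → Term Sg) : ℕ → Term Sg
  | 0 => v
  | i + 1 => σ i

/-- `n[v / x]`, where `x` has index `0`. -/
def inst (n v : Term Sg) : Term Sg := subst (scons v var) n

/-- `n[v / x, v' / y]`, where `x` has index `1` and `y` has index `0`. -/
def inst₂ (n v v' : Term Sg) : Term Sg := subst (scons v' (scons v var)) n

end Term

/-! ## Typing

The entries of a variable context are indexed by de Bruijn indices; the entry `none` means that
the variable with this index is not in the domain of the context. -/

/-- Variable contexts. -/
abbrev Ctx (W : Type w) : Type w := List (Option (Ty W))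

/-- Contexts in which all variables are intuitionistic. -/
def Ctx.IsInt {W : Type w} : Ctx W → Prop
  | [] => True
  | none :: Γ => Ctx.IsInt Γ
  | some P :: Γ => P.IsInt ∧ Ctx.IsInt Γ

/-- `CtxSplit Γ Γ₁ Γ₂` decomposes `Γ` as `Φ, Γ₁', Γ₂'` with `Φ` intuitionistic, where
`Γ₁ = Φ, Γ₁'` and `Γ₂ = Φ, Γ₂'`. -/
inductive CtxSplit {W : Type w} : Ctx W → Ctx W → Ctx W → Type w
  | nil : CtxSplit [] [] []
  | absent {Γ Γ₁ Γ₂ : Ctx W} :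
      CtxSplit Γ Γ₁ Γ₂ → CtxSplit (none :: Γ) (none :: Γ₁) (none :: Γ₂)
  | left (A : Ty W) {Γ Γ₁ Γ₂ : Ctx W} :
      CtxSplit Γ Γ₁ Γ₂ → CtxSplit (some A :: Γ) (some A :: Γ₁) (none :: Γ₂)
  | right (A : Ty W) {Γ Γ₁ Γ₂ : Ctx W} :
      CtxSplit Γ Γ₁ Γ₂ → CtxSplit (some A :: Γ) (none :: Γ₁) (some A :: Γ₂)
  | both (P : Ty W) (h : P.IsInt) {Γ Γ₁ Γ₂ : Ctx W} :
      CtxSplit Γ Γ₁ Γ₂ → CtxSplit (some P :: Γ) (some P :: Γ₁) (some P :: Γ₂)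

/-- `VarAt Γ i A`: the context `Γ` is `Φ, x : A` where `Φ` is intuitionistic and `x` has
index `i`. -/
inductive VarAt {W : Type w} : Ctx W → ℕ → Ty W → Type w
  | here {Γ : Ctx W} (A : Ty W) (h : Γ.IsInt) : VarAt (some A :: Γ) 0 A
  | absent {Γ : Ctx W} {i : ℕ} {A : Ty W} : VarAt Γ i A → VarAt (none :: Γ) (i + 1) A
  | skip {Γ : Ctx W} {i : ℕ} {A : Ty W} (P : Ty W) (h : P.IsInt) :
      VarAt Γ i A → VarAt (some P :: Γ) (i + 1) A

/-- Derivations of the typing judgement `Γ; Q ⊢ m : A`. -/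
inductive Typing {Sg : Signature.{u₃, w, k} M} :
    Ctx Sg.W → LabelCtx Sg.W → Term Sg → Ty Sg.W → Type (max v₃ w k)
  | var {Γ i A} (x : VarAt Γ i A) : Typing Γ .empty (.var i) A
  | label {Φ : Ctx Sg.W} (h : Φ.IsInt) (ℓ : ℕ) (α : Sg.W) :
      Typing Φ (.single ℓ α) (.label ℓ) (.wire α)
  | const {Φ : Ctx Sg.W} (h : Φ.IsInt) (c : Sg.Const) :
      Typing Φ .empty (.const c) (Sg.constTy c)
  | let_ {Γ Γ₁ Γ₂} {Q Q₁ Q₂ : LabelCtx Sg.W} {m n A B}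
      (s : CtxSplit Γ Γ₁ Γ₂) (t : Q.Split Q₁ Q₂) :
      Typing Γ₁ Q₁ m A → Typing (some A :: Γ₂) Q₂ n B → Typing Γ Q (.let_ m n) B
  | initial {Γ Q m} (C : Ty Sg.W) : Typing Γ Q m .zero → Typing Γ Q (.initial C m) C
  | left {Γ Q m} (A B : Ty Sg.W) : Typing Γ Q m A → Typing Γ Q (.left A B m) (.sum A B)
  | right {Γ Q m} (A B : Ty Sg.W) : Typing Γ Q m B → Typing Γ Q (.right A B m) (.sum A B)
  | case {Γ Γ₁ Γ₂} {Q Q₁ Q₂ : LabelCtx Sg.W} {m n p A B C}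
      (s : CtxSplit Γ Γ₁ Γ₂) (t : Q.Split Q₁ Q₂) :
      Typing Γ₁ Q₁ m (.sum A B) → Typing (some A :: Γ₂) Q₂ n C → Typing (some B :: Γ₂) Q₂ p C →
        Typing Γ Q (.case m n p) C
  | star {Φ : Ctx Sg.W} (h : Φ.IsInt) : Typing Φ .empty .star .unit
  | seq {Γ Γ₁ Γ₂} {Q Q₁ Q₂ : LabelCtx Sg.W} {m n C}
      (s : CtxSplit Γ Γ₁ Γ₂) (t : Q.Split Q₁ Q₂) :
      Typing Γ₁ Q₁ m .unit → Typing Γ₂ Q₂ n C → Typing Γ Q (.seq m n) C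
  | pair {Γ Γ₁ Γ₂} {Q Q₁ Q₂ : LabelCtx Sg.W} {m n A B}
      (s : CtxSplit Γ Γ₁ Γ₂) (t : Q.Split Q₁ Q₂) :
      Typing Γ₁ Q₁ m A → Typing Γ₂ Q₂ n B → Typing Γ Q (.pair m n) (.tensor A B)
  | letPair {Γ Γ₁ Γ₂} {Q Q₁ Q₂ : LabelCtx Sg.W} {m n A B C}
      (s : CtxSplit Γ Γ₁ Γ₂) (t : Q.Split Q₁ Q₂) :
      Typing Γ₁ Q₁ m (.tensor A B) → Typing (some B :: some A :: Γ₂) Q₂ n C →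
        Typing Γ Q (.letPair m n) C
  | lam {Γ Q m B} (A : Ty Sg.W) :
      Typing (some A :: Γ) Q m B → Typing Γ Q (.lam A m) (.lolli A B)
  | app {Γ Γ₁ Γ₂} {Q Q₁ Q₂ : LabelCtx Sg.W} {m n A B}
      (s : CtxSplit Γ Γ₁ Γ₂) (t : Q.Split Q₁ Q₂) :
      Typing Γ₁ Q₁ m (.lolli A B) → Typing Γ₂ Q₂ n A → Typing Γ Q (.app m n) B
  | lift {Φ : Ctx Sg.W} {m A} (h : Φ.IsInt) :
      Typing Φ .empty m A → Typing Φ .empty (.lift m) (.bang A)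
  | force {Γ Q m A} : Typing Γ Q m (.bang A) → Typing Γ Q (.force m) A
  | box {Γ Q m} {T U : MTy Sg.W} :
      Typing Γ Q m (.bang (.lolli T.toTy U.toTy)) → Typing Γ Q (.box T m) (.diag T U)
  | apply {Γ Γ₁ Γ₂} {Q Q₁ Q₂ : LabelCtx Sg.W} {m n} {T U : MTy Sg.W}
      (s : CtxSplit Γ Γ₁ Γ₂) (t : Q.Split Q₁ Q₂) :
      Typing Γ₁ Q₁ m (.diag T U) → Typing Γ₂ Q₂ n T.toTy → Typing Γ Q (.apply m n) U.toTy
  | diag {Φ : Ctx Sg.W} {l l'} {S : LDiagram Sg} {T U : MTy Sg.W} (h : Φ.IsInt) :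
      LTyping S.dom l T → LTyping S.cod l' U → Typing Φ .empty (.diag l S l') (.diag T U)

/-- `Q ⊢ (S, m) : A; Q'` for a labelled string diagram `S` with inputs `Q`: the outputs of `S` are
the union of disjoint label contexts `Q''` and `Q'`, and `∅; Q'' ⊢ m : A`. -/
structure ConfigTyping {Sg : Signature.{u₃, w, k} M} {Q : LabelCtx Sg.W} (S : Diagram Sg Q)
    (m : Term Sg) (A : Ty Sg.W) (Q' : LabelCtx Sg.W) where
  Q'' : LabelCtx Sg.W
  split : S.cod.Split Q'' Q'
  typing : Typing [] Q'' m A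

/-! ## Operational semantics -/

/-- `append(S, k⃗, ℓ⃗, D, ℓ⃗') = (S', k⃗')`: the labels of `k⃗` are a subset `Qk` of the outputs
of `S`, with remaining outputs `Qr`; the labels of `ℓ⃗` and `ℓ⃗'` are exactly the inputs and the
outputs of `D`, and `(k⃗, D', k⃗')` is a renaming of `(ℓ⃗, D, ℓ⃗')` with `k⃗'` fresh; the diagram `S'`
is `S` followed by `D'` on the wires `Qk` and the identity on the wires `Qr`. -/
inductive Append [SymmetricCategory M] {Sg : Signature.{u₃, w, k} M} {Q : LabelCtx Sg.W}
    (S : Diagram Sg Q) (kt lt : LTuple) (D : LDiagram Sg) (lt' : LTuple) :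
    Diagram Sg Q → LTuple → Prop
  | mk {T U : MTy Sg.W} {Qk Qr Qk' R : LabelCtx Sg.W} {kt' : LTuple}
      (s : S.cod.Split Qk Qr) (s' : R.Split Qk' Qr)
      (hk : LTyping Qk kt T) (hl : LTyping D.dom lt T)
      (hl' : LTyping D.cod lt' U) (hk' : LTyping Qk' kt' U)
      (fresh : ∀ ℓ ∈ Qk'.labels,
        ℓ ∉ Q.labels ∪ S.cod.labels ∪ D.dom.labels ∪ D.cod.labels) :
      Append S kt lt D lt'
        ⟨R, S.hom ≫ (LabelCtx.splitIso Sg.wire s).hom ≫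
          (((hk.iso Sg.wire).hom ≫ (hl.iso Sg.wire).inv ≫ D.hom ≫
            (hl'.iso Sg.wire).hom ≫ (hk'.iso Sg.wire).inv) ▷ Qr.den Sg.wire) ≫
          (LabelCtx.splitIso Sg.wire s').inv⟩ kt'

/-- The evaluation relation `(S, m) ⇓ (S', v)`. The diagrams `S` and `S'` have the same inputs.
In the rule for `box T m`, the pair `(Q₀, l)` is the result of `freshlabels(T)`. -/
inductive Eval [SymmetricCategory M] {Sg : Signature.{u₃, w, k} M} :
    {Q : LabelCtx Sg.W} → Diagram Sg Q → Term Sg → Diagram Sg Q → Term Sg → Prop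
  | const {Q} {S : Diagram Sg Q} (c) : Eval S (.const c) S (.const c)
  | let_ {Q} {S S' S'' : Diagram Sg Q} {m n v w} :
      Eval S m S' v → Eval S' (n.inst v) S'' w → Eval S (.let_ m n) S'' w
  | left {Q} {S S' : Diagram Sg Q} {A B m v} :
      Eval S m S' v → Eval S (.left A B m) S' (.left A B v)
  | right {Q} {S S' : Diagram Sg Q} {A B m v} :
      Eval S m S' v → Eval S (.right A B m) S' (.right A B v)
  | case_left {Q} {S S' S'' : Diagram Sg Q} {A B m n p v w} :
      Eval S m S' (.left A B v) → Eval S' (n.inst v) S'' w → Eval S (.case m n p) S'' w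
  | case_right {Q} {S S' S'' : Diagram Sg Q} {A B m n p v w} :
      Eval S m S' (.right A B v) → Eval S' (p.inst v) S'' w → Eval S (.case m n p) S'' w
  | star {Q} {S : Diagram Sg Q} : Eval S .star S .star
  | seq {Q} {S S' S'' : Diagram Sg Q} {m n v} :
      Eval S m S' .star → Eval S' n S'' v → Eval S (.seq m n) S'' v
  | pair {Q} {S S' S'' : Diagram Sg Q} {m n v v'} :
      Eval S m S' v → Eval S' n S'' v' → Eval S (.pair m n) S'' (.pair v v')
  | letPair {Q} {S S' S'' : Diagram Sg Q} {m n v v' w} :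
      Eval S m S' (.pair v v') → Eval S' (n.inst₂ v v') S'' w → Eval S (.letPair m n) S'' w
  | lam {Q} {S : Diagram Sg Q} (A m) : Eval S (.lam A m) S (.lam A m)
  | app {Q} {S S' S'' S₃ : Diagram Sg Q} {A m m' n v w} :
      Eval S m S' (.lam A m') → Eval S' n S'' v → Eval S'' (m'.inst v) S₃ w →
        Eval S (.app m n) S₃ w
  | lift {Q} {S : Diagram Sg Q} (m) : Eval S (.lift m) S (.lift m)
  | force {Q} {S S' S'' : Diagram Sg Q} {m m' v} :
      Eval S m S' (.lift m') → Eval S' m' S'' v → Eval S (.force m) S'' v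
  | label {Q} {S : Diagram Sg Q} (ℓ) : Eval S (.label ℓ) S (.label ℓ)
  | box {Q Q₀} {S S' : Diagram Sg Q} {D : Diagram Sg Q₀} {T m n l l'} :
      Eval S m S' (.lift n) → LTyping Q₀ l T →
        (∀ ℓ ∈ Q₀.labels, ℓ ∉ Q.labels ∪ S'.cod.labels ∪ n.labels) →
        Eval (Diagram.id Sg Q₀) (.app n (l.toTerm Sg)) D (LTuple.toTerm Sg l') →
        Eval S (.box T m) S' (.diag l ⟨Q₀, D.cod, D.hom⟩ l')
  | apply {Q} {S S' S'' S₃ : Diagram Sg Q} {m n D l l' kt kt'} :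
      Eval S m S' (.diag l D l') → Eval S' n S'' (LTuple.toTerm Sg kt) →
        Append S'' kt l D l' S₃ kt' → Eval S (.apply m n) S₃ (LTuple.toTerm Sg kt')
  | diag {Q} {S : Diagram Sg Q} (l D l') : Eval S (.diag l D l') S (.diag l D l')

end Calculus

/-! ## Denotational semantics -/

section Semantics

variable {V : Type u₁} [Category.{v₁} V] [CartesianMonoidalCategory V] [BraidedCategory V]
  [MonoidalClosed V] [HasFiniteCoproducts V]
  {C : Type u₂} [Category.{v₂} C] [EnrichedOrdinaryCategory V C] [MonoidalCategory C]
  [SymmetricCategory C] [MonoidalClosed C] [HasFiniteCoproducts C]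
  {M : Type u₃} [Category.{v₃} M] [MonoidalCategory M] [SymmetricCategory M]

instance (𝓜 : EnrichedCLNLModel V C) : 𝓜.F.Braided := 𝓜.braidedF

instance (𝓜 : Model V C M) : 𝓜.E.Braided := 𝓜.braidedE

namespace EnrichedCLNLModel

variable (𝓜 : EnrichedCLNLModel V C)

/-- `G`, the underlying functor of `𝒞(I, -)`. -/
abbrev G (_ : EnrichedCLNLModel V C) : C ⥤ V := eCoyoneda V (𝟙_ C)

/-- `G(A ⊸ B) = 𝒞(I, A ⊸ B) ≅ 𝒞(A ⊗ I, B) ≅ 𝒞(A, B)`. -/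
def homIso (A B : C) : 𝓜.G.obj ((ihom A).obj B) ≅ (A ⟶[V] B) :=
  ((𝓜.ihomVAdjunction A).homIso (𝟙_ C) B).symm ≪≫ Iso.eHomCongr V (ρ_ A) (Iso.refl B)

/-- `Ψ : C(A, B) ≅ C(I, A ⊸ B) ≅ C(F 1, A ⊸ B) ≅ V(1, G(A ⊸ B)) ≅ V(1, 𝒞(A, B))`. -/
def psi {A B : C} (f : A ⟶ B) : 𝟙_ V ⟶ (A ⟶[V] B) :=
  𝓜.adj.homEquiv (𝟙_ V) ((ihom A).obj B)
    (Functor.OplaxMonoidal.η 𝓜.F ≫ MonoidalClosed.curry ((ρ_ A).hom ≫ f)) ≫ (𝓜.homIso A B).hom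

/-- The discarding map, for an isomorphism `A ≅ F X`. -/
def discard {A : C} {X : V} (e : A ≅ 𝓜.F.obj X) : A ⟶ 𝟙_ C :=
  e.hom ≫ 𝓜.F.map (SemiCartesianMonoidalCategory.toUnit X) ≫ Functor.OplaxMonoidal.η 𝓜.F

/-- The copying map, for an isomorphism `A ≅ F X`. -/
def copy {A : C} {X : V} (e : A ≅ 𝓜.F.obj X) : A ⟶ A ⊗ A :=
  e.hom ≫ 𝓜.F.map (CartesianMonoidalCategory.lift (𝟙 X) (𝟙 X)) ≫
    Functor.OplaxMonoidal.δ 𝓜.F X X ≫ (e.inv ⊗ₘ e.inv)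

/-- The map `A ⟶ !A`, for an isomorphism `A ≅ F X`. -/
def lift {A : C} {X : V} (e : A ≅ 𝓜.F.obj X) : A ⟶ 𝓜.F.obj (𝓜.G.obj A) :=
  e.hom ≫ 𝓜.F.map (𝓜.adj.unit.app X) ≫ 𝓜.F.map (𝓜.G.map e.inv)

/-- A morphism is intuitionistic, with respect to isomorphisms `A ≅ F X` and `B ≅ F Y`. -/
def IsIntuitionistic {A B : C} {X Y : V} (e : A ≅ 𝓜.F.obj X) (e' : B ≅ 𝓜.F.obj Y)
    (f : A ⟶ B) : Prop :=
  ∃ f' : X ⟶ Y, f = e.hom ≫ 𝓜.F.map f' ≫ e'.inv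

/-- `0 ≅ F ∅`. -/
noncomputable def zeroIso : ⊥_ C ≅ 𝓜.F.obj (⊥_ V) :=
  initialIsInitial.uniqueUpToIso
    (have := 𝓜.adj.isLeftAdjoint; IsInitial.isInitialObj 𝓜.F _ initialIsInitial)

/-- `F X + F Y ≅ F (X ⨿ Y)`. -/
noncomputable def sumIso (X Y : V) : 𝓜.F.obj X ⨿ 𝓜.F.obj Y ≅ 𝓜.F.obj (X ⨿ Y) :=
  have := 𝓜.adj.isLeftAdjoint
  PreservesColimitPair.iso 𝓜.F X Y

end EnrichedCLNLModel

/-- `[f, g] : (A + B) ⊗ X ⟶ Z` for `f : A ⊗ X ⟶ Z` and `g : B ⊗ X ⟶ Z`. -/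
noncomputable def caseMap {A B X Z : C} (f : A ⊗ X ⟶ Z) (g : B ⊗ X ⟶ Z) : (A ⨿ B) ⊗ X ⟶ Z :=
  (β_ (A ⨿ B) X).hom ≫ MonoidalClosed.uncurry
    (coprod.desc (MonoidalClosed.curry ((β_ X A).hom ≫ f))
      (MonoidalClosed.curry ((β_ X B).hom ≫ g)))

/-- The evaluation `(A ⊸ B) ⊗ A ⟶ B`. -/
def evMap (A B : C) : (ihom A).obj B ⊗ A ⟶ B := (β_ _ _).hom ≫ (ihom.ev A).app B

namespace Model

variable (𝓜 : Model V C M) (Sg : Signature.{u₃, w, k} M)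

/-- The interpretation `⟦α⟧ = E(⟦α⟧_M)` of wire types. -/
abbrev wire (α : Sg.W) : C := 𝓜.E.obj (Sg.wire α)

/-- The interpretation of types. -/
noncomputable def ty : Ty Sg.W → C
  | .zero => ⊥_ C
  | .sum A B => ty A ⨿ ty B
  | .unit => 𝟙_ C
  | .tensor A B => ty A ⊗ ty B
  | .lolli A B => (ihom (ty A)).obj (ty B)
  | .bang A => 𝓜.F.obj (𝓜.G.obj (ty A))
  | .wire α => 𝓜.wire Sg α
  | .diag T U => 𝓜.F.obj (T.den (𝓜.wire Sg) ⟶[V] U.den (𝓜.wire Sg))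

/-- The interpretation of an M-type is its interpretation as a type (all the components of
this isomorphism are identities). -/
noncomputable def mtyIso : (T : MTy Sg.W) → (𝓜.ty Sg T.toTy ≅ T.den (𝓜.wire Sg))
  | .wire α => Iso.refl (𝓜.wire Sg α)
  | .unit => Iso.refl (𝟙_ C)
  | .tensor T U => mtyIso T ⊗ᵢ mtyIso U

/-- For an intuitionistic type `P`, the canonical isomorphism `⟦P⟧ ≅ F X`. -/
noncomputable def intIso : (P : Ty Sg.W) → P.IsInt → Σ X : V, (𝓜.ty Sg P ≅ 𝓜.F.obj X)
  | .zero, _ => ⟨⊥_ V, 𝓜.zeroIso⟩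
  | .sum P R, h => ⟨(intIso P h.1).1 ⨿ (intIso R h.2).1,
      coprod.mapIso (intIso P h.1).2 (intIso R h.2).2 ≪≫ 𝓜.sumIso _ _⟩
  | .unit, _ => ⟨𝟙_ V, Functor.Monoidal.εIso 𝓜.F⟩
  | .tensor P R, h => ⟨(intIso P h.1).1 ⊗ (intIso R h.2).1,
      ((intIso P h.1).2 ⊗ᵢ (intIso R h.2).2) ≪≫ Functor.Monoidal.μIso 𝓜.F _ _⟩
  | .bang A, _ => ⟨𝓜.G.obj (𝓜.ty Sg A), Iso.refl _⟩
  | .diag T U, _ => ⟨T.den (𝓜.wire Sg) ⟶[V] U.den (𝓜.wire Sg), Iso.refl _⟩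

/-- The interpretation of variable contexts. -/
noncomputable def ctx : Ctx Sg.W → C
  | [] => 𝟙_ C
  | none :: Γ => ctx Γ
  | some A :: Γ => 𝓜.ty Sg A ⊗ ctx Γ

/-- For an intuitionistic context `Φ`, the canonical isomorphism `⟦Φ⟧ ≅ F X`. -/
noncomputable def ctxIntIso : (Φ : Ctx Sg.W) → Φ.IsInt → Σ X : V, (𝓜.ctx Sg Φ ≅ 𝓜.F.obj X)
  | [], _ => ⟨𝟙_ V, Functor.Monoidal.εIso 𝓜.F⟩
  | none :: Φ, h => ctxIntIso Φ h
  | some P :: Φ, h => ⟨(𝓜.intIso Sg P h.1).1 ⊗ (ctxIntIso Φ h.2).1,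
      ((𝓜.intIso Sg P h.1).2 ⊗ᵢ (ctxIntIso Φ h.2).2) ≪≫ Functor.Monoidal.μIso 𝓜.F _ _⟩

/-- `⋄ : ⟦P⟧ ⟶ I`. -/
noncomputable def discardTy (P : Ty Sg.W) (h : P.IsInt) : 𝓜.ty Sg P ⟶ 𝟙_ C :=
  𝓜.discard (𝓜.intIso Sg P h).2

/-- `Δ : ⟦P⟧ ⟶ ⟦P⟧ ⊗ ⟦P⟧`. -/
noncomputable def copyTy (P : Ty Sg.W) (h : P.IsInt) : 𝓜.ty Sg P ⟶ 𝓜.ty Sg P ⊗ 𝓜.ty Sg P :=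
  𝓜.copy (𝓜.intIso Sg P h).2

/-- `⋄ : ⟦Φ⟧ ⟶ I`. -/
noncomputable def discardCtx (Φ : Ctx Sg.W) (h : Φ.IsInt) : 𝓜.ctx Sg Φ ⟶ 𝟙_ C :=
  𝓜.discard (𝓜.ctxIntIso Sg Φ h).2

/-- `lift : ⟦Φ⟧ ⟶ !⟦Φ⟧`. -/
noncomputable def liftCtx (Φ : Ctx Sg.W) (h : Φ.IsInt) :
    𝓜.ctx Sg Φ ⟶ 𝓜.F.obj (𝓜.G.obj (𝓜.ctx Sg Φ)) :=
  𝓜.lift (𝓜.ctxIntIso Sg Φ h).2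

/-- `⟦Φ, Γ₁, Γ₂⟧ ⟶ ⟦Φ, Γ₁⟧ ⊗ ⟦Φ, Γ₂⟧`: copy `⟦Φ⟧` and reorder. -/
noncomputable def splitCtx : {Γ Γ₁ Γ₂ : Ctx Sg.W} → CtxSplit Γ Γ₁ Γ₂ →
    (𝓜.ctx Sg Γ ⟶ 𝓜.ctx Sg Γ₁ ⊗ 𝓜.ctx Sg Γ₂)
  | _, _, _, .nil => (λ_ (𝟙_ C)).inv
  | _, _, _, .absent (Γ := Γ) (Γ₁ := Γ₁) (Γ₂ := Γ₂) s => @splitCtx Γ Γ₁ Γ₂ s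
  | _, _, _, .left A s => (𝓜.ty Sg A ◁ splitCtx s) ≫ (α_ _ _ _).inv
  | _, _, _, .right A s => (𝓜.ty Sg A ◁ splitCtx s) ≫ (swapIso _ _ _).hom
  | _, _, _, .both P h s => (𝓜.copyTy Sg P h ⊗ₘ splitCtx s) ≫ tensorμ _ _ _ _

/-- `⟦Φ, x : A⟧ ⟶ ⟦A⟧`: discard `⟦Φ⟧`. -/
noncomputable def lookup : {Γ : Ctx Sg.W} → {i : ℕ} → {A : Ty Sg.W} → VarAt Γ i A →
    (𝓜.ctx Sg Γ ⟶ 𝓜.ty Sg A)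
  | _, _, _, .here A h => (𝓜.ty Sg A ◁ 𝓜.discardCtx Sg _ h) ≫ (ρ_ _).hom
  | _, _, _, .absent (Γ := Γ) (i := i) (A := A) x => @lookup Γ i A x
  | _, _, _, .skip P h x => (𝓜.discardTy Sg P h ▷ _) ≫ (λ_ _).hom ≫ lookup x

/-- The interpretation `⟦Q⟧` of label contexts. -/
abbrev labelCtx (Q : LabelCtx Sg.W) : C := Q.den (𝓜.wire Sg)

/-- `⟦Q₁, Q₂⟧ ≅ ⟦Q₁⟧ ⊗ ⟦Q₂⟧`. -/
def splitLabels {Q Q₁ Q₂ : LabelCtx Sg.W} (t : Q.Split Q₁ Q₂) :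
    𝓜.labelCtx Sg Q ≅ 𝓜.labelCtx Sg Q₁ ⊗ 𝓜.labelCtx Sg Q₂ :=
  LabelCtx.splitIso (𝓜.wire Sg) t

/-- The interpretation of labelled string diagrams:
`⟦Q⟧ ≅ E(⟦Q⟧_M) ⟶ E(⟦Q'⟧_M) ≅ ⟦Q'⟧`. -/
def diagram {Q Q' : LabelCtx Sg.W} (S : DiagramHom Sg Q Q') :
    𝓜.labelCtx Sg Q ⟶ 𝓜.labelCtx Sg Q' :=
  (tensorListIso 𝓜.E (fun e : ℕ × Sg.W => Sg.wire e.2) Q.entries).hom ≫ 𝓜.E.map S ≫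
    (tensorListIso 𝓜.E (fun e : ℕ × Sg.W => Sg.wire e.2) Q'.entries).inv

/-- `φ(ℓ⃗, S, ℓ⃗') : ⟦T⟧ ⟶ ⟦Q⟧ ⟶ ⟦Q'⟧ ⟶ ⟦U⟧`. -/
def phi {l l' : LTuple} {S : LDiagram Sg} {T U : MTy Sg.W}
    (hl : LTyping S.dom l T) (hl' : LTyping S.cod l' U) :
    T.den (𝓜.wire Sg) ⟶ U.den (𝓜.wire Sg) :=
  (hl.iso (𝓜.wire Sg)).inv ≫ 𝓜.diagram Sg S.hom ≫ (hl'.iso (𝓜.wire Sg)).hom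

/-- `!(⟦T⟧ ⊸ ⟦U⟧) ≅ ⟦Diag(T, U)⟧`. -/
noncomputable def boxIso (T U : MTy Sg.W) :
    𝓜.ty Sg (.bang (.lolli T.toTy U.toTy)) ≅ 𝓜.ty Sg (.diag T U) :=
  𝓜.F.mapIso (𝓜.homIso (𝓜.ty Sg T.toTy) (𝓜.ty Sg U.toTy) ≪≫
    Iso.eHomCongr V (𝓜.mtyIso Sg T) (𝓜.mtyIso Sg U))

/-- An interpretation `I ⟶ ⟦A_c⟧` of the constants, which is an intuitionistic morphism
whenever the type `A_c` is intuitionistic. -/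
structure Constants where
  den (c : Sg.Const) : 𝟙_ C ⟶ 𝓜.ty Sg (Sg.constTy c)
  intuitionistic (c : Sg.Const) (h : (Sg.constTy c).IsInt) :
    𝓜.IsIntuitionistic (Functor.Monoidal.εIso 𝓜.F) (𝓜.intIso Sg (Sg.constTy c) h).2 (den c)

variable {𝓜 Sg}

/-- `⟦Φ, Γ₁, Γ₂⟧ ⊗ ⟦Q₁, Q₂⟧ ⟶ (⟦Φ, Γ₁⟧ ⊗ ⟦Q₁⟧) ⊗ (⟦Φ, Γ₂⟧ ⊗ ⟦Q₂⟧)`. -/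
noncomputable def split {Γ Γ₁ Γ₂ : Ctx Sg.W} {Q Q₁ Q₂ : LabelCtx Sg.W} (s : CtxSplit Γ Γ₁ Γ₂)
    (t : Q.Split Q₁ Q₂) :
    𝓜.ctx Sg Γ ⊗ 𝓜.labelCtx Sg Q ⟶
      (𝓜.ctx Sg Γ₁ ⊗ 𝓜.labelCtx Sg Q₁) ⊗ (𝓜.ctx Sg Γ₂ ⊗ 𝓜.labelCtx Sg Q₂) :=
  (𝓜.splitCtx Sg s ⊗ₘ (𝓜.splitLabels Sg t).hom) ≫ tensorμ _ _ _ _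

/-- The interpretation `⟦Γ⟧ ⊗ ⟦Q⟧ ⟶ ⟦A⟧` of a derivation of `Γ; Q ⊢ m : A`. -/
noncomputable def den (K : 𝓜.Constants Sg) : {Γ : Ctx Sg.W} → {Q : LabelCtx Sg.W} →
    {m : Term Sg} → {A : Ty Sg.W} → Typing Γ Q m A →
    (𝓜.ctx Sg Γ ⊗ 𝓜.labelCtx Sg Q ⟶ 𝓜.ty Sg A)
  | _, _, _, _, .var x => (ρ_ _).hom ≫ 𝓜.lookup Sg x
  | _, _, _, _, .label h _ α =>
      (𝓜.discardCtx Sg _ h ▷ _) ≫ (λ_ _).hom ≫ (ρ_ (𝓜.wire Sg α)).hom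
  | _, _, _, _, .const h c => (ρ_ _).hom ≫ 𝓜.discardCtx Sg _ h ≫ K.den c
  | _, _, _, _, .let_ s t d d' =>
      split s t ≫ (den K d ▷ _) ≫ (α_ _ _ _).inv ≫ den K d'
  | _, _, _, _, .initial _ d => den K d ≫ initial.to _
  | _, _, _, _, .left _ _ d => den K d ≫ coprod.inl
  | _, _, _, _, .right _ _ d => den K d ≫ coprod.inr
  | _, _, _, _, .case s t d d₁ d₂ =>
      split s t ≫ (den K d ▷ _) ≫
        caseMap ((α_ _ _ _).inv ≫ den K d₁) ((α_ _ _ _).inv ≫ den K d₂)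
  | _, _, _, _, .star h => (ρ_ _).hom ≫ 𝓜.discardCtx Sg _ h
  | _, _, _, _, .seq s t d d' => split s t ≫ (den K d ▷ _) ≫ (λ_ _).hom ≫ den K d'
  | _, _, _, _, .pair s t d d' => split s t ≫ (den K d ⊗ₘ den K d')
  | _, _, _, _, .letPair s t d d' =>
      split s t ≫ (den K d ▷ _) ≫ ((β_ _ _).hom ▷ _) ≫ (α_ _ _ _).hom ≫
        (_ ◁ (α_ _ _ _).inv) ≫ (α_ _ _ _).inv ≫ den K d'
  | _, _, _, _, .lam _ d => MonoidalClosed.curry ((α_ _ _ _).inv ≫ den K d)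
  | _, _, _, _, .app s t d d' => split s t ≫ (den K d ⊗ₘ den K d') ≫ evMap _ _
  | _, _, _, _, .lift h d =>
      (ρ_ _).hom ≫ 𝓜.liftCtx Sg _ h ≫ 𝓜.F.map (𝓜.G.map ((ρ_ _).inv ≫ den K d))
  | _, _, _, _, .force d => den K d ≫ 𝓜.adj.counit.app _
  | _, _, _, _, .box d => den K d ≫ (𝓜.boxIso Sg _ _).hom
  | _, _, _, _, .apply s t d d' =>
      split s t ≫ ((den K d ≫ (𝓜.boxIso Sg _ _).inv ≫ 𝓜.adj.counit.app _) ⊗ₘ den K d') ≫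
        evMap _ _
  | _, _, _, _, .diag h hl hl' =>
      (ρ_ _).hom ≫ 𝓜.discardCtx Sg _ h ≫ Functor.LaxMonoidal.ε 𝓜.F ≫
        𝓜.F.map (𝓜.psi (𝓜.phi Sg hl hl'))

/-- The interpretation of a derivation of `Q ⊢ (S, m) : A; Q'`:
`⟦Q⟧ ⟶ ⟦Q''⟧ ⊗ ⟦Q'⟧ ⟶ ⟦A⟧ ⊗ ⟦Q'⟧`. -/
noncomputable def config (K : 𝓜.Constants Sg) {Q Q' : LabelCtx Sg.W} {S : Diagram Sg Q}
    {m : Term Sg} {A : Ty Sg.W} (d : ConfigTyping S m A Q') :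
    𝓜.labelCtx Sg Q ⟶ 𝓜.ty Sg A ⊗ 𝓜.labelCtx Sg Q' :=
  𝓜.diagram Sg S.hom ≫ (𝓜.splitLabels Sg d.split).hom ≫
    (((λ_ _).inv ≫ den K d.typing) ▷ 𝓜.labelCtx Sg Q')

end Model

end Semantics

end ECLNL

/-!
Soundness of the ECLNL calculus: evaluation of configurations preserves typing and denotation.
The proof has three ingredients.

*Independence of the derivation* (`coherent`, `Model.den_eq`). A term over given contexts is typed
by derivations that end with the same rule; they differ only in how the contexts are split between
the premises. Labels and linear variables are used exactly once, so that their distribution is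
determined by the free names of the premises (`Typing.labels_eq`, `Typing.isFree_of_not_isInt`).
Intuitionistic variables may be sent to one premise or to both, but by the counit laws of copying
and discarding every splitting factors through the one that duplicates all intuitionistic variables
(`Model.exists_restrict`, `Model.exists_common_split`). Hence it is enough to
compare suitable derivations, which is what the induction on evaluation provides.

*Substitution* (`IsSubstClass.exists_typing`). An induction over derivations works for every class
of substitutions whose interpretations are compatible with looking up, discarding, copying, lifting
and splitting. It is used twice: for weakenings, and for environments `Env`, which replace some of
the variables by closed values. The second case rests on the fact that a closed value of
intuitionistic type uses no labels and denotes an intuitionistic morphism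
(`Term.IsValue.isIntuitionistic`), that is, one that comes from the cartesian category and therefore
commutes with discarding, copying and lifting.

*Induction on evaluation* (`Eval.preserves`). The statement `Preserves` is proved for all ways of
splitting the outputs of the diagram into those used by the term and a frame. When a subterm is
evaluated, the labels of the other subterms are moved to the frame by the associativity and symmetry
of splittings (`Preserves.frame_left`, `Preserves.frame_right`). The redexes are then handled by
the substitution lemma and by the universal properties of the coproduct, of the closed structure and
of the adjunction. For `box` and `apply`, the interpretation of a boxed diagram is the transpose of
a curried morphism (`Model.psi_eq`), and appending a diagram is interpreted by composition because
`E` is a symmetric strong monoidal functor (`Model.diagram_append`).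

The bookkeeping of labels uses that a list without repetitions can be distributed over a formal
tensor product in at most one way; this also gives coherence for symmetric monoidal categories
(`SymHom.coherence`), since structural isomorphisms transport distributions to distributions.

The interpretations of lists, types and contexts are tensor products only by definitional unfolding,
which rewriting does not see. Many equations are therefore first stated for arbitrary objects, as a
separate lemma or a local `key`, and then instantiated up to definitional equality.
-/

namespace ECLNL

/-! ### Shuffles of lists -/

section Shuffles

variable {α : Type w} {D : Type u} [Category.{v} D] [MonoidalCategory D] [SymmetricCategory D]

/-- The two parts of a shuffle can be exchanged; on interpretations, this is the symmetry. -/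
theorem Shuffle.exists_symm (f : α → D) {l l₁ l₂ : List α} (s : Shuffle l l₁ l₂) :
    ∃ t : Shuffle l l₂ l₁, (t.iso f).hom = (s.iso f).hom ≫ (β_ _ _).hom := by
  induction s with
  | nil =>
    refine ⟨.nil, ?_⟩
    change (λ_ (𝟙_ D)).inv = (λ_ (𝟙_ D)).inv ≫ (β_ (𝟙_ D) (𝟙_ D)).hom
    simp [← unitors_equal]
  | left a s ih =>
    obtain ⟨t, ht⟩ := ih
    refine ⟨.right a t, ?_⟩
    simp [Shuffle.iso, ht, swapIso, tensorList, BraidedCategory.braiding_tensor_left_hom]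
  | right a s ih =>
    obtain ⟨t, ht⟩ := ih
    refine ⟨.left a t, ?_⟩
    simp only [Shuffle.iso, ht, swapIso, tensorList, Iso.trans_hom, whiskerLeftIso_hom,
      Iso.symm_hom, whiskerRightIso_hom, whiskerLeft_comp,
      BraidedCategory.braiding_tensor_right_hom, Category.assoc, Iso.hom_inv_id_assoc]
    rw [← comp_whiskerRight_assoc, SymmetricCategory.symmetry]
    simp

/-- Splitting off the last part first gives the same isomorphism as splitting off the first part
first, up to the associator. -/
theorem Shuffle.exists_assoc (f : α → D) {l l₁₂ l₁ l₂ l₃ : List α} (s : Shuffle l l₁₂ l₃)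
    (t : Shuffle l₁₂ l₁ l₂) :
    ∃ (l₂₃ : List α) (s' : Shuffle l l₁ l₂₃) (t' : Shuffle l₂₃ l₂ l₃),
      (s.iso f).hom ≫ (t.iso f).hom ▷ _ ≫ (α_ _ _ _).hom =
        (s'.iso f).hom ≫ _ ◁ (t'.iso f).hom := by
  induction s generalizing l₁ l₂ with
  | nil =>
    cases t
    refine ⟨[], .nil, .nil, ?_⟩
    change (λ_ (𝟙_ D)).inv ≫ (λ_ (𝟙_ D)).inv ▷ 𝟙_ D ≫ (α_ (𝟙_ D) (𝟙_ D) (𝟙_ D)).hom =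
      (λ_ (𝟙_ D)).inv ≫ 𝟙_ D ◁ (λ_ (𝟙_ D)).inv
    monoidal
  | left a s ih =>
    cases t with
    | left _ t =>
      obtain ⟨l', s', t', h⟩ := ih t
      refine ⟨l', .left a s', t', ?_⟩
      simp only [Shuffle.iso, tensorList, Iso.trans_hom, whiskerLeftIso_hom, Iso.symm_hom,
        Category.assoc]
      rw [← associator_inv_naturality_right, ← whiskerLeft_comp_assoc, ← h]
      simp
    | right _ t =>
      obtain ⟨l', s', t', h⟩ := ih t
      refine ⟨a :: l', .right a s', .left a t', ?_⟩
      have h' : (s.iso f).hom ≫ (t.iso f).hom ▷ _ =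
        (s'.iso f).hom ≫ _ ◁ (t'.iso f).hom ≫ (α_ _ _ _).inv := by
        rw [← reassoc_of% h]; simp
      simp only [Shuffle.iso, tensorList, Iso.trans_hom, whiskerLeftIso_hom, Iso.symm_hom,
        Category.assoc, swapIso, whiskerRightIso_hom, comp_whiskerRight]
      rw [← associator_inv_naturality_middle_assoc, ← whiskerLeft_comp_assoc, h']
      simp only [whiskerLeft_comp, Category.assoc]
      rw [← associator_naturality_right_assoc, ← whisker_exchange_assoc,
        ← associator_inv_naturality_right_assoc]
      monoidal
  | right a s ih =>
    obtain ⟨l', s', t', h⟩ := ih t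
    refine ⟨a :: l', .right a s', .right a t', ?_⟩
    have h' : (s.iso f).hom ≫ (t.iso f).hom ▷ _ =
      (s'.iso f).hom ≫ _ ◁ (t'.iso f).hom ≫ (α_ _ _ _).inv := by
      rw [← reassoc_of% h]; simp
    simp only [Shuffle.iso, tensorList, Iso.trans_hom, whiskerLeftIso_hom, Iso.symm_hom,
        Category.assoc, swapIso, whiskerRightIso_hom]
    have key : f a ◁ (s.iso f).hom ≫ f a ◁ (t.iso f).hom ▷ _ ≫ f a ◁ (α_ _ _ _).hom =
        f a ◁ (s'.iso f).hom ≫ f a ◁ _ ◁ (t'.iso f).hom := by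
      simp only [← whiskerLeft_comp, h]
    simp only [whiskerLeft_comp]
    rw [← associator_naturality_right_assoc, ← whisker_exchange_assoc,
      ← associator_inv_naturality_right_assoc, ← reassoc_of% key, ← associator_naturality_left_assoc,
      ← comp_whiskerRight_assoc, ← BraidedCategory.braiding_naturality_right, comp_whiskerRight_assoc,
      ← associator_inv_naturality_middle_assoc, BraidedCategory.braiding_tensor_right_hom]
    simp only [comp_whiskerRight, Category.assoc]
    monoidal

theorem Shuffle.sublist_left {l l₁ l₂ : List α} (s : Shuffle l l₁ l₂) : l₁.Sublist l := by
  induction s with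
  | nil => exact .slnil
  | left a _ ih => exact ih.cons_cons a
  | right a _ ih => exact ih.cons a

theorem Shuffle.sublist_right {l l₁ l₂ : List α} (s : Shuffle l l₁ l₂) : l₂.Sublist l := by
  induction s with
  | nil => exact .slnil
  | left a _ ih => exact ih.cons a
  | right a _ ih => exact ih.cons_cons a

theorem Shuffle.mem_iff {l l₁ l₂ : List α} (s : Shuffle l l₁ l₂) (x : α) :
    x ∈ l ↔ x ∈ l₁ ∨ x ∈ l₂ := by
  induction s with
  | nil => simp
  | left a _ ih => simp [ih, or_assoc]
  | right a _ ih => simp [ih, or_left_comm]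

theorem Shuffle.disjoint {l l₁ l₂ : List α} (s : Shuffle l l₁ l₂) (hl : l.Nodup) (x : α)
    (h₁ : x ∈ l₁) (h₂ : x ∈ l₂) : False := by
  induction s with
  | nil => simp at h₁
  | left a s ih =>
    rw [List.nodup_cons] at hl
    rcases List.mem_cons.1 h₁ with rfl | h₁
    · exact hl.1 (s.sublist_right.subset h₂)
    · exact ih hl.2 h₁ h₂
  | right a s ih =>
    rw [List.nodup_cons] at hl
    rcases List.mem_cons.1 h₂ with rfl | h₂
    · exact hl.1 (s.sublist_left.subset h₁)
    · exact ih hl.2 h₁ h₂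

/-- If `l` has no repetitions, a shuffle is determined by its left component. -/
theorem Shuffle.sigma_eq {l l₁ l₂ l₂' : List α} (s : Shuffle l l₁ l₂) (s' : Shuffle l l₁ l₂')
    (hl : l.Nodup) : (⟨l₂, s⟩ : Σ l₂, Shuffle l l₁ l₂) = ⟨l₂', s'⟩ := by
  induction s generalizing l₂' with
  | nil => cases s'; rfl
  | left a s ih =>
    have ha := (List.nodup_cons.1 hl).1
    cases s' with
    | left _ s' => cases ih s' (List.nodup_cons.1 hl).2; rfl
    | right _ s' => exact absurd (s'.sublist_left.subset (List.mem_cons_self)) ha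
  | right a s ih =>
    have ha := (List.nodup_cons.1 hl).1
    cases s' with
    | left _ s' => exact absurd (s.sublist_left.subset (List.mem_cons_self)) ha
    | right _ s' => cases ih s' (List.nodup_cons.1 hl).2; rfl

theorem Shuffle.subsingleton {l l₁ l₂ : List α} (hl : l.Nodup) (s s' : Shuffle l l₁ l₂) :
    s = s' := by
  have := s.sigma_eq s' hl
  simpa using this

theorem List.Sublist.eq_of_mem_iff {l l₁ l₂ : List α} (h₁ : l₁.Sublist l) (h₂ : l₂.Sublist l)
    (hl : l.Nodup) (h : ∀ x, x ∈ l₁ ↔ x ∈ l₂) : l₁ = l₂ := by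
  induction h₁ generalizing l₂ with
  | slnil => exact (List.sublist_nil.1 h₂).symm
  | cons a h₁ ih =>
    have ha := (List.nodup_cons.1 hl).1
    cases h₂ with
    | cons _ h₂ => exact ih h₂ (List.nodup_cons.1 hl).2 h
    | cons_cons _ h₂ => exact absurd (h₁.subset ((h _).2 List.mem_cons_self)) ha
  | cons_cons a h₁ ih =>
    have ha := (List.nodup_cons.1 hl).1
    cases h₂ with
    | cons _ h₂ => exact absurd (h₂.subset ((h _).1 List.mem_cons_self)) ha
    | cons_cons _ h₂ =>
      have hl' := (List.nodup_cons.1 hl)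
      refine congrArg _ (ih h₂ hl'.2 fun x => ?_)
      by_cases hx : x = a
      · subst hx
        exact ⟨fun h => absurd (h₁.subset h) ha, fun h => absurd (h₂.subset h) ha⟩
      · simpa [hx] using h x

/-- The converse of `Shuffle.exists_assoc`. Without repetitions, it follows by symmetry, because a
shuffle is determined by its left component. -/
theorem Shuffle.exists_assoc_inv (f : α → D) {l l₂₃ l₁ l₂ l₃ : List α} (hl : l.Nodup)
    (s : Shuffle l l₁ l₂₃) (t : Shuffle l₂₃ l₂ l₃) :
    ∃ (l₁₂ : List α) (s' : Shuffle l l₁₂ l₃) (t' : Shuffle l₁₂ l₁ l₂),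
      (s.iso f).hom ≫ _ ◁ (t.iso f).hom ≫ (α_ _ _ _).inv =
        (s'.iso f).hom ≫ (t'.iso f).hom ▷ _ := by
  obtain ⟨s₁, -⟩ := s.exists_symm f
  obtain ⟨t₁, -⟩ := t.exists_symm f
  obtain ⟨l', s₂, t₂, -⟩ := Shuffle.exists_assoc f s₁ t₁
  obtain ⟨s₃, -⟩ := s₂.exists_symm f
  obtain ⟨t₃, -⟩ := t₂.exists_symm f
  obtain ⟨l'', s₄, t₄, h⟩ := Shuffle.exists_assoc f s₃ t₃
  cases s.sigma_eq s₄ hl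
  cases t.subsingleton (hl.sublist s.sublist_right) t₄
  exact ⟨l', s₃, t₃, by rw [← reassoc_of% h]; simp⟩

theorem Shuffle.exists_append (l₁ l₂ : List α) : Nonempty (Shuffle (l₁ ++ l₂) l₁ l₂) := by
  induction l₁ with
  | nil =>
    induction l₂ with
    | nil => exact ⟨.nil⟩
    | cons a l ih => exact ih.map (.right a)
  | cons a l ih => exact ih.map (.left a)

theorem Shuffle.exists_right (f : α → D) (l : List α) :
    ∃ s : Shuffle l [] l, (s.iso f).hom = (λ_ _).inv := by
  induction l with
  | nil => exact ⟨.nil, rfl⟩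
  | cons a l ih =>
    obtain ⟨s, hs⟩ := ih
    refine ⟨.right a s, ?_⟩
    have key : ∀ g : tensorList f l ⟶ 𝟙_ D ⊗ tensorList f l, g = (λ_ _).inv →
        f a ◁ g ≫ (α_ _ _ _).inv ≫ (β_ (f a) (𝟙_ D)).hom ▷ _ ≫ (α_ _ _ _).hom =
          (λ_ (f a ⊗ tensorList f l)).inv := by
      rintro _ rfl
      simp
    exact key _ hs

theorem Shuffle.eq_of_left_nil {l l' : List α} (s : Shuffle l [] l') : l = l' := by
  generalize h : ([] : List α) = l₀ at s
  induction s with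
  | nil => rfl
  | left => cases h
  | right a s ih => rw [ih h]

theorem Shuffle.eq_of_right_nil {l l' : List α} (s : Shuffle l l' []) : l = l' := by
  generalize h : ([] : List α) = l₀ at s
  induction s with
  | nil => rfl
  | left a s ih => rw [ih h]
  | right => cases h

theorem Shuffle.iso_of_left_nil (f : α → D) {l : List α} (s : Shuffle l [] l) (hl : l.Nodup) :
    (s.iso f).hom = (λ_ _).inv := by
  obtain ⟨t, ht⟩ := Shuffle.exists_right f l
  rw [s.subsingleton hl t, ht]

theorem Shuffle.iso_of_right_nil (f : α → D) {l : List α} (s : Shuffle l l []) (hl : l.Nodup) :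
    (s.iso f).hom = (ρ_ _).inv := by
  obtain ⟨t, ht⟩ := s.exists_symm f
  have key : ∀ g : tensorList f l ⟶ tensorList f l ⊗ 𝟙_ D,
      (λ_ _).inv = g ≫ (β_ _ _).hom → g = (ρ_ _).inv := by
    intro g hg
    rw [← cancel_mono (β_ _ _).hom, ← hg]
    simp
  exact key _ ((t.iso_of_left_nil f hl).symm.trans ht)

end Shuffles

/-! ### Coherence for symmetric monoidal categories -/

section Coherence

variable {D : Type u} [Category.{v} D] [MonoidalCategory D]

theorem comp_tensorHom {X Y Z X' Y' : D} (f : X ⟶ Y) (g : Y ⟶ Z) (h : X' ⟶ Y') :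
    (f ≫ g) ⊗ₘ h = f ▷ X' ≫ (g ⊗ₘ h) := by
  simp [MonoidalCategory.tensorHom_def]

theorem tensorHom_comp' {X Y Z X' Y' : D} (h : X' ⟶ Y') (f : X ⟶ Y) (g : Y ⟶ Z) :
    h ⊗ₘ (f ≫ g) = X' ◁ f ≫ (h ⊗ₘ g) := by
  simp [MonoidalCategory.tensorHom_def']

variable [SymmetricCategory D]

/-- Formal composites of the structural isomorphisms of a symmetric monoidal category, between
formal tensor products (encoded as M-types) of numbered atoms. -/
inductive SymHom : MTy ℕ → MTy ℕ → Type
  | id (T : MTy ℕ) : SymHom T T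
  | comp {T U V : MTy ℕ} : SymHom T U → SymHom U V → SymHom T V
  | whiskerLeft (V : MTy ℕ) {T U : MTy ℕ} : SymHom T U → SymHom (.tensor V T) (.tensor V U)
  | whiskerRight {T U : MTy ℕ} : SymHom T U → (V : MTy ℕ) → SymHom (.tensor T V) (.tensor U V)
  | assoc (T U V : MTy ℕ) : SymHom (.tensor (.tensor T U) V) (.tensor T (.tensor U V))
  | assocInv (T U V : MTy ℕ) : SymHom (.tensor T (.tensor U V)) (.tensor (.tensor T U) V)
  | left (T : MTy ℕ) : SymHom (.tensor .unit T) T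
  | leftInv (T : MTy ℕ) : SymHom T (.tensor .unit T)
  | right (T : MTy ℕ) : SymHom (.tensor T .unit) T
  | rightInv (T : MTy ℕ) : SymHom T (.tensor T .unit)
  | braid (T U : MTy ℕ) : SymHom (.tensor T U) (.tensor U T)

/-- The isomorphism denoted by a formal composite. -/
def SymHom.hom (f : ℕ → D) : {T U : MTy ℕ} → SymHom T U → (T.den f ⟶ U.den f)
  | _, _, .id T => 𝟙 (T.den f)
  | _, _, .comp e e' => e.hom f ≫ e'.hom f
  | _, _, .whiskerLeft V e => V.den f ◁ e.hom f
  | _, _, .whiskerRight e V => e.hom f ▷ V.den f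
  | _, _, .assoc T U V => (α_ (T.den f) (U.den f) (V.den f)).hom
  | _, _, .assocInv T U V => (α_ (T.den f) (U.den f) (V.den f)).inv
  | _, _, .left T => (λ_ (T.den f)).hom
  | _, _, .leftInv T => (λ_ (T.den f)).inv
  | _, _, .right T => (ρ_ (T.den f)).hom
  | _, _, .rightInv T => (ρ_ (T.den f)).inv
  | _, _, .braid T U => (β_ (T.den f) (U.den f)).hom

variable {α : Type w} {g : ℕ → List α}

/-- Distributions of a list over a formal tensor product whose `n`-th atom is to receive the
sublist `g n`. -/
inductive Distribution (g : ℕ → List α) : List α → MTy ℕ → Type w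
  | wire (n : ℕ) : Distribution g (g n) (.wire n)
  | unit : Distribution g [] .unit
  | tensor {l l₁ l₂ : List α} {T U : MTy ℕ} (s : Shuffle l l₁ l₂) :
      Distribution g l₁ T → Distribution g l₂ U → Distribution g l (.tensor T U)

/-- The isomorphism denoted by a distribution, for given interpretations `X n` of the atoms. -/
def Distribution.iso (f : α → D) {X : ℕ → D} (h : ∀ n, tensorList f (g n) ≅ X n) :
    {l : List α} → {T : MTy ℕ} → Distribution g l T → (tensorList f l ≅ T.den X)
  | _, _, .wire n => h n
  | _, _, .unit => Iso.refl (𝟙_ D)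
  | _, _, .tensor s p q => s.iso f ≪≫ (p.iso f h ⊗ᵢ q.iso f h)

/-- The atoms of a formal tensor product, from left to right. -/
def MTy.atoms : MTy ℕ → List ℕ
  | .wire n => [n]
  | .unit => []
  | .tensor T U => T.atoms ++ U.atoms

theorem Distribution.mem_iff {l : List α} {T : MTy ℕ} (p : Distribution g l T) (x : α) :
    x ∈ l ↔ ∃ n ∈ T.atoms, x ∈ g n := by
  induction p with
  | wire n => simp [MTy.atoms]
  | unit => simp [MTy.atoms]
  | tensor s p q ihp ihq => simp [MTy.atoms, s.mem_iff, ihp, ihq, or_and_right, exists_or]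

/-- Over a list without repetitions there is at most one distribution. -/
theorem Distribution.heq {l l' : List α} {T : MTy ℕ} (hl : l.Nodup) (p : Distribution g l T)
    (q : Distribution g l' T) (h : l = l') : p ≍ q := by
  induction p generalizing l' with
  | wire n => cases q; rfl
  | unit => cases q; rfl
  | tensor s p p' ih ih' =>
    cases q with
    | tensor t q q' =>
      subst h
      cases List.Sublist.eq_of_mem_iff s.sublist_left t.sublist_left hl
        fun x => by rw [p.mem_iff, q.mem_iff]
      cases s.sigma_eq t hl
      rw [eq_of_heq (ih (hl.sublist s.sublist_left) q rfl),
        eq_of_heq (ih' (hl.sublist s.sublist_right) q' rfl)]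

theorem Distribution.subsingleton {l : List α} {T : MTy ℕ} (hl : l.Nodup)
    (p q : Distribution g l T) : p = q :=
  eq_of_heq (p.heq hl q rfl)

theorem Distribution.exists_tensor {l : List α} {T U : MTy ℕ} (q : Distribution g l (.tensor T U)) :
    ∃ (l₁ l₂ : List α) (s : Shuffle l l₁ l₂) (q₁ : Distribution g l₁ T) (q₂ : Distribution g l₂ U),
      q = .tensor s q₁ q₂ := by
  cases q with
  | tensor s q₁ q₂ => exact ⟨_, _, s, q₁, q₂, rfl⟩

theorem Distribution.exists_wire {l : List α} {n : ℕ} (q : Distribution g l (.wire n)) :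
    ∃ h : g n = l, q = h ▸ .wire n := by
  cases q
  exact ⟨rfl, rfl⟩

theorem Distribution.nonempty (T : MTy ℕ) : Nonempty (Distribution (fun n => [n]) T.atoms T) := by
  induction T with
  | wire n => exact ⟨.wire n⟩
  | unit => exact ⟨.unit⟩
  | tensor T U h h' =>
    obtain ⟨h⟩ := h
    obtain ⟨h'⟩ := h'
    obtain ⟨s⟩ := Shuffle.exists_append T.atoms U.atoms
    exact ⟨.tensor s h h'⟩

/-- Composing a distribution with a formal composite of structural isomorphisms gives a
distribution. -/
theorem Distribution.exists_comp (f : α → D) {X : ℕ → D} (h : ∀ n, tensorList f (g n) ≅ X n)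
    {T U : MTy ℕ} {l : List α} (p : Distribution g l T) (e : SymHom T U) (hl : l.Nodup) :
    ∃ q : Distribution g l U, (p.iso f h).hom ≫ e.hom X = (q.iso f h).hom := by
  induction e generalizing l with
  | id T => exact ⟨p, Category.comp_id _⟩
  | comp e e' ih ih' =>
    obtain ⟨q, hq⟩ := ih p hl
    obtain ⟨r, hr⟩ := ih' q hl
    exact ⟨r, by rw [SymHom.hom, reassoc_of% hq, hr]⟩
  | whiskerLeft V e ih =>
    cases p with
    | tensor s p p' =>
      obtain ⟨q, hq⟩ := ih p' (hl.sublist s.sublist_right)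
      refine ⟨.tensor s p q, ?_⟩
      change ((s.iso f).hom ≫ ((p.iso f h).hom ⊗ₘ (p'.iso f h).hom)) ≫ V.den X ◁ e.hom X =
        (s.iso f).hom ≫ ((p.iso f h).hom ⊗ₘ (q.iso f h).hom)
      simp [← hq, MonoidalCategory.tensorHom_def]
  | whiskerRight e V ih =>
    cases p with
    | tensor s p p' =>
      obtain ⟨q, hq⟩ := ih p (hl.sublist s.sublist_left)
      refine ⟨.tensor s q p', ?_⟩
      change ((s.iso f).hom ≫ ((p.iso f h).hom ⊗ₘ (p'.iso f h).hom)) ≫ e.hom X ▷ V.den X =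
        (s.iso f).hom ≫ ((q.iso f h).hom ⊗ₘ (p'.iso f h).hom)
      simp [← hq, MonoidalCategory.tensorHom_def']
  | assoc T U V =>
    cases p with
    | tensor s p r =>
      cases p with
      | tensor t p q =>
        obtain ⟨l', s', t', hs⟩ := Shuffle.exists_assoc f s t
        refine ⟨.tensor s' p (.tensor t' q r), ?_⟩
        change ((s.iso f).hom ≫ (((t.iso f).hom ≫ ((p.iso f h).hom ⊗ₘ (q.iso f h).hom)) ⊗ₘ
            (r.iso f h).hom)) ≫ (α_ (T.den X) (U.den X) (V.den X)).hom =
          (s'.iso f).hom ≫ ((p.iso f h).hom ⊗ₘ (t'.iso f).hom ≫ ((q.iso f h).hom ⊗ₘ (r.iso f h).hom))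
        have e₁ : (((t.iso f).hom ≫ ((p.iso f h).hom ⊗ₘ (q.iso f h).hom)) ⊗ₘ (r.iso f h).hom) =
          (t.iso f).hom ▷ _ ≫ (((p.iso f h).hom ⊗ₘ (q.iso f h).hom) ⊗ₘ (r.iso f h).hom) :=
          comp_tensorHom _ _ _
        have e₂ : ((p.iso f h).hom ⊗ₘ (t'.iso f).hom ≫ ((q.iso f h).hom ⊗ₘ (r.iso f h).hom)) =
          _ ◁ (t'.iso f).hom ≫ ((p.iso f h).hom ⊗ₘ ((q.iso f h).hom ⊗ₘ (r.iso f h).hom)) :=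
          tensorHom_comp' _ _ _
        rw [e₁, e₂, Category.assoc, Category.assoc, associator_naturality, reassoc_of% hs]
  | assocInv T U V =>
    cases p with
    | tensor s p q =>
      cases q with
      | tensor t q r =>
        obtain ⟨l', s', t', hs⟩ := Shuffle.exists_assoc_inv f hl s t
        refine ⟨.tensor s' (.tensor t' p q) r, ?_⟩
        change ((s.iso f).hom ≫ ((p.iso f h).hom ⊗ₘ (t.iso f).hom ≫
            ((q.iso f h).hom ⊗ₘ (r.iso f h).hom))) ≫ (α_ (T.den X) (U.den X) (V.den X)).inv =
          (s'.iso f).hom ≫ ((t'.iso f).hom ≫ ((p.iso f h).hom ⊗ₘ (q.iso f h).hom) ⊗ₘ (r.iso f h).hom)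
        have e₁ : (((t'.iso f).hom ≫ ((p.iso f h).hom ⊗ₘ (q.iso f h).hom)) ⊗ₘ (r.iso f h).hom) =
          (t'.iso f).hom ▷ _ ≫ (((p.iso f h).hom ⊗ₘ (q.iso f h).hom) ⊗ₘ (r.iso f h).hom) :=
          comp_tensorHom _ _ _
        have e₂ : ((p.iso f h).hom ⊗ₘ (t.iso f).hom ≫ ((q.iso f h).hom ⊗ₘ (r.iso f h).hom)) =
          _ ◁ (t.iso f).hom ≫ ((p.iso f h).hom ⊗ₘ ((q.iso f h).hom ⊗ₘ (r.iso f h).hom)) :=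
          tensorHom_comp' _ _ _
        rw [e₁, e₂, Category.assoc, Category.assoc, associator_inv_naturality, reassoc_of% hs]
  | left T =>
    cases p with
    | tensor s p q =>
      cases p
      cases s.eq_of_left_nil
      refine ⟨q, ?_⟩
      have key : ∀ g : tensorList f l ⟶ 𝟙_ D ⊗ tensorList f l, g = (λ_ _).inv →
          (g ≫ (𝟙 (𝟙_ D) ⊗ₘ (q.iso f h).hom)) ≫ (λ_ (T.den X)).hom = (q.iso f h).hom := by
        rintro _ rfl
        simp
      exact key _ (s.iso_of_left_nil f hl)
  | leftInv T =>
    obtain ⟨s, hs⟩ := Shuffle.exists_right f l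
    refine ⟨.tensor s .unit p, ?_⟩
    have key : ∀ g : tensorList f l ⟶ 𝟙_ D ⊗ tensorList f l, g = (λ_ _).inv →
        (p.iso f h).hom ≫ (λ_ (T.den X)).inv = g ≫ (𝟙 (𝟙_ D) ⊗ₘ (p.iso f h).hom) := by
      rintro _ rfl
      simp
    exact key _ hs
  | right T =>
    cases p with
    | tensor s p q =>
      cases q
      cases s.eq_of_right_nil
      refine ⟨p, ?_⟩
      have key : ∀ g : tensorList f l ⟶ tensorList f l ⊗ 𝟙_ D, g = (ρ_ _).inv →
          (g ≫ ((p.iso f h).hom ⊗ₘ 𝟙 (𝟙_ D))) ≫ (ρ_ (T.den X)).hom = (p.iso f h).hom := by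
        rintro _ rfl
        simp
      exact key _ (s.iso_of_right_nil f hl)
  | rightInv T =>
    obtain ⟨s, -⟩ := Shuffle.exists_right f l
    obtain ⟨s, -⟩ := s.exists_symm f
    refine ⟨.tensor s p .unit, ?_⟩
    have key : ∀ g : tensorList f l ⟶ tensorList f l ⊗ 𝟙_ D, g = (ρ_ _).inv →
        (p.iso f h).hom ≫ (ρ_ (T.den X)).inv = g ≫ ((p.iso f h).hom ⊗ₘ 𝟙 (𝟙_ D)) := by
      rintro _ rfl
      simp
    exact key _ (s.iso_of_right_nil f hl)
  | braid T U =>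
    cases p with
    | tensor s p q =>
      obtain ⟨t, ht⟩ := s.exists_symm f
      refine ⟨.tensor t q p, ?_⟩
      change ((s.iso f).hom ≫ ((p.iso f h).hom ⊗ₘ (q.iso f h).hom)) ≫ (β_ (T.den X) (U.den X)).hom =
        (t.iso f).hom ≫ ((q.iso f h).hom ⊗ₘ (p.iso f h).hom)
      rw [ht]
      simp

/-- Coherence for symmetric monoidal categories: two formal composites between the same formal
tensor products of distinct atoms denote the same isomorphism. Both transport the unique
distribution of the atoms over the source to the unique distribution over the target. -/
theorem SymHom.coherence (f : ℕ → D) {T U : MTy ℕ} (e e' : SymHom T U)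
    (hT : T.atoms.Nodup) : e.hom f = e'.hom f := by
  obtain ⟨p⟩ := Distribution.nonempty T
  let h (n : ℕ) : tensorList f [n] ≅ f n := ρ_ (f n)
  obtain ⟨q, hq⟩ := p.exists_comp f h e hT
  obtain ⟨q', hq'⟩ := p.exists_comp f h e' hT
  rw [← cancel_epi (p.iso f h).hom, hq, hq', q.subsingleton hT q']

end Coherence

/-! ### Splittings of label contexts -/

section LabelContexts

variable {W : Type w}

/-- The formal symmetry `X ⊗ (Y ⊗ Z) ⟶ Y ⊗ (X ⊗ Z)`. -/
def SymHom.swap (A B Z : MTy ℕ) :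
    SymHom (.tensor A (.tensor B Z)) (.tensor B (.tensor A Z)) :=
  .comp (.assocInv _ _ _) (.comp (.whiskerRight (.braid _ _) _) (.assoc _ _ _))

/-- The formal middle-four interchange. -/
def SymHom.interchange (A B A' B' : MTy ℕ) :
    SymHom (.tensor (.tensor A B) (.tensor A' B')) (.tensor (.tensor A A') (.tensor B B')) :=
  .comp (.assoc _ _ _) (.comp (.whiskerLeft _ (.assocInv _ _ _))
    (.comp (.whiskerLeft _ (.whiskerRight (.braid _ _) _))
      (.comp (.whiskerLeft _ (.assoc _ _ _)) (.assocInv _ _ _))))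

/-- The function with values `a, b, c, d, e`. -/
def atoms₅ {β : Type*} (a b c d e : β) : ℕ → β
  | 0 => a
  | 1 => b
  | 2 => c
  | 3 => d
  | _ => e

namespace LabelCtx

theorem nodup (Q : LabelCtx W) : Q.entries.Nodup :=
  Q.sorted.imp fun h e => by simp [e] at h

/-- The label context listed by a sublist of the entries of a label context. -/
def ofSublist (Q : LabelCtx W) {l : List (ℕ × W)} (h : l.Sublist Q.entries) : LabelCtx W :=
  ⟨l, Q.sorted.sublist h⟩

theorem snd_eq_of_mem {Q : LabelCtx W} {ℓ : ℕ} {a b : W} (ha : (ℓ, a) ∈ Q.entries)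
    (hb : (ℓ, b) ∈ Q.entries) : a = b := by
  obtain ⟨l, hl⟩ := Q
  induction l with
  | nil => simp at ha
  | cons x l ih =>
    rw [List.pairwise_cons] at hl
    rcases List.mem_cons.1 ha with ha | ha <;> rcases List.mem_cons.1 hb with hb | hb
    · have := ha.trans hb.symm
      simpa using this
    · have := hl.1 _ hb
      simp [← ha] at this
    · have := hl.1 _ ha
      simp [← hb] at this
    · exact ih hl.2 ha hb

/-- Two parts of a label context with the same domain are equal. -/
theorem eq_of_labels_eq {Q Q₁ Q₂ : LabelCtx W} (h₁ : Q₁.entries.Sublist Q.entries)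
    (h₂ : Q₂.entries.Sublist Q.entries) (h : Q₁.labels = Q₂.labels) : Q₁ = Q₂ := by
  ext1
  refine List.Sublist.eq_of_mem_iff h₁ h₂ Q.nodup ?_
  rintro ⟨ℓ, a⟩
  constructor
  · intro ha
    obtain ⟨b, hb⟩ : ℓ ∈ Q₂.labels := h ▸ ⟨a, ha⟩
    rwa [snd_eq_of_mem (h₁.subset ha) (h₂.subset hb)]
  · intro ha
    obtain ⟨b, hb⟩ : ℓ ∈ Q₁.labels := h ▸ ⟨a, ha⟩
    rwa [snd_eq_of_mem (h₂.subset ha) (h₁.subset hb)]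

theorem Split.labels_eq {Q Q₁ Q₂ : LabelCtx W} (s : Q.Split Q₁ Q₂) :
    Q.labels = Q₁.labels ∪ Q₂.labels := by
  ext ℓ
  simp only [labels, Set.mem_ofPred_eq, Set.mem_union, s.mem_iff, exists_or]

theorem Split.disjoint {Q Q₁ Q₂ : LabelCtx W} (s : Q.Split Q₁ Q₂) :
    Disjoint Q₁.labels Q₂.labels := by
  rw [Set.disjoint_left]
  rintro ℓ ⟨a, ha⟩ ⟨b, hb⟩
  cases snd_eq_of_mem (s.sublist_left.subset ha) (s.sublist_right.subset hb)
  exact Shuffle.disjoint s Q.nodup _ ha hb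

theorem Split.right_eq {Q Q₁ Q₂ Q₂' : LabelCtx W} (s : Q.Split Q₁ Q₂) (s' : Q.Split Q₁ Q₂') :
    Q₂ = Q₂' := by
  have := s.sigma_eq s' Q.nodup
  ext1
  exact congrArg Sigma.fst this

/-- The right part of a splitting determines the left part, since labels occur only once. -/
theorem Split.left_eq {Q Q₁ Q₁' Q₂ : LabelCtx W} (s : Q.Split Q₁ Q₂) (s' : Q.Split Q₁' Q₂) :
    Q₁ = Q₁' := by
  refine eq_of_labels_eq s.sublist_left s'.sublist_left ?_
  have h := s.labels_eq.symm.trans s'.labels_eq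
  have h₁ := Set.disjoint_left.1 s.disjoint
  have h₂ := Set.disjoint_left.1 s'.disjoint
  ext ℓ
  have := Set.ext_iff.1 h ℓ
  simp only [Set.mem_union] at this
  grind

theorem Split.subsingleton {Q Q₁ Q₂ : LabelCtx W} (s s' : Q.Split Q₁ Q₂) : s = s' :=
  Shuffle.subsingleton Q.nodup s s'

theorem Split.eq_of_left_empty {Q Q' : LabelCtx W} (s : Q.Split empty Q') : Q = Q' := by
  ext1; exact Shuffle.eq_of_left_nil s

theorem Split.eq_of_right_empty {Q Q' : LabelCtx W} (s : Q.Split Q' empty) : Q = Q' := by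
  ext1; exact Shuffle.eq_of_right_nil s

variable {D : Type u} [Category.{v} D] [MonoidalCategory D] [SymmetricCategory D] (f : W → D)

theorem splitIso_left_empty {Q : LabelCtx W} (s : Q.Split empty Q) :
    (splitIso f s).hom = (λ_ _).inv :=
  Shuffle.iso_of_left_nil _ s Q.nodup

theorem splitIso_right_empty {Q : LabelCtx W} (s : Q.Split Q empty) :
    (splitIso f s).hom = (ρ_ _).inv :=
  Shuffle.iso_of_right_nil _ s Q.nodup

theorem exists_split_left_empty (Q : LabelCtx W) : Nonempty (Q.Split empty Q) := by
  change Nonempty (Shuffle Q.entries [] Q.entries)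
  generalize Q.entries = l
  induction l with
  | nil => exact ⟨.nil⟩
  | cons a l ih => exact ih.map (.right a)

theorem Split.exists_symm {Q Q₁ Q₂ : LabelCtx W} (s : Q.Split Q₁ Q₂) :
    ∃ t : Q.Split Q₂ Q₁, (splitIso f t).hom = (splitIso f s).hom ≫ (β_ _ _).hom :=
  Shuffle.exists_symm _ s

theorem Split.symm {Q Q₁ Q₂ : LabelCtx W} (s : Q.Split Q₁ Q₂) : Nonempty (Q.Split Q₂ Q₁) := by
  unfold Split at *
  generalize Q.entries = l, Q₁.entries = l₁, Q₂.entries = l₂ at *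
  induction s with
  | nil => exact ⟨.nil⟩
  | left a s ih => exact ih.map (.right a)
  | right a s ih => exact ih.map (.left a)

theorem Split.exists_assoc {Q Q₁₂ Q₁ Q₂ Q₃ : LabelCtx W} (s : Q.Split Q₁₂ Q₃)
    (t : Q₁₂.Split Q₁ Q₂) :
    ∃ (Q₂₃ : LabelCtx W) (s' : Q.Split Q₁ Q₂₃) (t' : Q₂₃.Split Q₂ Q₃),
      (splitIso f s).hom ≫ (splitIso f t).hom ▷ _ ≫ (α_ _ _ _).hom =
        (splitIso f s').hom ≫ _ ◁ (splitIso f t').hom := by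
  obtain ⟨l, s', t', h⟩ := Shuffle.exists_assoc (fun e : ℕ × W => f e.2) s t
  exact ⟨Q.ofSublist s'.sublist_right, s', t', h⟩

theorem Split.exists_assoc_inv {Q Q₂₃ Q₁ Q₂ Q₃ : LabelCtx W} (s : Q.Split Q₁ Q₂₃)
    (t : Q₂₃.Split Q₂ Q₃) :
    ∃ (Q₁₂ : LabelCtx W) (s' : Q.Split Q₁₂ Q₃) (t' : Q₁₂.Split Q₁ Q₂),
      (splitIso f s).hom ≫ _ ◁ (splitIso f t).hom ≫ (α_ _ _ _).inv =
        (splitIso f s').hom ≫ (splitIso f t').hom ▷ _ := by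
  obtain ⟨l, s', t', h⟩ := Shuffle.exists_assoc_inv (fun e : ℕ × W => f e.2) Q.nodup s t
  exact ⟨Q.ofSublist s'.sublist_left, s', t', h⟩

/-- The symmetry `A ⊗ (B ⊗ Z) ⟶ B ⊗ (A ⊗ Z)` for splittings of label contexts. -/
theorem Split.exists_swap {Q Y A B Z : LabelCtx W} (s : Q.Split A Y) (t : Y.Split B Z) :
    ∃ (Y' : LabelCtx W) (s' : Q.Split B Y') (t' : Y'.Split A Z),
      (splitIso f s).hom ≫ _ ◁ (splitIso f t).hom ≫ (swapIso _ _ _).hom =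
        (splitIso f s').hom ≫ _ ◁ (splitIso f t').hom := by
  let g : ℕ → List (ℕ × W) := atoms₅ A.entries B.entries Z.entries [] []
  let F := fun e : ℕ × W => f e.2
  let p : Distribution g Q.entries (.tensor (.wire 0) (.tensor (.wire 1) (.wire 2))) :=
    .tensor s (.wire 0) (.tensor t (.wire 1) (.wire 2))
  obtain ⟨q, hq⟩ := p.exists_comp F (X := fun n => tensorList F (g n)) (fun n => Iso.refl _)
    (SymHom.swap (.wire 0) (.wire 1) (.wire 2)) Q.nodup
  obtain ⟨l₁, l₂, s', q₁, q₂, rfl⟩ := q.exists_tensor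
  obtain ⟨l₃, l₄, t', q₃, q₄, rfl⟩ := q₂.exists_tensor
  obtain ⟨rfl, rfl⟩ := q₁.exists_wire
  obtain ⟨rfl, rfl⟩ := q₃.exists_wire
  obtain ⟨rfl, rfl⟩ := q₄.exists_wire
  refine ⟨Q.ofSublist s'.sublist_right, s', t', ?_⟩
  have e : ∀ {X A Y B Z : D} (a : X ⟶ A ⊗ Y) (b : Y ⟶ B ⊗ Z),
      a ≫ A ◁ b = a ≫ (𝟙 A ⊗ₘ b ≫ (𝟙 B ⊗ₘ 𝟙 Z)) := by simp
  have e₀ : ∀ {X A Y B Z U : D} (a : X ⟶ A ⊗ Y) (b : Y ⟶ B ⊗ Z) (c : A ⊗ (B ⊗ Z) ⟶ U),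
      a ≫ A ◁ b ≫ c = (a ≫ (𝟙 A ⊗ₘ b ≫ (𝟙 B ⊗ₘ 𝟙 Z))) ≫ c := by simp
  exact (e₀ _ _ _).trans (hq.trans (e _ _).symm)

/-- The middle-four interchange for splittings of label contexts. -/
theorem Split.exists_interchange {Q Y Z A B A' B' : LabelCtx W} (s : Q.Split Y Z)
    (t : Y.Split A B) (t' : Z.Split A' B') :
    ∃ (P R : LabelCtx W) (s₁ : Q.Split P R) (t₁ : P.Split A A') (t₂ : R.Split B B'),
      (splitIso f s).hom ≫ ((splitIso f t).hom ⊗ₘ (splitIso f t').hom) ≫ tensorμ _ _ _ _ =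
        (splitIso f s₁).hom ≫ ((splitIso f t₁).hom ⊗ₘ (splitIso f t₂).hom) := by
  let g : ℕ → List (ℕ × W) := atoms₅ A.entries B.entries A'.entries B'.entries []
  let F := fun e : ℕ × W => f e.2
  let p : Distribution g Q.entries
      (.tensor (.tensor (.wire 0) (.wire 1)) (.tensor (.wire 2) (.wire 3))) :=
    .tensor s (.tensor t (.wire 0) (.wire 1)) (.tensor t' (.wire 2) (.wire 3))
  obtain ⟨q, hq⟩ := p.exists_comp F (X := fun n => tensorList F (g n)) (fun n => Iso.refl _)
    (SymHom.interchange (.wire 0) (.wire 1) (.wire 2) (.wire 3)) Q.nodup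
  obtain ⟨l₁, l₂, s', q₁, q₂, rfl⟩ := q.exists_tensor
  obtain ⟨l₃, l₄, t₁, q₃, q₄, rfl⟩ := q₁.exists_tensor
  obtain ⟨l₅, l₆, t₂, q₅, q₆, rfl⟩ := q₂.exists_tensor
  obtain ⟨rfl, rfl⟩ := q₃.exists_wire
  obtain ⟨rfl, rfl⟩ := q₄.exists_wire
  obtain ⟨rfl, rfl⟩ := q₅.exists_wire
  obtain ⟨rfl, rfl⟩ := q₆.exists_wire
  refine ⟨Q.ofSublist s'.sublist_left, Q.ofSublist s'.sublist_right, s', t₁, t₂, ?_⟩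
  have e : ∀ {X Y A B Z C D' : D} (a : X ⟶ Y ⊗ Z) (b : Y ⟶ A ⊗ B) (c : Z ⟶ C ⊗ D'),
      a ≫ (b ⊗ₘ c) = a ≫ (b ≫ (𝟙 A ⊗ₘ 𝟙 B) ⊗ₘ c ≫ (𝟙 C ⊗ₘ 𝟙 D')) := by simp
  have e₀ : ∀ {X Y A B Z C D' U : D} (a : X ⟶ Y ⊗ Z) (b : Y ⟶ A ⊗ B) (c : Z ⟶ C ⊗ D')
      (d : (A ⊗ B) ⊗ (C ⊗ D') ⟶ U),
      a ≫ (b ⊗ₘ c) ≫ d = (a ≫ (b ≫ (𝟙 A ⊗ₘ 𝟙 B) ⊗ₘ c ≫ (𝟙 C ⊗ₘ 𝟙 D'))) ≫ d := by simp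
  exact (e₀ _ _ _ _).trans (hq.trans (e _ _ _).symm)

end LabelCtx
end LabelContexts

/-! ### Naturality of discarding, copying and lifting -/

section IntuitionisticMorphisms

variable {V : Type u₁} [Category.{v₁} V] [CartesianMonoidalCategory V] [BraidedCategory V]
  [MonoidalClosed V] [HasFiniteCoproducts V]
  {C : Type u₂} [Category.{v₂} C] [EnrichedOrdinaryCategory V C] [MonoidalCategory C]
  [SymmetricCategory C] [MonoidalClosed C] [HasFiniteCoproducts C]

namespace EnrichedCLNLModel

variable (𝓜 : EnrichedCLNLModel V C) {A B A' B' : C} {X Y X' Y' : V}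

theorem isIntuitionistic_id (e : A ≅ 𝓜.F.obj X) : 𝓜.IsIntuitionistic e e (𝟙 A) :=
  ⟨𝟙 X, by simp⟩

variable {𝓜} in
theorem IsIntuitionistic.comp {A'' : C} {X'' : V} {e : A ≅ 𝓜.F.obj X} {e' : A' ≅ 𝓜.F.obj X'}
    {e'' : A'' ≅ 𝓜.F.obj X''} {f : A ⟶ A'} {g : A' ⟶ A''} (hf : 𝓜.IsIntuitionistic e e' f)
    (hg : 𝓜.IsIntuitionistic e' e'' g) : 𝓜.IsIntuitionistic e e'' (f ≫ g) := by
  obtain ⟨f', rfl⟩ := hf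
  obtain ⟨g', rfl⟩ := hg
  exact ⟨f' ≫ g', by simp⟩

variable {𝓜} in
theorem IsIntuitionistic.tensor {e : A ≅ 𝓜.F.obj X} {e' : A' ≅ 𝓜.F.obj X'}
    {d : B ≅ 𝓜.F.obj Y} {d' : B' ≅ 𝓜.F.obj Y'} {f : A ⟶ A'} {g : B ⟶ B'}
    (hf : 𝓜.IsIntuitionistic e e' f) (hg : 𝓜.IsIntuitionistic d d' g) :
    𝓜.IsIntuitionistic ((e ⊗ᵢ d) ≪≫ Functor.Monoidal.μIso 𝓜.F X Y)
      ((e' ⊗ᵢ d') ≪≫ Functor.Monoidal.μIso 𝓜.F X' Y') (f ⊗ₘ g) := by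
  obtain ⟨f', rfl⟩ := hf
  obtain ⟨g', rfl⟩ := hg
  refine ⟨f' ⊗ₘ g', ?_⟩
  have h := Functor.OplaxMonoidal.δ_natural 𝓜.F f' g'
  simp only [Iso.trans_hom, Iso.trans_inv, Functor.Monoidal.μIso_hom, Functor.Monoidal.μIso_inv,
    Category.assoc, ← reassoc_of% h, Functor.Monoidal.μ_δ_assoc, tensorIso_hom, tensorIso_inv,
    tensorHom_comp_tensorHom]

theorem isIntuitionistic_discard (e : A ≅ 𝓜.F.obj X) :
    𝓜.IsIntuitionistic e (Functor.Monoidal.εIso 𝓜.F) (𝓜.discard e) :=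
  ⟨SemiCartesianMonoidalCategory.toUnit X, by simp [discard]⟩

variable {𝓜} in
/-- Discarding is natural with respect to intuitionistic morphisms. -/
theorem IsIntuitionistic.comp_discard {e : A ≅ 𝓜.F.obj X} {e' : A' ≅ 𝓜.F.obj X'} {f : A ⟶ A'}
    (hf : 𝓜.IsIntuitionistic e e' f) : f ≫ 𝓜.discard e' = 𝓜.discard e := by
  obtain ⟨f', rfl⟩ := hf
  simp [discard, ← Functor.map_comp_assoc]

variable {𝓜} in
/-- Copying is natural with respect to intuitionistic morphisms. -/
theorem IsIntuitionistic.comp_copy {e : A ≅ 𝓜.F.obj X} {e' : A' ≅ 𝓜.F.obj X'} {f : A ⟶ A'}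
    (hf : 𝓜.IsIntuitionistic e e' f) : f ≫ 𝓜.copy e' = 𝓜.copy e ≫ (f ⊗ₘ f) := by
  obtain ⟨f', rfl⟩ := hf
  have h : f' ≫ CartesianMonoidalCategory.lift (𝟙 X') (𝟙 X') =
      CartesianMonoidalCategory.lift (𝟙 X) (𝟙 X) ≫ (f' ⊗ₘ f') := by simp
  have h' := congrArg 𝓜.F.map h
  rw [Functor.map_comp, Functor.map_comp] at h'
  simp only [copy, Category.assoc, Iso.inv_hom_id_assoc, tensorHom_comp_tensorHom, reassoc_of% h']
  simp [← Functor.OplaxMonoidal.δ_natural_assoc, ← tensorHom_comp_tensorHom]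

variable {𝓜} in
/-- Lifting is natural with respect to intuitionistic morphisms. -/
theorem IsIntuitionistic.comp_lift {e : A ≅ 𝓜.F.obj X} {e' : A' ≅ 𝓜.F.obj X'} {f : A ⟶ A'}
    (hf : 𝓜.IsIntuitionistic e e' f) : f ≫ 𝓜.lift e' = 𝓜.lift e ≫ 𝓜.F.map (𝓜.G.map f) := by
  obtain ⟨f', rfl⟩ := hf
  simp only [lift, Category.assoc, Iso.inv_hom_id_assoc]
  have h := 𝓜.adj.unit.naturality f'
  simp only [Functor.id_obj, Functor.id_map, Functor.comp_obj, Functor.comp_map] at h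
  rw [← Functor.map_comp_assoc, h]
  rw [Functor.map_comp, Category.assoc]
  simp only [← Functor.map_comp, Iso.inv_hom_id_assoc]

theorem discard_εIso : 𝓜.discard (Functor.Monoidal.εIso 𝓜.F) = 𝟙 _ := by
  have : SemiCartesianMonoidalCategory.toUnit (𝟙_ V) = 𝟙 _ := Subsingleton.elim _ _
  simp [discard, this]

theorem isIntuitionistic_leftUnitor (e : A ≅ 𝓜.F.obj X) :
    𝓜.IsIntuitionistic ((Functor.Monoidal.εIso 𝓜.F ⊗ᵢ e) ≪≫ Functor.Monoidal.μIso 𝓜.F (𝟙_ V) X)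
      e (λ_ A).hom := by
  refine ⟨(λ_ X).hom, ?_⟩
  rw [Functor.Monoidal.map_leftUnitor]
  simp [MonoidalCategory.tensorHom_def']

theorem discard_eq (e : A ≅ 𝓜.F.obj X) : 𝓜.discard e = e.hom ≫ 𝓜.discard (Iso.refl _) := by
  simp [discard]

theorem copy_eq (e : A ≅ 𝓜.F.obj X) :
    𝓜.copy e = e.hom ≫ 𝓜.copy (Iso.refl _) ≫ (e.inv ⊗ₘ e.inv) := by
  simp [copy]

theorem discard_tensor (e : A ≅ 𝓜.F.obj X) (e' : A' ≅ 𝓜.F.obj X') :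
    𝓜.discard ((e ⊗ᵢ e') ≪≫ Functor.Monoidal.μIso 𝓜.F X X') =
      (𝓜.discard e ▷ _) ≫ (λ_ _).hom ≫ 𝓜.discard e' := by
  have h := ((𝓜.isIntuitionistic_discard e).tensor (𝓜.isIntuitionistic_discard e')).comp_discard
  have h₁ : SemiCartesianMonoidalCategory.toUnit (𝟙_ V ⊗ 𝟙_ V) = (λ_ _).hom :=
    Subsingleton.elim _ _
  have h₂ : 𝓜.discard ((Functor.Monoidal.εIso 𝓜.F ⊗ᵢ Functor.Monoidal.εIso 𝓜.F) ≪≫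
      Functor.Monoidal.μIso 𝓜.F (𝟙_ V) (𝟙_ V)) = (λ_ _).hom := by
    rw [discard, h₁, Functor.Monoidal.map_leftUnitor]
    simp [MonoidalCategory.tensorHom_def']
  rw [← h, h₂, ← leftUnitor_naturality, MonoidalCategory.tensorHom_def, Category.assoc]

/-- A counit law of the comonoid formed by copying and discarding. -/
theorem copy_discard_left (e : A ≅ 𝓜.F.obj X) :
    𝓜.copy e ≫ (𝓜.discard e ▷ A) = (λ_ A).inv := by
  have h : CartesianMonoidalCategory.lift (𝟙 X) (𝟙 X) ≫
      SemiCartesianMonoidalCategory.toUnit X ▷ X = (λ_ X).inv := by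
    rw [← cancel_mono (λ_ X).hom]; simp
  have h' : 𝓜.copy (Iso.refl (𝓜.F.obj X)) ≫ (𝓜.discard (Iso.refl _) ▷ 𝓜.F.obj X) =
      (λ_ _).inv := by
    have := Functor.OplaxMonoidal.δ_natural_left 𝓜.F (SemiCartesianMonoidalCategory.toUnit X) X
    simp only [copy, discard, Iso.refl_hom, Iso.refl_inv, Category.id_comp, Category.assoc,
      comp_whiskerRight, tensorHom_id, id_whiskerRight]
    rw [reassoc_of% this, ← Functor.map_comp_assoc, h, Functor.OplaxMonoidal.left_unitality]
  rw [copy_eq, discard_eq, Category.assoc, Category.assoc, comp_whiskerRight,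
    MonoidalCategory.tensorHom_def', Category.assoc, ← comp_whiskerRight_assoc, e.inv_hom_id,
    id_whiskerRight, Category.id_comp, whisker_exchange, reassoc_of% h']
  simp

/-- A counit law of the comonoid formed by copying and discarding. -/
theorem copy_discard_right (e : A ≅ 𝓜.F.obj X) :
    𝓜.copy e ≫ (A ◁ 𝓜.discard e) = (ρ_ A).inv := by
  have h : CartesianMonoidalCategory.lift (𝟙 X) (𝟙 X) ≫
      X ◁ SemiCartesianMonoidalCategory.toUnit X = (ρ_ X).inv := by
    rw [← cancel_mono (ρ_ X).hom]; simp
  have h' : 𝓜.copy (Iso.refl (𝓜.F.obj X)) ≫ (𝓜.F.obj X ◁ 𝓜.discard (Iso.refl _)) =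
      (ρ_ _).inv := by
    have := Functor.OplaxMonoidal.δ_natural_right 𝓜.F X (SemiCartesianMonoidalCategory.toUnit X)
    simp only [copy, discard, Iso.refl_hom, Iso.refl_inv, Category.id_comp, Category.assoc,
      whiskerLeft_comp, tensorHom_id, id_whiskerRight]
    rw [reassoc_of% this, ← Functor.map_comp_assoc, h, Functor.OplaxMonoidal.right_unitality]
  rw [copy_eq, discard_eq, Category.assoc, Category.assoc, whiskerLeft_comp,
    MonoidalCategory.tensorHom_def, Category.assoc, ← whiskerLeft_comp_assoc, e.inv_hom_id,
    whiskerLeft_id, Category.id_comp, ← whisker_exchange, reassoc_of% h']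
  simp

theorem copy_εIso : 𝓜.copy (Functor.Monoidal.εIso 𝓜.F) = (λ_ _).inv := by
  rw [← 𝓜.copy_discard_left, discard_εIso]
  simp

end EnrichedCLNLModel

end IntuitionisticMorphisms

/-! ### Naturality of the splitting maps -/

section SplitLemmas

variable {C : Type u} [Category.{v} C] [MonoidalCategory C]

/-- A map compatible with a splitting remains so when a variable that goes to the left part is
added. -/
theorem whiskerLeft_split_left {A Γ Γ₁ Γ₂ Δ Δ₁ Δ₂ : C} {a : Δ ⟶ Γ} {s : Γ ⟶ Γ₁ ⊗ Γ₂}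
    {s' : Δ ⟶ Δ₁ ⊗ Δ₂} {a₁ : Δ₁ ⟶ Γ₁} {a₂ : Δ₂ ⟶ Γ₂} (h : a ≫ s = s' ≫ (a₁ ⊗ₘ a₂)) :
    (A ◁ a) ≫ (A ◁ s) ≫ (α_ _ _ _).inv =
      ((A ◁ s') ≫ (α_ _ _ _).inv) ≫ ((A ◁ a₁) ⊗ₘ a₂) := by
  rw [← whiskerLeft_comp_assoc, h]
  simp [MonoidalCategory.tensorHom_def]

/-- A map compatible with a splitting remains so when a variable that it discards is added to the
left part of the source. -/
theorem discard_split_left {P Γ Γ₁ Γ₂ Δ Δ₁ Δ₂ : C} {a : Δ ⟶ Γ} {s : Γ ⟶ Γ₁ ⊗ Γ₂}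
    {s' : Δ ⟶ Δ₁ ⊗ Δ₂} {a₁ : Δ₁ ⟶ Γ₁} {a₂ : Δ₂ ⟶ Γ₂} (d : P ⟶ 𝟙_ C)
    (h : a ≫ s = s' ≫ (a₁ ⊗ₘ a₂)) :
    ((d ▷ _) ≫ (λ_ _).hom ≫ a) ≫ s =
      ((P ◁ s') ≫ (α_ _ _ _).inv) ≫ (((d ▷ _) ≫ (λ_ _).hom ≫ a₁) ⊗ₘ a₂) := by
  rw [Category.assoc, Category.assoc, h]
  simp only [MonoidalCategory.tensorHom_def, comp_whiskerRight, Category.assoc,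
    leftUnitor_whiskerRight]
  rw [← associator_inv_naturality_left_assoc, Iso.inv_hom_id_assoc, whisker_exchange_assoc,
    leftUnitor_naturality_assoc]

variable [SymmetricCategory C]

theorem swapIso_naturality {X Y Z X' Y' Z' : C} (f : X ⟶ X') (g : Y ⟶ Y') (h : Z ⟶ Z') :
    (f ⊗ₘ (g ⊗ₘ h)) ≫ (swapIso X' Y' Z').hom = (swapIso X Y Z).hom ≫ (g ⊗ₘ (f ⊗ₘ h)) := by
  have : ((f ⊗ₘ g) ⊗ₘ h) ≫ (β_ X' Y').hom ▷ Z' = (β_ X Y).hom ▷ Z ≫ ((g ⊗ₘ f) ⊗ₘ h) := by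
    rw [← comp_tensorHom, ← BraidedCategory.braiding_naturality, ← tensorHom_id,
      tensorHom_comp_tensorHom, Category.comp_id]
  simp only [swapIso, Iso.trans_hom, Iso.symm_hom, whiskerRightIso_hom, Category.assoc,
    associator_inv_naturality_assoc, reassoc_of% this, associator_naturality]

/-- A map compatible with a splitting remains so when a variable that goes to the right part is
added. -/
theorem whiskerLeft_split_right {A Γ Γ₁ Γ₂ Δ Δ₁ Δ₂ : C} {a : Δ ⟶ Γ} {s : Γ ⟶ Γ₁ ⊗ Γ₂}
    {s' : Δ ⟶ Δ₁ ⊗ Δ₂} {a₁ : Δ₁ ⟶ Γ₁} {a₂ : Δ₂ ⟶ Γ₂} (h : a ≫ s = s' ≫ (a₁ ⊗ₘ a₂)) :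
    (A ◁ a) ≫ (A ◁ s) ≫ (swapIso _ _ _).hom =
      ((A ◁ s') ≫ (swapIso _ _ _).hom) ≫ (a₁ ⊗ₘ (A ◁ a₂)) := by
  rw [← whiskerLeft_comp_assoc, h]
  have e₁ := swapIso_naturality (𝟙 A) a₁ a₂
  rw [id_tensorHom, id_tensorHom] at e₁
  rw [Category.assoc, ← e₁]
  simp

/-- Two maps compatible with splittings have a tensor product compatible with the interchanged
splitting; in particular for a variable that goes to both parts. -/
theorem tensor_split_both {A B A₁ A₂ B₁ B₂ Γ Γ₁ Γ₂ Δ Δ₁ Δ₂ : C} {a : Δ ⟶ Γ} {s : Γ ⟶ Γ₁ ⊗ Γ₂}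
    {s' : Δ ⟶ Δ₁ ⊗ Δ₂} {a₁ : Δ₁ ⟶ Γ₁} {a₂ : Δ₂ ⟶ Γ₂} (h : a ≫ s = s' ≫ (a₁ ⊗ₘ a₂))
    {b : B ⟶ A} {c : A ⟶ A₁ ⊗ A₂} {c' : B ⟶ B₁ ⊗ B₂} {b₁ : B₁ ⟶ A₁} {b₂ : B₂ ⟶ A₂}
    (h' : b ≫ c = c' ≫ (b₁ ⊗ₘ b₂)) :
    (b ⊗ₘ a) ≫ (c ⊗ₘ s) ≫ tensorμ _ _ _ _ =
      ((c' ⊗ₘ s') ≫ tensorμ _ _ _ _) ≫ ((b₁ ⊗ₘ a₁) ⊗ₘ (b₂ ⊗ₘ a₂)) := by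
  rw [tensorHom_comp_tensorHom_assoc, h, h', ← tensorHom_comp_tensorHom_assoc, Category.assoc,
    tensorμ_natural]

end SplitLemmas

/-! ### Weakening of contexts -/

section Contexts

variable {V : Type u₁} [Category.{v₁} V] [CartesianMonoidalCategory V] [BraidedCategory V]
  [MonoidalClosed V] [HasFiniteCoproducts V]
  {C : Type u₂} [Category.{v₂} C] [EnrichedOrdinaryCategory V C] [MonoidalCategory C]
  [SymmetricCategory C] [MonoidalClosed C] [HasFiniteCoproducts C]
  {M : Type u₃} [Category.{v₃} M] [MonoidalCategory M] [SymmetricCategory M]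

/-- `Weakening Γ Δ`: the context `Δ` extends `Γ` by intuitionistic variables, some of which may
come after the end of `Γ`. -/
inductive Weakening {W : Type w} : Ctx W → Ctx W → Type w
  | nil {Φ : Ctx W} (h : Φ.IsInt) : Weakening [] Φ
  | absent {Γ Δ : Ctx W} : Weakening Γ Δ → Weakening (none :: Γ) (none :: Δ)
  | keep (A : Ty W) {Γ Δ : Ctx W} : Weakening Γ Δ → Weakening (some A :: Γ) (some A :: Δ)
  | drop (P : Ty W) (h : P.IsInt) {Γ Δ : Ctx W} :
      Weakening Γ Δ → Weakening (none :: Γ) (some P :: Δ)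

theorem Weakening.isInt {W : Type w} {Γ Δ : Ctx W} (w : Weakening Γ Δ) (hΓ : Γ.IsInt) :
    Δ.IsInt := by
  induction w with
  | nil h => exact h
  | absent w ih => exact ih hΓ
  | keep A w ih => exact ⟨hΓ.1, ih hΓ.2⟩
  | drop P h w ih => exact ⟨h, ih hΓ⟩

variable (𝓜 : Model V C M) (Sg : Signature.{u₃, w, k} M)

/-- The projection `⟦Δ⟧ ⟶ ⟦Γ⟧`, which discards the additional variables. -/
noncomputable def Model.weaken : {Γ Δ : Ctx Sg.W} → Weakening Γ Δ → (𝓜.ctx Sg Δ ⟶ 𝓜.ctx Sg Γ)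
  | _, _, .nil h => 𝓜.discardCtx Sg _ h
  | _, _, .absent (Γ := Γ) (Δ := Δ) w => @weaken Γ Δ w
  | _, _, .keep A w => 𝓜.ty Sg A ◁ weaken w
  | _, _, .drop (Γ := Γ) (Δ := Δ) P h w =>
      (𝓜.discardTy Sg P h ▷ _) ≫ (λ_ _).hom ≫ @weaken Γ Δ w

theorem Model.discardCtx_some (P : Ty Sg.W) (Φ : Ctx Sg.W) (h : Ctx.IsInt (some P :: Φ)) :
    𝓜.discardCtx Sg (some P :: Φ) h =
      (𝓜.discardTy Sg P h.1 ▷ _) ≫ (λ_ _).hom ≫ 𝓜.discardCtx Sg Φ h.2 :=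
  𝓜.discard_tensor _ _

/-- Intuitionistic variables that are to be discarded may all be sent to the left part of a
splitting. -/
theorem Model.exists_split_left (Φ : Ctx Sg.W) (h : Φ.IsInt) :
    ∃ (Φ' : Ctx Sg.W) (h' : Φ'.IsInt) (s : CtxSplit Φ Φ Φ'),
      𝓜.discardCtx Sg Φ h ≫ (λ_ (𝟙_ C)).inv =
        𝓜.splitCtx Sg s ≫ (𝓜.discardCtx Sg Φ h ⊗ₘ 𝓜.discardCtx Sg Φ' h') := by
  induction Φ with
  | nil =>
    refine ⟨[], h, .nil, ?_⟩
    have : 𝓜.discardCtx Sg [] h = 𝟙 (𝟙_ C) := 𝓜.discard_εIso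
    have key : ∀ d : 𝟙_ C ⟶ 𝟙_ C, d = 𝟙 _ → d ≫ (λ_ (𝟙_ C)).inv = (λ_ (𝟙_ C)).inv ≫ (d ⊗ₘ d) := by
      rintro _ rfl
      simp
    exact key _ this
  | cons o Φ ih =>
    cases o with
    | none =>
      obtain ⟨Φ', h', s, hs⟩ := ih h
      exact ⟨none :: Φ', h', .absent s, hs⟩
    | some P =>
      obtain ⟨Φ', h', s, hs⟩ := ih h.2
      refine ⟨none :: Φ', h', .left P s, ?_⟩
      rw [𝓜.discardCtx_some]
      exact discard_split_left _ hs

variable {Sg}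

/-- Weakening is compatible with splitting contexts. -/
theorem Model.exists_split_weaken {Γ Γ₁ Γ₂ Δ : Ctx Sg.W} (w : Weakening Γ Δ)
    (s : CtxSplit Γ Γ₁ Γ₂) :
    ∃ (Δ₁ Δ₂ : Ctx Sg.W) (s' : CtxSplit Δ Δ₁ Δ₂) (w₁ : Weakening Γ₁ Δ₁) (w₂ : Weakening Γ₂ Δ₂),
      𝓜.weaken Sg w ≫ 𝓜.splitCtx Sg s =
        𝓜.splitCtx Sg s' ≫ (𝓜.weaken Sg w₁ ⊗ₘ 𝓜.weaken Sg w₂) := by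
  induction w generalizing Γ₁ Γ₂ with
  | nil h =>
    cases s
    obtain ⟨Φ', h', s', hs⟩ := 𝓜.exists_split_left Sg _ h
    exact ⟨_, Φ', s', .nil h, .nil h', hs⟩
  | absent w ih =>
    cases s with
    | absent s =>
      obtain ⟨Δ₁, Δ₂, s', w₁, w₂, h⟩ := ih s
      exact ⟨none :: Δ₁, none :: Δ₂, .absent s', .absent w₁, .absent w₂, h⟩
  | keep A w ih =>
    cases s with
    | left _ s =>
      obtain ⟨Δ₁, Δ₂, s', w₁, w₂, h⟩ := ih s
      exact ⟨_, _, .left A s', .keep A w₁, .absent w₂, whiskerLeft_split_left h⟩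
    | right _ s =>
      obtain ⟨Δ₁, Δ₂, s', w₁, w₂, h⟩ := ih s
      exact ⟨_, _, .right A s', .absent w₁, .keep A w₂, whiskerLeft_split_right h⟩
    | both _ hA s =>
      obtain ⟨Δ₁, Δ₂, s', w₁, w₂, h⟩ := ih s
      refine ⟨_, _, .both A hA s', .keep A w₁, .keep A w₂, ?_⟩
      have := tensor_split_both h (b := 𝟙 (𝓜.ty Sg A)) (b₁ := 𝟙 _) (b₂ := 𝟙 _)
        (c := 𝓜.copyTy Sg A hA) (c' := 𝓜.copyTy Sg A hA) (by simp)
      simp only [id_tensorHom] at this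
      exact this
  | drop P hP w ih =>
    cases s with
    | absent s =>
      obtain ⟨Δ₁, Δ₂, s', w₁, w₂, h⟩ := ih s
      exact ⟨_, _, .left P s', .drop P hP w₁, .absent w₂, discard_split_left _ h⟩

/-- A weakening of an intuitionistic context denotes an intuitionistic morphism, so that it commutes
with discarding, copying and lifting. -/
theorem Model.isIntuitionistic_weaken {Γ Δ : Ctx Sg.W} (w : Weakening Γ Δ) (hΓ : Γ.IsInt)
    (hΔ : Δ.IsInt) :
    𝓜.IsIntuitionistic (𝓜.ctxIntIso Sg Δ hΔ).2 (𝓜.ctxIntIso Sg Γ hΓ).2 (𝓜.weaken Sg w) := by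
  induction w with
  | nil h => exact 𝓜.isIntuitionistic_discard _
  | absent w ih => exact ih hΓ hΔ
  | keep A w ih =>
    have := (𝓜.isIntuitionistic_id (𝓜.intIso Sg A hΓ.1).2).tensor (ih hΓ.2 hΔ.2)
    rw [id_tensorHom] at this
    exact this
  | drop P h w ih =>
    have := ((𝓜.isIntuitionistic_discard (𝓜.intIso Sg P h).2).tensor
      (𝓜.isIntuitionistic_id (𝓜.ctxIntIso Sg _ hΔ.2).2)).comp
        ((𝓜.isIntuitionistic_leftUnitor _).comp (ih hΓ hΔ.2))
    rw [tensorHom_id] at this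
    exact this

/-- Weakening is compatible with looking up variables. -/
theorem Model.exists_lookup_weaken {Γ Δ : Ctx Sg.W} (w : Weakening Γ Δ) {i : ℕ} {A : Ty Sg.W}
    (x : VarAt Γ i A) :
    ∃ x' : VarAt Δ i A, 𝓜.lookup Sg x' = 𝓜.weaken Sg w ≫ 𝓜.lookup Sg x := by
  induction w generalizing i with
  | nil h => cases x
  | absent w ih =>
    cases x with
    | absent x =>
      obtain ⟨x', hx⟩ := ih x
      exact ⟨.absent x', hx⟩
  | keep B w ih =>
    cases x with
    | here _ h =>
      refine ⟨.here _ (w.isInt h), ?_⟩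
      have := (𝓜.isIntuitionistic_weaken w h (w.isInt h)).comp_discard
      have key : ∀ {A X Y : C} (a : X ⟶ Y) (d : Y ⟶ 𝟙_ C) (d' : X ⟶ 𝟙_ C), a ≫ d = d' →
        A ◁ d' ≫ (ρ_ A).hom = A ◁ a ≫ A ◁ d ≫ (ρ_ A).hom := by
        rintro A X Y a d _ rfl
        simp
      exact key _ _ _ this
    | skip _ h x =>
      obtain ⟨x', hx⟩ := ih x
      refine ⟨.skip _ h x', ?_⟩
      have key : ∀ {A X Y Z : C} (a : X ⟶ Y) (l : Y ⟶ Z) (l' : X ⟶ Z) (d : A ⟶ 𝟙_ C), l' = a ≫ l →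
        d ▷ _ ≫ (λ_ _).hom ≫ l' = A ◁ a ≫ d ▷ _ ≫ (λ_ _).hom ≫ l := by
        rintro A X Y Z a l _ d rfl
        simp [whisker_exchange_assoc]
      exact key _ _ _ _ hx
  | drop P h w ih =>
    cases x with
    | absent x =>
      obtain ⟨x', hx⟩ := ih x
      refine ⟨.skip _ h x', ?_⟩
      have key : ∀ {A X Y Z : C} (a : X ⟶ Y) (l : Y ⟶ Z) (l' : X ⟶ Z) (d : A ⟶ 𝟙_ C), l' = a ≫ l →
        d ▷ _ ≫ (λ_ _).hom ≫ l' = (d ▷ _ ≫ (λ_ _).hom ≫ a) ≫ l := by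
        rintro A X Y Z a l _ d rfl
        simp
      exact key _ _ _ _ hx

end Contexts

/-! ### Naturality of the interpretation of the rules -/

section NaturalityOfRules

variable {C : Type u} [Category.{v} C] [MonoidalCategory C]

section
variable {X X₁ X₂ Y Y₁ Y₂ A B Z : C} {φ : Y ⟶ X} {s : X ⟶ X₁ ⊗ X₂} {s' : Y ⟶ Y₁ ⊗ Y₂}
  {φ₁ : Y₁ ⟶ X₁} {φ₂ : Y₂ ⟶ X₂}

/-- Precomposition with a map compatible with the splitting, for a rule that tensors its premises.
-/
theorem tensor_natural (h : φ ≫ s = s' ≫ (φ₁ ⊗ₘ φ₂)) (d₁ : X₁ ⟶ A) (d₂ : X₂ ⟶ B) :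
    s' ≫ ((φ₁ ≫ d₁) ⊗ₘ (φ₂ ≫ d₂)) = φ ≫ s ≫ (d₁ ⊗ₘ d₂) := by
  rw [reassoc_of% h, tensorHom_comp_tensorHom]

theorem tensor_natural_assoc (h : φ ≫ s = s' ≫ (φ₁ ⊗ₘ φ₂)) (d₁ : X₁ ⟶ A) (d₂ : X₂ ⟶ B)
    (r : A ⊗ B ⟶ Z) :
    s' ≫ ((φ₁ ≫ d₁) ⊗ₘ (φ₂ ≫ d₂)) ≫ r = φ ≫ s ≫ (d₁ ⊗ₘ d₂) ≫ r := by
  rw [reassoc_of% h, tensorHom_comp_tensorHom_assoc]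

/-- Precomposition with a map compatible with the splitting, for a rule whose second premise
receives the result of the first. -/
theorem whisker_natural (h : φ ≫ s = s' ≫ (φ₁ ⊗ₘ φ₂)) (d₁ : X₁ ⟶ A) (r : A ⊗ X₂ ⟶ Z) :
    s' ≫ ((φ₁ ≫ d₁) ▷ _) ≫ (A ◁ φ₂) ≫ r = φ ≫ s ≫ (d₁ ▷ _) ≫ r := by
  rw [reassoc_of% h]
  simp [MonoidalCategory.tensorHom_def, whisker_exchange_assoc]

theorem bind_natural {Q Q' Γ Δ : C} (φ : Δ ⊗ Q' ⟶ Γ ⊗ Q) (d : (A ⊗ Γ) ⊗ Q ⟶ Z) :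
    (α_ A Δ Q').inv ≫ ((α_ A Δ Q').hom ≫ (A ◁ φ) ≫ (α_ A Γ Q).inv) ≫ d =
      (A ◁ φ) ≫ (α_ A Γ Q).inv ≫ d := by
  simp

theorem curry_bind_natural [MonoidalClosed C] {Q Q' Γ Δ : C} (φ : Δ ⊗ Q' ⟶ Γ ⊗ Q)
    (d : (A ⊗ Γ) ⊗ Q ⟶ Z) :
    MonoidalClosed.curry ((α_ A Δ Q').inv ≫
      ((α_ A Δ Q').hom ≫ (A ◁ φ) ≫ (α_ A Γ Q).inv) ≫ d) =
      φ ≫ MonoidalClosed.curry ((α_ A Γ Q).inv ≫ d) := by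
  rw [bind_natural, MonoidalClosed.curry_natural_left]
end

variable [SymmetricCategory C]

theorem letPair_natural {A B Z Q Q' Γ Δ : C} (φ : Δ ⊗ Q' ⟶ Γ ⊗ Q)
    (d : (B ⊗ A ⊗ Γ) ⊗ Q ⟶ Z) :
    ((β_ A B).hom ▷ _) ≫ (α_ _ _ _).hom ≫ (_ ◁ (α_ _ _ _).inv) ≫ (α_ _ _ _).inv ≫
      ((α_ B (A ⊗ Δ) Q').hom ≫ (B ◁ ((α_ A Δ Q').hom ≫ (A ◁ φ) ≫ (α_ A Γ Q).inv)) ≫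
        (α_ B (A ⊗ Γ) Q).inv) ≫ d =
    ((A ⊗ B) ◁ φ) ≫ ((β_ A B).hom ▷ _) ≫ (α_ _ _ _).hom ≫ (_ ◁ (α_ _ _ _).inv) ≫
      (α_ _ _ _).inv ≫ d := by
  rw [whisker_exchange_assoc]
  congr 1
  simp

variable [MonoidalClosed C] [HasFiniteCoproducts C] {A B X Y Z : C}

omit [SymmetricCategory C] in
/-- Tensoring distributes over coproducts, by closedness. -/
theorem whiskerLeft_coprod_hom_ext {f g : X ⊗ (A ⨿ B) ⟶ Z}
    (hl : X ◁ coprod.inl ≫ f = X ◁ coprod.inl ≫ g)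
    (hr : X ◁ coprod.inr ≫ f = X ◁ coprod.inr ≫ g) : f = g := by
  apply MonoidalClosed.curry_injective
  apply coprod.hom_ext
  · rw [← MonoidalClosed.curry_natural_left, hl, MonoidalClosed.curry_natural_left]
  · rw [← MonoidalClosed.curry_natural_left, hr, MonoidalClosed.curry_natural_left]

theorem coprod_whiskerRight_hom_ext {f g : (A ⨿ B) ⊗ X ⟶ Z}
    (hl : coprod.inl ▷ X ≫ f = coprod.inl ▷ X ≫ g)
    (hr : coprod.inr ▷ X ≫ f = coprod.inr ▷ X ≫ g) : f = g := by
  rw [← cancel_epi (β_ X (A ⨿ B)).hom]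
  apply whiskerLeft_coprod_hom_ext
  · rw [BraidedCategory.braiding_naturality_right_assoc, hl,
      BraidedCategory.braiding_naturality_right_assoc]
  · rw [BraidedCategory.braiding_naturality_right_assoc, hr,
      BraidedCategory.braiding_naturality_right_assoc]

theorem inl_caseMap (f : A ⊗ X ⟶ Z) (g : B ⊗ X ⟶ Z) : coprod.inl ▷ X ≫ caseMap f g = f := by
  rw [caseMap, BraidedCategory.braiding_naturality_left_assoc,
    ← MonoidalClosed.uncurry_natural_left, coprod.inl_desc, MonoidalClosed.uncurry_curry]
  simp

theorem inr_caseMap (f : A ⊗ X ⟶ Z) (g : B ⊗ X ⟶ Z) : coprod.inr ▷ X ≫ caseMap f g = g := by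
  rw [caseMap, BraidedCategory.braiding_naturality_left_assoc,
    ← MonoidalClosed.uncurry_natural_left, coprod.inr_desc, MonoidalClosed.uncurry_curry]
  simp

theorem caseMap_natural (φ : Y ⟶ X) (f : A ⊗ X ⟶ Z) (g : B ⊗ X ⟶ Z) :
    caseMap ((A ◁ φ) ≫ f) ((B ◁ φ) ≫ g) = ((A ⨿ B) ◁ φ) ≫ caseMap f g := by
  apply coprod_whiskerRight_hom_ext
  · rw [inl_caseMap, ← whisker_exchange_assoc, inl_caseMap]
  · rw [inr_caseMap, ← whisker_exchange_assoc, inr_caseMap]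

end NaturalityOfRules

/-! ### Interpreted substitutions -/

section Substitution

variable {V : Type u₁} [Category.{v₁} V] [CartesianMonoidalCategory V] [BraidedCategory V]
  [MonoidalClosed V] [HasFiniteCoproducts V]
  {C : Type u₂} [Category.{v₂} C] [EnrichedOrdinaryCategory V C] [MonoidalCategory C]
  [SymmetricCategory C] [MonoidalClosed C] [HasFiniteCoproducts C]
  {M : Type u₃} [Category.{v₃} M] [MonoidalCategory M] [SymmetricCategory M]
  {𝓜 : Model V C M} {Sg : Signature.{u₃, w, k} M}

/-- A class `R` of interpreted simultaneous substitutions: `R σ φ` says that `σ` substitutes terms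
over `Δ; Q'` for the variables of `Γ; Q`, with denotation `φ`. The fields are what an induction
over typing derivations needs: the denotation of variables, compatibility with discarding,
copying and splitting contexts, and stability under binders. -/
structure IsSubstClass (K : 𝓜.Constants Sg)
    (R : ∀ {Γ Δ : Ctx Sg.W} {Q Q' : LabelCtx Sg.W}, (ℕ → Term Sg) →
      (𝓜.ctx Sg Δ ⊗ 𝓜.labelCtx Sg Q' ⟶ 𝓜.ctx Sg Γ ⊗ 𝓜.labelCtx Sg Q) → Prop) : Prop where
  var {Γ Δ : Ctx Sg.W} {Q' : LabelCtx Sg.W} {σ : ℕ → Term Sg}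
    {φ : 𝓜.ctx Sg Δ ⊗ 𝓜.labelCtx Sg Q' ⟶ 𝓜.ctx Sg Γ ⊗ 𝓜.labelCtx Sg .empty} (h : R σ φ)
    {i : ℕ} {A : Ty Sg.W} (x : VarAt Γ i A) :
    ∃ d : Typing Δ Q' (σ i) A, Model.den K d = φ ≫ Model.den K (.var x)
  int {Γ Δ : Ctx Sg.W} {Q Q' : LabelCtx Sg.W} {σ : ℕ → Term Sg}
    {φ : 𝓜.ctx Sg Δ ⊗ 𝓜.labelCtx Sg Q' ⟶ 𝓜.ctx Sg Γ ⊗ 𝓜.labelCtx Sg Q} (h : R σ φ)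
    (hΓ : Γ.IsInt) :
    ∃ (hΔ : Δ.IsInt) (e : Q' = Q) (f : 𝓜.ctx Sg Δ ⟶ 𝓜.ctx Sg Γ),
      𝓜.IsIntuitionistic (𝓜.ctxIntIso Sg Δ hΔ).2 (𝓜.ctxIntIso Sg Γ hΓ).2 f ∧
        φ = f ⊗ₘ eqToHom (congrArg (𝓜.labelCtx Sg) e)
  split {Γ Γ₁ Γ₂ Δ : Ctx Sg.W} {Q Q₁ Q₂ Q' : LabelCtx Sg.W} {σ : ℕ → Term Sg}
    {φ : 𝓜.ctx Sg Δ ⊗ 𝓜.labelCtx Sg Q' ⟶ 𝓜.ctx Sg Γ ⊗ 𝓜.labelCtx Sg Q} (h : R σ φ)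
    (s : CtxSplit Γ Γ₁ Γ₂) (t : Q.Split Q₁ Q₂) :
    ∃ (Δ₁ Δ₂ : Ctx Sg.W) (Q₁' Q₂' : LabelCtx Sg.W) (s' : CtxSplit Δ Δ₁ Δ₂)
      (t' : Q'.Split Q₁' Q₂')
      (φ₁ : 𝓜.ctx Sg Δ₁ ⊗ 𝓜.labelCtx Sg Q₁' ⟶ 𝓜.ctx Sg Γ₁ ⊗ 𝓜.labelCtx Sg Q₁)
      (φ₂ : 𝓜.ctx Sg Δ₂ ⊗ 𝓜.labelCtx Sg Q₂' ⟶ 𝓜.ctx Sg Γ₂ ⊗ 𝓜.labelCtx Sg Q₂),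
      R σ φ₁ ∧ R σ φ₂ ∧ φ ≫ Model.split s t = Model.split s' t' ≫ (φ₁ ⊗ₘ φ₂)
  bind {Γ Δ : Ctx Sg.W} {Q Q' : LabelCtx Sg.W} {σ : ℕ → Term Sg}
    {φ : 𝓜.ctx Sg Δ ⊗ 𝓜.labelCtx Sg Q' ⟶ 𝓜.ctx Sg Γ ⊗ 𝓜.labelCtx Sg Q} (h : R σ φ)
    (A : Ty Sg.W) :
    R (Γ := some A :: Γ) (Δ := some A :: Δ) (Q := Q) (Q' := Q') (Term.ups σ)
      ((α_ (𝓜.ty Sg A) (𝓜.ctx Sg Δ) (𝓜.labelCtx Sg Q')).hom ≫ (𝓜.ty Sg A ◁ φ) ≫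
        (α_ (𝓜.ty Sg A) (𝓜.ctx Sg Γ) (𝓜.labelCtx Sg Q)).inv)

/-- The interpretation of a rule that starts by discarding an intuitionistic context. -/
theorem IsSubstClass.discard {K : 𝓜.Constants Sg}
    {R : ∀ {Γ Δ : Ctx Sg.W} {Q Q' : LabelCtx Sg.W}, (ℕ → Term Sg) →
      (𝓜.ctx Sg Δ ⊗ 𝓜.labelCtx Sg Q' ⟶ 𝓜.ctx Sg Γ ⊗ 𝓜.labelCtx Sg Q) → Prop}
    (hR : IsSubstClass K R) {Γ Δ : Ctx Sg.W} {Q Q' : LabelCtx Sg.W} {σ : ℕ → Term Sg}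
    {φ : 𝓜.ctx Sg Δ ⊗ 𝓜.labelCtx Sg Q' ⟶ 𝓜.ctx Sg Γ ⊗ 𝓜.labelCtx Sg Q} (h : R σ φ)
    (hΓ : Γ.IsInt) :
    ∃ (_ : Δ.IsInt) (e : Q' = Q), ∀ (hΔ : Δ.IsInt),
      φ ≫ (𝓜.discardCtx Sg Γ hΓ ▷ _) =
        𝓜.discardCtx Sg Δ hΔ ⊗ₘ eqToHom (congrArg (𝓜.labelCtx Sg) e) := by
  obtain ⟨hΔ, e, f, hf, rfl⟩ := hR.int h hΓ
  refine ⟨hΔ, e, fun _ => ?_⟩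
  subst e
  simp only [eqToHom_refl, tensorHom_id, ← comp_whiskerRight]
  exact congrArg (· ▷ _) hf.comp_discard

/-- The substitution lemma: a well-typed term stays well-typed under an interpreted substitution,
and its interpretation is precomposed with that of the substitution. -/
theorem IsSubstClass.exists_typing {K : 𝓜.Constants Sg}
    {R : ∀ {Γ Δ : Ctx Sg.W} {Q Q' : LabelCtx Sg.W}, (ℕ → Term Sg) →
      (𝓜.ctx Sg Δ ⊗ 𝓜.labelCtx Sg Q' ⟶ 𝓜.ctx Sg Γ ⊗ 𝓜.labelCtx Sg Q) → Prop}
    (hR : IsSubstClass K R) {Γ : Ctx Sg.W} {Q : LabelCtx Sg.W} {m : Term Sg} {A : Ty Sg.W}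
    (d : Typing Γ Q m A) {Δ : Ctx Sg.W} {Q' : LabelCtx Sg.W} {σ : ℕ → Term Sg}
    {φ : 𝓜.ctx Sg Δ ⊗ 𝓜.labelCtx Sg Q' ⟶ 𝓜.ctx Sg Γ ⊗ 𝓜.labelCtx Sg Q} (h : R σ φ) :
    ∃ d' : Typing Δ Q' (m.subst σ) A, Model.den K d' = φ ≫ Model.den K d := by
  induction d generalizing Δ Q' σ with
  | var x => exact hR.var h x
  | label hΦ ℓ α =>
    obtain ⟨hΔ, rfl, hφ⟩ := hR.discard h hΦ
    refine ⟨.label hΔ ℓ α, ?_⟩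
    have key : ∀ {X Y Q Z : C} {φ : X ⊗ Q ⟶ Y ⊗ Q} {d : Y ⟶ 𝟙_ C} {d' : X ⟶ 𝟙_ C} (r : Q ⟶ Z),
        φ ≫ (d ▷ Q) = d' ⊗ₘ 𝟙 Q →
        (d' ▷ Q) ≫ (λ_ _).hom ≫ r = φ ≫ (d ▷ Q) ≫ (λ_ _).hom ≫ r := by
      intro X Y Q Z φ d d' r h
      rw [reassoc_of% h, tensorHom_id]
    exact key _ (hφ hΔ)
  | const hΦ c =>
    obtain ⟨hΔ, rfl, hφ⟩ := hR.discard h hΦ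
    refine ⟨.const hΔ c, ?_⟩
    have key : ∀ {X Y Z : C} {φ : X ⊗ 𝟙_ C ⟶ Y ⊗ 𝟙_ C} {d : Y ⟶ 𝟙_ C} {d' : X ⟶ 𝟙_ C}
        (r : 𝟙_ C ⟶ Z), φ ≫ (d ▷ 𝟙_ C) = d' ⊗ₘ 𝟙 (𝟙_ C) →
        (ρ_ _).hom ≫ d' ≫ r = φ ≫ (ρ_ _).hom ≫ d ≫ r := by
      intro X Y Z φ d d' r h
      rw [← rightUnitor_naturality_assoc, ← rightUnitor_naturality_assoc, reassoc_of% h,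
        tensorHom_id]
    exact key _ (hφ hΔ)
  | let_ s t d d' ih ih' =>
    obtain ⟨Δ₁, Δ₂, Q₁', Q₂', s', t', φ₁, φ₂, h₁, h₂, hφ⟩ := hR.split h s t
    obtain ⟨d₁, hd₁⟩ := ih h₁
    obtain ⟨d₂, hd₂⟩ := ih' (hR.bind h₂ _)
    refine ⟨.let_ s' t' d₁ d₂, ?_⟩
    simp only [Model.den, hd₁, hd₂]
    rw [← whisker_natural hφ]
    exact congrArg (fun z => _ ≫ _ ≫ z) (bind_natural φ₂ _)
  | initial B d ih =>
    obtain ⟨d₁, hd₁⟩ := ih h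
    exact ⟨.initial B d₁, by simp only [Model.den, hd₁]; exact Category.assoc _ _ _⟩
  | left A B d ih =>
    obtain ⟨d₁, hd₁⟩ := ih h
    exact ⟨.left A B d₁, by simp only [Model.den, hd₁]; exact Category.assoc _ _ _⟩
  | right A B d ih =>
    obtain ⟨d₁, hd₁⟩ := ih h
    exact ⟨.right A B d₁, by simp only [Model.den, hd₁]; exact Category.assoc _ _ _⟩
  | case s t d d' d'' ih ih' ih'' =>
    obtain ⟨Δ₁, Δ₂, Q₁', Q₂', s', t', φ₁, φ₂, h₁, h₂, hφ⟩ := hR.split h s t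
    obtain ⟨d₁, hd₁⟩ := ih h₁
    obtain ⟨d₂, hd₂⟩ := ih' (hR.bind h₂ _)
    obtain ⟨d₃, hd₃⟩ := ih'' (hR.bind h₂ _)
    refine ⟨.case s' t' d₁ d₂ d₃, ?_⟩
    simp only [Model.den, hd₁, hd₂, hd₃]
    refine Eq.trans ?_ (whisker_natural hφ _ _)
    refine congrArg (fun z => _ ≫ _ ≫ z) (Eq.trans ?_ (caseMap_natural φ₂ _ _))
    exact congrArg₂ caseMap (bind_natural φ₂ _) (bind_natural φ₂ _)
  | star hΦ =>
    obtain ⟨hΔ, rfl, hφ⟩ := hR.discard h hΦ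
    refine ⟨.star hΔ, ?_⟩
    have key : ∀ {X Y : C} {φ : X ⊗ 𝟙_ C ⟶ Y ⊗ 𝟙_ C} {d : Y ⟶ 𝟙_ C} {d' : X ⟶ 𝟙_ C},
        φ ≫ (d ▷ 𝟙_ C) = d' ⊗ₘ 𝟙 (𝟙_ C) → (ρ_ _).hom ≫ d' = φ ≫ (ρ_ _).hom ≫ d := by
      intro X Y φ d d' h
      rw [← rightUnitor_naturality, ← rightUnitor_naturality, reassoc_of% h, tensorHom_id]
    exact key (hφ hΔ)
  | seq s t d d' ih ih' =>
    obtain ⟨Δ₁, Δ₂, Q₁', Q₂', s', t', φ₁, φ₂, h₁, h₂, hφ⟩ := hR.split h s t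
    obtain ⟨d₁, hd₁⟩ := ih h₁
    obtain ⟨d₂, hd₂⟩ := ih' h₂
    refine ⟨.seq s' t' d₁ d₂, ?_⟩
    simp only [Model.den, hd₁, hd₂]
    rw [← whisker_natural hφ]
    exact congrArg (fun z => _ ≫ _ ≫ z) (leftUnitor_naturality_assoc φ₂ _).symm
  | pair s t d d' ih ih' =>
    obtain ⟨Δ₁, Δ₂, Q₁', Q₂', s', t', φ₁, φ₂, h₁, h₂, hφ⟩ := hR.split h s t
    obtain ⟨d₁, hd₁⟩ := ih h₁
    obtain ⟨d₂, hd₂⟩ := ih' h₂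
    refine ⟨.pair s' t' d₁ d₂, ?_⟩
    simp only [Model.den, hd₁, hd₂]
    exact tensor_natural hφ _ _
  | letPair s t d d' ih ih' =>
    obtain ⟨Δ₁, Δ₂, Q₁', Q₂', s', t', φ₁, φ₂, h₁, h₂, hφ⟩ := hR.split h s t
    obtain ⟨d₁, hd₁⟩ := ih h₁
    obtain ⟨d₂, hd₂⟩ := ih' (hR.bind (hR.bind h₂ _) _)
    refine ⟨.letPair s' t' d₁ d₂, ?_⟩
    simp only [Model.den, hd₁, hd₂]
    rw [← whisker_natural hφ]
    exact congrArg (fun z => _ ≫ _ ≫ z) (letPair_natural φ₂ _)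
  | lam A d ih =>
    obtain ⟨d₁, hd₁⟩ := ih (hR.bind h _)
    refine ⟨.lam A d₁, ?_⟩
    simp only [Model.den, hd₁]
    exact curry_bind_natural φ _
  | app s t d d' ih ih' =>
    obtain ⟨Δ₁, Δ₂, Q₁', Q₂', s', t', φ₁, φ₂, h₁, h₂, hφ⟩ := hR.split h s t
    obtain ⟨d₁, hd₁⟩ := ih h₁
    obtain ⟨d₂, hd₂⟩ := ih' h₂
    refine ⟨.app s' t' d₁ d₂, ?_⟩
    simp only [Model.den, hd₁, hd₂]
    exact tensor_natural_assoc hφ _ _ _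
  | lift hΦ d ih =>
    obtain ⟨d₁, hd₁⟩ := ih h
    obtain ⟨hΔ, rfl, f, hf, rfl⟩ := hR.int h hΦ
    refine ⟨.lift hΔ d₁, ?_⟩
    simp only [Model.den, hd₁]
    have key : ∀ {X Y X' Y' Z Z' : C} {f : X ⟶ Y} {l : Y ⟶ Y'} {l' : X ⟶ X'} {r : X' ⟶ Y'}
        (g : Y' ⟶ Z), f ≫ l = l' ≫ r →
        (ρ_ X).hom ≫ l' ≫ r ≫ g = (f ⊗ₘ 𝟙 (𝟙_ C)) ≫ (ρ_ Y).hom ≫ l ≫ g := by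
      intro X Y X' Y' Z Z' f l l' r g h
      rw [tensorHom_id, rightUnitor_naturality_assoc, reassoc_of% h]
    refine Eq.trans ?_ (key (Z' := 𝟙_ C) (𝓜.F.map (𝓜.G.map ((ρ_ _).inv ≫ Model.den K d)))
      hf.comp_lift)
    have e : (ρ_ _).inv ≫ (f ⊗ₘ 𝟙 (𝟙_ C)) ≫ Model.den K d =
      f ≫ (ρ_ _).inv ≫ Model.den K d := by
        have key : ∀ {X Y Z : C} (f : X ⟶ Y) (g : Y ⊗ 𝟙_ C ⟶ Z),
            (ρ_ X).inv ≫ (f ⊗ₘ 𝟙 (𝟙_ C)) ≫ g = f ≫ (ρ_ Y).inv ≫ g := by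
          intro X Y Z f g
          rw [tensorHom_id, ← rightUnitor_inv_naturality_assoc]
        exact key _ _
    rw [← Functor.map_comp, ← Functor.map_comp]
    exact congrArg (fun z => (ρ_ _).hom ≫ _ ≫ 𝓜.F.map (𝓜.G.map z)) e
  | force d ih =>
    obtain ⟨d₁, hd₁⟩ := ih h
    exact ⟨.force d₁, by simp only [Model.den, hd₁]; exact Category.assoc _ _ _⟩
  | box d ih =>
    obtain ⟨d₁, hd₁⟩ := ih h
    exact ⟨.box d₁, by simp only [Model.den, hd₁]; exact Category.assoc _ _ _⟩
  | apply s t d d' ih ih' =>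
    obtain ⟨Δ₁, Δ₂, Q₁', Q₂', s', t', φ₁, φ₂, h₁, h₂, hφ⟩ := hR.split h s t
    obtain ⟨d₁, hd₁⟩ := ih h₁
    obtain ⟨d₂, hd₂⟩ := ih' h₂
    refine ⟨.apply s' t' d₁ d₂, ?_⟩
    simp only [Model.den, hd₁, hd₂]
    rw [Category.assoc φ₁]
    exact tensor_natural_assoc hφ _ _ _
  | diag hΦ hl hl' =>
    obtain ⟨hΔ, rfl, hφ⟩ := hR.discard h hΦ
    refine ⟨.diag hΔ hl hl', ?_⟩
    have key : ∀ {X Y Z : C} {φ : X ⊗ 𝟙_ C ⟶ Y ⊗ 𝟙_ C} {d : Y ⟶ 𝟙_ C} {d' : X ⟶ 𝟙_ C}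
        (r : 𝟙_ C ⟶ Z), φ ≫ (d ▷ 𝟙_ C) = d' ⊗ₘ 𝟙 (𝟙_ C) →
        (ρ_ _).hom ≫ d' ≫ r = φ ≫ (ρ_ _).hom ≫ d ≫ r := by
      intro X Y Z φ d d' r h
      rw [← rightUnitor_naturality_assoc, ← rightUnitor_naturality_assoc, reassoc_of% h,
        tensorHom_id]
    exact key _ (hφ hΔ)

/-- The class of weakenings, regarded as identity substitutions. -/
inductive WeakeningRel (𝓜 : Model V C M) (Sg : Signature.{u₃, w, k} M) :
    ∀ {Γ Δ : Ctx Sg.W} {Q Q' : LabelCtx Sg.W}, (ℕ → Term Sg) →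
      (𝓜.ctx Sg Δ ⊗ 𝓜.labelCtx Sg Q' ⟶ 𝓜.ctx Sg Γ ⊗ 𝓜.labelCtx Sg Q) → Prop
  | mk {Γ Δ : Ctx Sg.W} (Q : LabelCtx Sg.W) (x : Weakening Γ Δ) :
      WeakeningRel 𝓜 Sg (Q := Q) (Q' := Q) Term.var (𝓜.weaken Sg x ▷ 𝓜.labelCtx Sg Q)

omit [SymmetricCategory M] in
theorem Term.ups_var : Term.ups (Term.var : ℕ → Term Sg) = Term.var := by
  funext i
  cases i <;> rfl

omit [SymmetricCategory M] in
theorem Term.subst_var (m : Term Sg) : m.subst Term.var = m := by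
  induction m <;> simp_all [Term.subst, Term.ups_var]

/-- Weakenings form a class of interpreted substitutions. -/
theorem isSubstClass_weakening (K : 𝓜.Constants Sg) : IsSubstClass K (WeakeningRel 𝓜 Sg) where
  var h i A x := by
    cases h with
    | mk w =>
    obtain ⟨x', hx⟩ := 𝓜.exists_lookup_weaken w x
    refine ⟨.var x', ?_⟩
    simp only [Model.den, hx]
    exact (rightUnitor_naturality_assoc _ _).symm
  int h hΓ := by
    cases h with
    | mk w => exact ⟨w.isInt hΓ, rfl, _, 𝓜.isIntuitionistic_weaken w hΓ _, by simp⟩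
  split h s t := by
    cases h with
    | mk w =>
    obtain ⟨Δ₁, Δ₂, s', w₁, w₂, hw⟩ := 𝓜.exists_split_weaken w s
    refine ⟨Δ₁, Δ₂, _, _, s', t, _, _, .mk _ w₁, .mk _ w₂, ?_⟩
    have := tensor_split_both (a := 𝟙 _) (s := (𝓜.splitLabels Sg t).hom)
      (s' := (𝓜.splitLabels Sg t).hom) (a₁ := 𝟙 _) (a₂ := 𝟙 _) (by simp) hw
    simp only [tensorHom_id] at this
    exact this
  bind h A := by
    cases h with
    | mk w =>
    rw [Term.ups_var]
    convert WeakeningRel.mk (𝓜 := 𝓜) _ (.keep A w) using 1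
    have key : ∀ {A X Y Q : C} (w : X ⟶ Y),
        (α_ A X Q).hom ≫ (A ◁ w ▷ Q) ≫ (α_ A Y Q).inv = (A ◁ w) ▷ Q := by
      intros
      simp
    exact key _

/-- Weakening a derivation precomposes its interpretation with the projection. -/
theorem Typing.exists_weaken (K : 𝓜.Constants Sg) {Γ Δ : Ctx Sg.W} {Q : LabelCtx Sg.W}
    {m : Term Sg} {A : Ty Sg.W} (d : Typing Γ Q m A) (w : Weakening Γ Δ) :
    ∃ d' : Typing Δ Q m A, Model.den K d' = (𝓜.weaken Sg w ▷ _) ≫ Model.den K d := by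
  have := (isSubstClass_weakening K).exists_typing d (.mk Q w)
  rwa [m.subst_var] at this

end Substitution

/-! ### Free labels and free variables -/

section FreeNames

variable {M : Type u₃} [Category.{v₃} M] [MonoidalCategory M] {Sg : Signature.{u₃, w, k} M}

/-- The free labels of a term: those that its typing derivations use linearly. The labels of a
boxed diagram `(ℓ⃗, S, ℓ⃗')` are bound. -/
def Term.freeLabels : Term Sg → Set ℕ
  | .var _ => ∅
  | .const _ => ∅
  | .let_ m n => m.freeLabels ∪ n.freeLabels
  | .initial _ m => m.freeLabels
  | .left _ _ m => m.freeLabels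
  | .right _ _ m => m.freeLabels
  | .case m n _ => m.freeLabels ∪ n.freeLabels
  | .star => ∅
  | .seq m n => m.freeLabels ∪ n.freeLabels
  | .pair m n => m.freeLabels ∪ n.freeLabels
  | .letPair m n => m.freeLabels ∪ n.freeLabels
  | .lam _ m => m.freeLabels
  | .app m n => m.freeLabels ∪ n.freeLabels
  | .lift _ => ∅
  | .force m => m.freeLabels
  | .label ℓ => {ℓ}
  | .box _ m => m.freeLabels
  | .apply m n => m.freeLabels ∪ n.freeLabels
  | .diag _ _ _ => ∅

theorem LabelCtx.labels_empty {W : Type w} : (LabelCtx.empty : LabelCtx W).labels = ∅ := by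
  ext; simp [LabelCtx.labels, LabelCtx.empty]

theorem LabelCtx.labels_single {W : Type w} (ℓ : ℕ) (α : W) :
    (LabelCtx.single ℓ α).labels = {ℓ} := by
  ext; simp [LabelCtx.labels, LabelCtx.single]

/-- Labels are used exactly once, so a term determines the domain of its label context. -/
theorem Typing.labels_eq {Γ : Ctx Sg.W} {Q : LabelCtx Sg.W} {m : Term Sg} {A : Ty Sg.W}
    (d : Typing Γ Q m A) : Q.labels = m.freeLabels := by
  induction d with
  | var | const | star | lift | diag => exact LabelCtx.labels_empty
  | label h ℓ α => exact LabelCtx.labels_single ℓ α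
  | initial _ _ ih | left _ _ _ ih | right _ _ _ ih | lam _ _ ih | force _ ih | box _ ih => exact ih
  | case s t d d₁ d₂ ih ih₁ ih₂ =>
    rw [LabelCtx.Split.labels_eq t, ih, ih₁]; rfl
  | let_ s t d d₁ ih ih₁ | seq s t d d₁ ih ih₁ | pair s t d d₁ ih ih₁ | letPair s t d d₁ ih ih₁
  | app s t d d₁ ih ih₁ | apply s t d d₁ ih ih₁ =>
    rw [LabelCtx.Split.labels_eq t, ih, ih₁]; rfl

/-- `m.IsFree i`: the variable with index `i` occurs freely in `m`. -/
def Term.IsFree : Term Sg → ℕ → Prop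
  | .var j, i => i = j
  | .const _, _ => False
  | .let_ m n, i => m.IsFree i ∨ n.IsFree (i + 1)
  | .initial _ m, i => m.IsFree i
  | .left _ _ m, i => m.IsFree i
  | .right _ _ m, i => m.IsFree i
  | .case m n p, i => m.IsFree i ∨ n.IsFree (i + 1) ∨ p.IsFree (i + 1)
  | .star, _ => False
  | .seq m n, i => m.IsFree i ∨ n.IsFree i
  | .pair m n, i => m.IsFree i ∨ n.IsFree i
  | .letPair m n, i => m.IsFree i ∨ n.IsFree (i + 2)
  | .lam _ m, i => m.IsFree (i + 1)
  | .app m n, i => m.IsFree i ∨ n.IsFree i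
  | .lift m, i => m.IsFree i
  | .force m, i => m.IsFree i
  | .label _, _ => False
  | .box _ m, i => m.IsFree i
  | .apply m n, i => m.IsFree i ∨ n.IsFree i
  | .diag _ _ _, _ => False

variable {W : Type w}

theorem CtxSplit.getElem?_left {Γ Γ₁ Γ₂ : Ctx W} (s : CtxSplit Γ Γ₁ Γ₂) {i : ℕ} {A : Ty W}
    (h : Γ₁[i]? = some (some A)) : Γ[i]? = some (some A) := by
  induction s generalizing i with
  | nil => exact h
  | absent s ih | left _ s ih | right _ s ih | both _ _ s ih => cases i <;> simp_all

theorem CtxSplit.getElem?_right {Γ Γ₁ Γ₂ : Ctx W} (s : CtxSplit Γ Γ₁ Γ₂) {i : ℕ} {A : Ty W}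
    (h : Γ₂[i]? = some (some A)) : Γ[i]? = some (some A) := by
  induction s generalizing i with
  | nil => exact h
  | absent s ih | left _ s ih | right _ s ih | both _ _ s ih => cases i <;> simp_all

theorem CtxSplit.getElem?_or {Γ Γ₁ Γ₂ : Ctx W} (s : CtxSplit Γ Γ₁ Γ₂) {i : ℕ} {A : Ty W}
    (h : Γ[i]? = some (some A)) : Γ₁[i]? = some (some A) ∨ Γ₂[i]? = some (some A) := by
  induction s generalizing i with
  | nil => exact .inl h
  | absent s ih | left _ s ih | right _ s ih | both _ _ s ih => cases i <;> simp_all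

theorem VarAt.getElem? {Γ : Ctx W} {i : ℕ} {A : Ty W} (x : VarAt Γ i A) :
    Γ[i]? = some (some A) := by
  induction x <;> simp_all

theorem Ctx.IsInt.of_getElem? {Γ : Ctx W} (h : Γ.IsInt) {i : ℕ} {A : Ty W}
    (hi : Γ[i]? = some (some A)) : A.IsInt := by
  induction Γ generalizing i with
  | nil => simp at hi
  | cons o Γ ih =>
    cases o <;> cases i <;> simp_all [Ctx.IsInt]
    · exact ih hi
    · exact ih hi

theorem VarAt.eq_of_not_isInt {Γ : Ctx W} {i j : ℕ} {A B : Ty W} (x : VarAt Γ j A)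
    (hi : Γ[i]? = some (some B)) (hB : ¬ B.IsInt) : i = j := by
  induction x generalizing i with
  | here A h =>
    cases i with
    | zero => rfl
    | succ i => exact (hB (h.of_getElem? (by simpa using hi))).elim
  | absent x ih =>
    cases i with
    | zero => simp at hi
    | succ i => rw [ih (i := i) (by simpa using hi)]
  | skip P h x ih =>
    cases i with
    | zero => simp at hi; subst hi; exact (hB h).elim
    | succ i => rw [ih (i := i) (by simpa using hi)]

theorem Typing.getElem?_of_isFree {Γ : Ctx Sg.W} {Q : LabelCtx Sg.W} {m : Term Sg} {A : Ty Sg.W}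
    (d : Typing Γ Q m A) {i : ℕ} (h : m.IsFree i) : ∃ B, Γ[i]? = some (some B) := by
  induction d generalizing i with
  | var x => cases h; exact ⟨_, x.getElem?⟩
  | const | star | label | diag => exact h.elim
  | initial _ _ ih | left _ _ _ ih | right _ _ _ ih | force _ ih | box _ ih | lift _ _ ih =>
    exact ih h
  | lam _ _ ih => simpa using ih (i := i + 1) h
  | let_ s t d d₁ ih ih₁ =>
    rcases h with h | h
    · obtain ⟨B, hB⟩ := ih h; exact ⟨B, s.getElem?_left hB⟩
    · obtain ⟨B, hB⟩ := ih₁ h; exact ⟨B, s.getElem?_right (by simpa using hB)⟩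
  | letPair s t d d₁ ih ih₁ =>
    rcases h with h | h
    · obtain ⟨B, hB⟩ := ih h; exact ⟨B, s.getElem?_left hB⟩
    · obtain ⟨B, hB⟩ := ih₁ h; exact ⟨B, s.getElem?_right (by simpa using hB)⟩
  | case s t d d₁ d₂ ih ih₁ ih₂ =>
    rcases h with h | h | h
    · obtain ⟨B, hB⟩ := ih h; exact ⟨B, s.getElem?_left hB⟩
    · obtain ⟨B, hB⟩ := ih₁ h; exact ⟨B, s.getElem?_right (by simpa using hB)⟩
    · obtain ⟨B, hB⟩ := ih₂ h; exact ⟨B, s.getElem?_right (by simpa using hB)⟩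
  | seq s t d d₁ ih ih₁ | pair s t d d₁ ih ih₁ | app s t d d₁ ih ih₁ | apply s t d d₁ ih ih₁ =>
    rcases h with h | h
    · obtain ⟨B, hB⟩ := ih h; exact ⟨B, s.getElem?_left hB⟩
    · obtain ⟨B, hB⟩ := ih₁ h; exact ⟨B, s.getElem?_right hB⟩

/-- Variables that are not of intuitionistic type cannot be discarded, so that they occur in the
term. -/
theorem Typing.isFree_of_not_isInt {Γ : Ctx Sg.W} {Q : LabelCtx Sg.W} {m : Term Sg}
    {A : Ty Sg.W} (d : Typing Γ Q m A) {i : ℕ} {B : Ty Sg.W} (h : Γ[i]? = some (some B))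
    (hB : ¬ B.IsInt) : m.IsFree i := by
  induction d generalizing i with
  | var x => exact x.eq_of_not_isInt h hB
  | const hΦ | star hΦ | label hΦ | diag hΦ | lift hΦ => exact (hB (hΦ.of_getElem? h)).elim
  | initial _ _ ih | left _ _ _ ih | right _ _ _ ih | force _ ih | box _ ih => exact ih h
  | lam _ _ ih => exact ih (i := i + 1) (by simpa using h)
  | let_ s t d d₁ ih ih₁ =>
    exact (s.getElem?_or h).imp ih fun h => ih₁ (i := i + 1) (by simpa using h)
  | letPair s t d d₁ ih ih₁ =>
    exact (s.getElem?_or h).imp ih fun h => ih₁ (i := i + 2) (by simpa using h)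
  | case s t d d₁ d₂ ih ih₁ ih₂ =>
    exact (s.getElem?_or h).imp ih fun h => .inl (ih₁ (i := i + 1) (by simpa using h))
  | seq s t d d₁ ih ih₁ | pair s t d d₁ ih ih₁ | app s t d d₁ ih ih₁ | apply s t d d₁ ih ih₁ =>
    exact (s.getElem?_or h).imp ih ih₁

end FreeNames

/-! ### Uniqueness of the components of a derivation -/

section Uniqueness

variable {W : Type w}

theorem MTy.toTy_injective : Function.Injective (MTy.toTy (W := W)) := by
  intro T
  induction T with
  | wire α => intro U h; cases U <;> simp_all [MTy.toTy]
  | unit => intro U h; cases U <;> simp_all [MTy.toTy]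
  | tensor T T' ih ih' =>
    intro U h
    cases U with
    | tensor U U' =>
      simp only [MTy.toTy, Ty.tensor.injEq] at h
      rw [ih h.1, ih' h.2]
    | _ => simp [MTy.toTy] at h

theorem VarAt.type_unique {Γ : Ctx W} {i : ℕ} {A A' : Ty W} (x : VarAt Γ i A)
    (x' : VarAt Γ i A') : A = A' := by
  simpa using x.getElem?.symm.trans x'.getElem?

theorem VarAt.subsingleton {Γ : Ctx W} {i : ℕ} {A : Ty W} (x x' : VarAt Γ i A) : x = x' := by
  induction x with
  | here A h => cases x'; rfl
  | absent x ih => cases x' with | absent x' => rw [ih x']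
  | skip P h x ih => cases x' with | skip _ _ x' => rw [ih x']

theorem CtxSplit.subsingleton {Γ Γ₁ Γ₂ : Ctx W} (s s' : CtxSplit Γ Γ₁ Γ₂) : s = s' := by
  induction s with
  | nil => cases s'; rfl
  | absent s ih => cases s' with | absent s' => rw [ih s']
  | left A s ih => cases s' with | left _ s' => rw [ih s']
  | right A s ih => cases s' with | right _ s' => rw [ih s']
  | both A h s ih => cases s' with | both _ _ s' => rw [ih s']

theorem LTyping.labels_eq {Q : LabelCtx W} {l : LTuple} {T : MTy W} (h : LTyping Q l T) :
    Q.labels = l.labels := by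
  induction h with
  | label ℓ α => exact LabelCtx.labels_single ℓ α
  | star => exact LabelCtx.labels_empty
  | pair s h h' ih ih' => rw [LabelCtx.Split.labels_eq s, ih, ih']; rfl

theorem LabelCtx.single_injective {ℓ : ℕ} {α β : W} (h : LabelCtx.single ℓ α = .single ℓ β) :
    α = β := by
  simpa [LabelCtx.single] using h

/-- A label tuple has at most one typing over a given label context. Equality of label contexts is a
hypothesis, in order to allow induction. -/
theorem LTyping.sigma_eq {Q Q' : LabelCtx W} {l : LTuple} {T T' : MTy W} (h : LTyping Q l T)
    (e : Q = Q') (h' : LTyping Q' l T') : T = T' ∧ HEq h h' := by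
  induction h generalizing Q' T' with
  | label ℓ α =>
    cases h' with
    | label _ β =>
      obtain rfl := LabelCtx.single_injective e
      exact ⟨rfl, HEq.rfl⟩
  | star => cases h'; exact ⟨rfl, HEq.rfl⟩
  | pair s h₁ h₂ ih₁ ih₂ =>
    cases h' with
    | pair s' h₁' h₂' =>
      subst e
      have e₁ := LabelCtx.eq_of_labels_eq (Shuffle.sublist_left s) (Shuffle.sublist_left s')
        (h₁.labels_eq.trans h₁'.labels_eq.symm)
      obtain ⟨rfl, e₁'⟩ := ih₁ e₁ h₁'
      subst e₁
      have e₂ := LabelCtx.Split.right_eq s s'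
      obtain ⟨rfl, e₂'⟩ := ih₂ e₂ h₂'
      subst e₂
      cases e₁'
      cases e₂'
      rw [LabelCtx.Split.subsingleton s s']
      exact ⟨rfl, HEq.rfl⟩

theorem LTyping.type_unique {Q : LabelCtx W} {l : LTuple} {T T' : MTy W} (h : LTyping Q l T)
    (h' : LTyping Q l T') : T = T' :=
  (h.sigma_eq rfl h').1

theorem LTyping.subsingleton {Q : LabelCtx W} {l : LTuple} {T : MTy W} (h h' : LTyping Q l T) :
    h = h' :=
  eq_of_heq (h.sigma_eq rfl h').2

/-- The part of a context that consists of its intuitionistic variables and of the variables whose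
index satisfies `p`. -/
noncomputable def Ctx.restrict : (ℕ → Prop) → Ctx W → Ctx W
  | _, [] => []
  | p, none :: Γ => none :: Ctx.restrict (fun i => p (i + 1)) Γ
  | p, some A :: Γ =>
      have := Classical.propDecidable (A.IsInt ∨ p 0)
      (if A.IsInt ∨ p 0 then some A else none) :: Ctx.restrict (fun i => p (i + 1)) Γ

theorem Ctx.restrict_some_pos {p : ℕ → Prop} {Γ : Ctx W} {A : Ty W} (h : A.IsInt ∨ p 0) :
    Ctx.restrict p (some A :: Γ) = some A :: Ctx.restrict (fun i => p (i + 1)) Γ := by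
  simp only [Ctx.restrict, if_pos h]

theorem Ctx.restrict_some_neg {p : ℕ → Prop} {Γ : Ctx W} {A : Ty W} (h : ¬ (A.IsInt ∨ p 0)) :
    Ctx.restrict p (some A :: Γ) = none :: Ctx.restrict (fun i => p (i + 1)) Γ := by
  simp only [Ctx.restrict, if_neg h]

end Uniqueness

/-! ### Splittings that duplicate an intuitionistic variable -/

section MaximalSplit

variable {C : Type u} [Category.{v} C] [MonoidalCategory C] [SymmetricCategory C]

/-- Sending a variable to the left part is the same as copying it and discarding the right copy. -/
theorem split_both_discard_right {A Γ Γ₁ Γ₂ Δ₁ Δ₂ : C} {s : Γ ⟶ Γ₁ ⊗ Γ₂} {s' : Γ ⟶ Δ₁ ⊗ Δ₂}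
    {a₁ : Δ₁ ⟶ Γ₁} {a₂ : Δ₂ ⟶ Γ₂} (h : s = s' ≫ (a₁ ⊗ₘ a₂)) {c : A ⟶ A ⊗ A} {d : A ⟶ 𝟙_ C}
    (hc : c ≫ (A ◁ d) = (ρ_ A).inv) :
    (A ◁ s) ≫ (α_ _ _ _).inv =
      ((c ⊗ₘ s') ≫ tensorμ _ _ _ _) ≫ ((A ◁ a₁) ⊗ₘ ((d ▷ _) ≫ (λ_ _).hom ≫ a₂)) := by
  have := tensor_split_both (a := 𝟙 _) (s := s) (s' := s') (a₁ := a₁) (a₂ := a₂) (by simpa using h)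
    (b := 𝟙 A) (c := (ρ_ A).inv) (c' := c) (b₁ := 𝟙 A) (b₂ := d) (by simpa using hc.symm)
  have e : (d ▷ _) ≫ (λ_ _).hom ≫ a₂ = (d ⊗ₘ a₂) ≫ (λ_ _).hom := by
    simp [MonoidalCategory.tensorHom_def]
  have e' : (A ◁ a₁) ⊗ₘ ((d ⊗ₘ a₂) ≫ (λ_ _).hom) =
      ((𝟙 A ⊗ₘ a₁) ⊗ₘ (d ⊗ₘ a₂)) ≫ (_ ◁ (λ_ _).hom) := by
    simp [MonoidalCategory.tensorHom_def]
  rw [e, e', ← Category.assoc, ← this]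
  simp only [tensorμ, braiding_tensorUnit_left]
  simp only [MonoidalCategory.tensorHom_def]
  monoidal

/-- Sending a variable to the right part is the same as copying it and discarding the left copy. -/
theorem split_both_discard_left {A Γ Γ₁ Γ₂ Δ₁ Δ₂ : C} {s : Γ ⟶ Γ₁ ⊗ Γ₂} {s' : Γ ⟶ Δ₁ ⊗ Δ₂}
    {a₁ : Δ₁ ⟶ Γ₁} {a₂ : Δ₂ ⟶ Γ₂} (h : s = s' ≫ (a₁ ⊗ₘ a₂)) {c : A ⟶ A ⊗ A} {d : A ⟶ 𝟙_ C}
    (hc : c ≫ (d ▷ A) = (λ_ A).inv) :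
    (A ◁ s) ≫ (swapIso _ _ _).hom =
      ((c ⊗ₘ s') ≫ tensorμ _ _ _ _) ≫ (((d ▷ _) ≫ (λ_ _).hom ≫ a₁) ⊗ₘ (A ◁ a₂)) := by
  have := tensor_split_both (a := 𝟙 _) (s := s) (s' := s') (a₁ := a₁) (a₂ := a₂) (by simpa using h)
    (b := 𝟙 A) (c := (λ_ A).inv) (c' := c) (b₁ := d) (b₂ := 𝟙 A) (by simpa using hc.symm)
  have e : (d ▷ _) ≫ (λ_ _).hom ≫ a₁ = (d ⊗ₘ a₁) ≫ (λ_ _).hom := by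
    simp [MonoidalCategory.tensorHom_def]
  have e' : ((d ⊗ₘ a₁) ≫ (λ_ _).hom) ⊗ₘ (A ◁ a₂) =
      ((d ⊗ₘ a₁) ⊗ₘ (𝟙 A ⊗ₘ a₂)) ≫ ((λ_ _).hom ▷ _) := by
    simp [MonoidalCategory.tensorHom_def]
  rw [e, e', ← Category.assoc, ← this]
  simp only [tensorμ, swapIso, Iso.trans_hom, Iso.symm_hom, whiskerRightIso_hom]
  simp only [MonoidalCategory.tensorHom_def]
  monoidal

end MaximalSplit

/-! ### Independence of the derivation -/

section Coherence

variable {V : Type u₁} [Category.{v₁} V] [CartesianMonoidalCategory V] [BraidedCategory V]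
  [MonoidalClosed V] [HasFiniteCoproducts V]
  {C : Type u₂} [Category.{v₂} C] [EnrichedOrdinaryCategory V C] [MonoidalCategory C]
  [SymmetricCategory C] [MonoidalClosed C] [HasFiniteCoproducts C]
  {M : Type u₃} [Category.{v₃} M] [MonoidalCategory M] [SymmetricCategory M]
  (𝓜 : Model V C M) {Sg : Signature.{u₃, w, k} M}

/-- Every way of splitting a context factors through the way that duplicates all intuitionistic
variables. The latter depends only on the set `p` of the linear variables sent to the left part;
`p` may also contain intuitionistic variables. -/
theorem Model.exists_restrict {Γ Γ₁ Γ₂ : Ctx Sg.W} (s : CtxSplit Γ Γ₁ Γ₂) (p : ℕ → Prop)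
    (hp : ∀ i, p i → ∃ B, Γ₁[i]? = some (some B))
    (hp' : ∀ i B, Γ₁[i]? = some (some B) → ¬ B.IsInt → p i) :
    ∃ (Δ₁ Δ₂ : Ctx Sg.W) (_ : Δ₁ = Ctx.restrict p Γ) (_ : Δ₂ = Ctx.restrict (fun i => ¬ p i) Γ)
      (s' : CtxSplit Γ Δ₁ Δ₂) (w₁ : Weakening Γ₁ Δ₁) (w₂ : Weakening Γ₂ Δ₂),
      𝓜.splitCtx Sg s = 𝓜.splitCtx Sg s' ≫ (𝓜.weaken Sg w₁ ⊗ₘ 𝓜.weaken Sg w₂) := by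
  induction s generalizing p with
  | nil =>
    refine ⟨[], [], rfl, rfl, .nil, .nil trivial, .nil trivial, ?_⟩
    have : 𝓜.discardCtx Sg [] trivial = 𝟙 (𝟙_ C) := 𝓜.discard_εIso
    have key : ∀ d : 𝟙_ C ⟶ 𝟙_ C, d = 𝟙 _ → (λ_ (𝟙_ C)).inv = (λ_ (𝟙_ C)).inv ≫ (d ⊗ₘ d) := by
      rintro _ rfl
      simp
    exact key _ this
  | absent s ih =>
    obtain ⟨Δ₁, Δ₂, e₁, e₂, s', w₁, w₂, h⟩ := ih (fun i => p (i + 1))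
      (fun i h => by simpa using hp (i + 1) h)
      (fun i B h hB => hp' (i + 1) B (by simpa using h) hB)
    exact ⟨none :: Δ₁, none :: Δ₂, congrArg _ e₁, congrArg _ e₂, .absent s', .absent w₁,
      .absent w₂, h⟩
  | left A s ih =>
    obtain ⟨Δ₁, Δ₂, e₁, e₂, s', w₁, w₂, h⟩ := ih (fun i => p (i + 1))
      (fun i h => by simpa using hp (i + 1) h)
      (fun i B h hB => hp' (i + 1) B (by simpa using h) hB)
    by_cases hA : A.IsInt
    · refine ⟨some A :: Δ₁, some A :: Δ₂, ?_, ?_, .both A hA s', .keep A w₁, .drop A hA w₂, ?_⟩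
      · rw [Ctx.restrict_some_pos (.inl hA), e₁]
      · rw [Ctx.restrict_some_pos (.inl hA), e₂]
      · exact split_both_discard_right h (𝓜.copy_discard_right _)
    · have h0 : p 0 := hp' 0 A rfl hA
      refine ⟨some A :: Δ₁, none :: Δ₂, ?_, ?_, .left A s', .keep A w₁, .absent w₂, ?_⟩
      · rw [Ctx.restrict_some_pos (.inr h0), e₁]
      · rw [Ctx.restrict_some_neg (by simp [hA, h0]), e₂]
      · have := whiskerLeft_split_left (A := 𝓜.ty Sg A) (a := 𝟙 _) (by simpa using h)
        rw [MonoidalCategory.whiskerLeft_id, Category.id_comp] at this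
        exact this
  | right A s ih =>
    obtain ⟨Δ₁, Δ₂, e₁, e₂, s', w₁, w₂, h⟩ := ih (fun i => p (i + 1))
      (fun i h => by simpa using hp (i + 1) h)
      (fun i B h hB => hp' (i + 1) B (by simpa using h) hB)
    by_cases hA : A.IsInt
    · refine ⟨some A :: Δ₁, some A :: Δ₂, ?_, ?_, .both A hA s', .drop A hA w₁, .keep A w₂, ?_⟩
      · rw [Ctx.restrict_some_pos (.inl hA), e₁]
      · rw [Ctx.restrict_some_pos (.inl hA), e₂]
      · exact split_both_discard_left h (𝓜.copy_discard_left _)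
    · have h0 : ¬ p 0 := fun h => by simpa using hp 0 h
      refine ⟨none :: Δ₁, some A :: Δ₂, ?_, ?_, .right A s', .absent w₁, .keep A w₂, ?_⟩
      · rw [Ctx.restrict_some_neg (by simp [hA, h0]), e₁]
      · rw [Ctx.restrict_some_pos (.inr h0), e₂]
      · have := whiskerLeft_split_right (A := 𝓜.ty Sg A) (a := 𝟙 _) (by simpa using h)
        rw [MonoidalCategory.whiskerLeft_id, Category.id_comp] at this
        exact this
  | both A hA s ih =>
    obtain ⟨Δ₁, Δ₂, e₁, e₂, s', w₁, w₂, h⟩ := ih (fun i => p (i + 1))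
      (fun i h => by simpa using hp (i + 1) h)
      (fun i B h hB => hp' (i + 1) B (by simpa using h) hB)
    refine ⟨some A :: Δ₁, some A :: Δ₂, ?_, ?_, .both A hA s', .keep A w₁, .keep A w₂, ?_⟩
    · rw [Ctx.restrict_some_pos (.inl hA), e₁]
    · rw [Ctx.restrict_some_pos (.inl hA), e₂]
    · have := tensor_split_both (a := 𝟙 _) (by simpa using h) (b := 𝟙 (𝓜.ty Sg A)) (b₁ := 𝟙 _)
        (b₂ := 𝟙 _) (c := 𝓜.copyTy Sg A hA) (c' := 𝓜.copyTy Sg A hA) (by simp)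
      simp only [id_tensorHom, MonoidalCategory.whiskerLeft_id, Category.id_comp] at this
      exact this

theorem Model.split_weaken {Γ Γ₁ Γ₂ Δ₁ Δ₂ : Ctx Sg.W} {Q Q₁ Q₂ : LabelCtx Sg.W}
    {s : CtxSplit Γ Γ₁ Γ₂} {s' : CtxSplit Γ Δ₁ Δ₂} {w₁ : Weakening Γ₁ Δ₁} {w₂ : Weakening Γ₂ Δ₂}
    (h : 𝓜.splitCtx Sg s = 𝓜.splitCtx Sg s' ≫ (𝓜.weaken Sg w₁ ⊗ₘ 𝓜.weaken Sg w₂))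
    (t : Q.Split Q₁ Q₂) :
    𝟙 _ ≫ Model.split s t = Model.split s' t ≫
      ((𝓜.weaken Sg w₁ ▷ 𝓜.labelCtx Sg Q₁) ⊗ₘ (𝓜.weaken Sg w₂ ▷ 𝓜.labelCtx Sg Q₂)) := by
  have := tensor_split_both (a := 𝟙 _) (s := (𝓜.splitLabels Sg t).hom)
    (s' := (𝓜.splitLabels Sg t).hom) (a₁ := 𝟙 _) (a₂ := 𝟙 _) (by simp) (b := 𝟙 _)
    (by simpa using h)
  simp only [tensorHom_id, id_whiskerRight] at this
  exact this

/-- Two splittings of the same context and label context for which the left parts type the same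
term factor through a common one. -/
theorem Model.exists_common_split {Γ Γ₁ Γ₂ Γ₁' Γ₂' : Ctx Sg.W}
    {Q Q₁ Q₂ Q₁' Q₂' : LabelCtx Sg.W} {m : Term Sg} {A A' : Ty Sg.W}
    (s : CtxSplit Γ Γ₁ Γ₂) (t : Q.Split Q₁ Q₂) (s' : CtxSplit Γ Γ₁' Γ₂') (t' : Q.Split Q₁' Q₂')
    (d : Typing Γ₁ Q₁ m A) (d' : Typing Γ₁' Q₁' m A') :
    Q₁ = Q₁' ∧ Q₂ = Q₂' ∧ ∃ (Δ₁ Δ₂ : Ctx Sg.W) (ŝ : CtxSplit Γ Δ₁ Δ₂) (w₁ : Weakening Γ₁ Δ₁)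
      (w₂ : Weakening Γ₂ Δ₂) (w₁' : Weakening Γ₁' Δ₁) (w₂' : Weakening Γ₂' Δ₂),
      𝓜.splitCtx Sg s = 𝓜.splitCtx Sg ŝ ≫ (𝓜.weaken Sg w₁ ⊗ₘ 𝓜.weaken Sg w₂) ∧
      𝓜.splitCtx Sg s' = 𝓜.splitCtx Sg ŝ ≫ (𝓜.weaken Sg w₁' ⊗ₘ 𝓜.weaken Sg w₂') := by
  obtain rfl := LabelCtx.eq_of_labels_eq (Shuffle.sublist_left t) (Shuffle.sublist_left t')
    (d.labels_eq.trans d'.labels_eq.symm)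
  obtain rfl := LabelCtx.Split.right_eq t t'
  -- Both splittings send the linear free variables of `m` to the left part, and no other linear
  -- variables.
  obtain ⟨Δ₁, Δ₂, e₁, e₂, ŝ, w₁, w₂, h⟩ := 𝓜.exists_restrict s m.IsFree
    (fun _ h => d.getElem?_of_isFree h) (fun _ _ => d.isFree_of_not_isInt)
  obtain ⟨Δ₁', Δ₂', e₁', e₂', ŝ', w₁', w₂', h'⟩ := 𝓜.exists_restrict s' m.IsFree
    (fun _ h => d'.getElem?_of_isFree h) (fun _ _ => d'.isFree_of_not_isInt)
  obtain rfl := e₁.trans e₁'.symm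
  obtain rfl := e₂.trans e₂'.symm
  obtain rfl := ŝ.subsingleton ŝ'
  exact ⟨rfl, rfl, _, _, ŝ, w₁, w₂, w₁', w₂', h, h'⟩

variable {𝓜}

/-- All typing derivations of the term `m` over the same contexts have the same type and the same
interpretation. -/
def Coherent (K : 𝓜.Constants Sg) (m : Term Sg) : Prop :=
  ∀ {Γ : Ctx Sg.W} {Q : LabelCtx Sg.W} {A A' : Ty Sg.W} (d : Typing Γ Q m A)
    (d' : Typing Γ Q m A'), A = A' ∧ HEq (Model.den K d) (Model.den K d')

/-- Coherence for derivations over different contexts that have a common weakening. -/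
theorem Coherent.weaken {K : 𝓜.Constants Sg} {m : Term Sg} (h : Coherent K m)
    {Γ Γ' Δ : Ctx Sg.W} {Q : LabelCtx Sg.W} {A A' : Ty Sg.W} (d : Typing Γ Q m A)
    (d' : Typing Γ' Q m A') (w : Weakening Γ Δ) (w' : Weakening Γ' Δ) :
    A = A' ∧ HEq ((𝓜.weaken Sg w ▷ _) ≫ Model.den K d) ((𝓜.weaken Sg w' ▷ _) ≫ Model.den K d') := by
  obtain ⟨e, he⟩ := d.exists_weaken K w
  obtain ⟨e', he'⟩ := d'.exists_weaken K w'
  rw [← he, ← he']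
  exact h e e'

/-- By induction on the term: two derivations end with the same rule, and the ways in which they
split the contexts factor through a common one, so that the induction hypothesis applies to
weakenings of their premises. -/
theorem coherent (K : 𝓜.Constants Sg) (m : Term Sg) : Coherent K m := by
  have key : ∀ {A X Y Q Z : C} (w : X ⟶ Y) (r : (A ⊗ Y) ⊗ Q ⟶ Z),
      (A ◁ (w ▷ Q)) ≫ (α_ A Y Q).inv ≫ r = (α_ A X Q).inv ≫ ((A ◁ w) ▷ Q) ≫ r := by
    intros
    simp
  induction m with
  | var i =>
    intro Γ Q A A' d d'
    cases d with
    | var x =>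
    cases d' with
    | var x' =>
    obtain rfl := x.type_unique x'
    obtain rfl := x.subsingleton x'
    exact ⟨rfl, HEq.rfl⟩
  | const c =>
    intro Γ Q A A' d d'
    cases d
    cases d'
    exact ⟨rfl, HEq.rfl⟩
  | star =>
    intro Γ Q A A' d d'
    cases d
    cases d'
    exact ⟨rfl, HEq.rfl⟩
  | label ℓ =>
    intro Γ Q A A' d d'
    cases d
    cases d'
    exact ⟨rfl, HEq.rfl⟩
  | diag l S l' =>
    intro Γ Q A A' d d'
    cases d with
    | diag h hl hl' =>
    cases d' with
    | diag h' hk hk' =>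
    obtain rfl := hl.type_unique hk
    obtain rfl := hl'.type_unique hk'
    obtain rfl := hl.subsingleton hk
    obtain rfl := hl'.subsingleton hk'
    exact ⟨rfl, HEq.rfl⟩
  | initial B m ih =>
    intro Γ Q A A' d d'
    cases d with
    | initial _ d =>
    cases d' with
    | initial _ d' =>
    obtain ⟨-, h⟩ := ih d d'
    refine ⟨rfl, heq_of_eq ?_⟩
    simp only [Model.den, eq_of_heq h]
  | left B B' m ih =>
    intro Γ Q A A' d d'
    cases d with
    | left _ _ d =>
    cases d' with
    | left _ _ d' =>
    obtain ⟨-, h⟩ := ih d d'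
    refine ⟨rfl, heq_of_eq ?_⟩
    simp only [Model.den, eq_of_heq h]
  | right B B' m ih =>
    intro Γ Q A A' d d'
    cases d with
    | right _ _ d =>
    cases d' with
    | right _ _ d' =>
    obtain ⟨-, h⟩ := ih d d'
    refine ⟨rfl, heq_of_eq ?_⟩
    simp only [Model.den, eq_of_heq h]
  | lam B m ih =>
    intro Γ Q A A' d d'
    cases d with
    | lam _ d =>
    cases d' with
    | lam _ d' =>
    obtain ⟨rfl, h⟩ := ih d d'
    refine ⟨rfl, heq_of_eq ?_⟩
    simp only [Model.den]
    exact congrArg (fun z => MonoidalClosed.curry (_ ≫ z)) (eq_of_heq h)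
  | lift m ih =>
    intro Γ Q A A' d d'
    cases d with
    | lift _ d =>
    cases d' with
    | lift _ d' =>
    obtain ⟨rfl, h⟩ := ih d d'
    refine ⟨rfl, heq_of_eq ?_⟩
    simp only [Model.den, eq_of_heq h]
  | force m ih =>
    intro Γ Q A A' d d'
    cases d with
    | force d =>
    cases d' with
    | force d' =>
    obtain ⟨e, h⟩ := ih d d'
    cases e
    refine ⟨rfl, heq_of_eq ?_⟩
    simp only [Model.den, eq_of_heq h]
  | box T m ih =>
    intro Γ Q A A' d d'
    cases d with
    | box d =>
    cases d' with
    | box d' =>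
    obtain ⟨e, h⟩ := ih d d'
    obtain rfl := MTy.toTy_injective (by simpa using e)
    refine ⟨rfl, heq_of_eq ?_⟩
    simp only [Model.den, eq_of_heq h]
  | let_ m n ih ih' =>
    intro Γ Q A A' d d'
    cases d with
    | let_ s t d₁ d₂ =>
    cases d' with
    | let_ s' t' d₁' d₂' =>
    obtain ⟨rfl, rfl, Δ₁, Δ₂, ŝ, w₁, w₂, w₁', w₂', h, h'⟩ :=
      𝓜.exists_common_split s t s' t' d₁ d₁'
    obtain rfl := LabelCtx.Split.subsingleton t t'
    obtain ⟨rfl, h₁⟩ := ih.weaken d₁ d₁' w₁ w₁'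
    obtain ⟨rfl, h₂⟩ := ih'.weaken d₂ d₂' (.keep _ w₂) (.keep _ w₂')
    refine ⟨rfl, heq_of_eq ?_⟩
    simp only [Model.den]
    refine (Category.id_comp _).symm.trans ((whisker_natural (𝓜.split_weaken h t) _ _).symm.trans
      (Eq.trans ?_ ((whisker_natural (𝓜.split_weaken h' t) _ _).trans (Category.id_comp _))))
    refine congrArg₂ (fun z z' => _ ≫ (z ▷ _) ≫ z') (eq_of_heq h₁) ?_
    exact (key _ _).trans ((congrArg (_ ≫ ·) (eq_of_heq h₂)).trans (key _ _).symm)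
  | case m n p ih ih' ih'' =>
    intro Γ Q A A' d d'
    cases d with
    | case s t d₁ d₂ d₃ =>
    cases d' with
    | case s' t' d₁' d₂' d₃' =>
    obtain ⟨rfl, rfl, Δ₁, Δ₂, ŝ, w₁, w₂, w₁', w₂', h, h'⟩ :=
      𝓜.exists_common_split s t s' t' d₁ d₁'
    obtain rfl := LabelCtx.Split.subsingleton t t'
    obtain ⟨e, h₁⟩ := ih.weaken d₁ d₁' w₁ w₁'
    cases e
    obtain ⟨rfl, h₂⟩ := ih'.weaken d₂ d₂' (.keep _ w₂) (.keep _ w₂')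
    obtain ⟨-, h₃⟩ := ih''.weaken d₃ d₃' (.keep _ w₂) (.keep _ w₂')
    refine ⟨rfl, heq_of_eq ?_⟩
    simp only [Model.den]
    refine (Category.id_comp _).symm.trans ((whisker_natural (𝓜.split_weaken h t) _ _).symm.trans
      (Eq.trans ?_ ((whisker_natural (𝓜.split_weaken h' t) _ _).trans (Category.id_comp _))))
    refine congrArg₂ (fun z z' => _ ≫ (z ▷ _) ≫ z') (eq_of_heq h₁) ?_
    refine (caseMap_natural _ _ _).symm.trans (Eq.trans ?_ (caseMap_natural _ _ _))
    exact congrArg₂ caseMap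
      ((key _ _).trans ((congrArg (_ ≫ ·) (eq_of_heq h₂)).trans (key _ _).symm))
      ((key _ _).trans ((congrArg (_ ≫ ·) (eq_of_heq h₃)).trans (key _ _).symm))
  | seq m n ih ih' =>
    intro Γ Q A A' d d'
    cases d with
    | seq s t d₁ d₂ =>
    cases d' with
    | seq s' t' d₁' d₂' =>
    obtain ⟨rfl, rfl, Δ₁, Δ₂, ŝ, w₁, w₂, w₁', w₂', h, h'⟩ :=
      𝓜.exists_common_split s t s' t' d₁ d₁'
    obtain rfl := LabelCtx.Split.subsingleton t t'
    obtain ⟨-, h₁⟩ := ih.weaken d₁ d₁' w₁ w₁'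
    obtain ⟨rfl, h₂⟩ := ih'.weaken d₂ d₂' w₂ w₂'
    refine ⟨rfl, heq_of_eq ?_⟩
    simp only [Model.den]
    refine (Category.id_comp _).symm.trans ((whisker_natural (𝓜.split_weaken h t) _ _).symm.trans
      (Eq.trans ?_ ((whisker_natural (𝓜.split_weaken h' t) _ _).trans (Category.id_comp _))))
    refine congrArg₂ (fun z z' => _ ≫ (z ▷ _) ≫ z') (eq_of_heq h₁) ?_
    exact (leftUnitor_naturality_assoc _ _).trans
      ((congrArg (_ ≫ ·) (eq_of_heq h₂)).trans (leftUnitor_naturality_assoc _ _).symm)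
  | pair m n ih ih' =>
    intro Γ Q A A' d d'
    cases d with
    | pair s t d₁ d₂ =>
    cases d' with
    | pair s' t' d₁' d₂' =>
    obtain ⟨rfl, rfl, Δ₁, Δ₂, ŝ, w₁, w₂, w₁', w₂', h, h'⟩ :=
      𝓜.exists_common_split s t s' t' d₁ d₁'
    obtain rfl := LabelCtx.Split.subsingleton t t'
    obtain ⟨rfl, h₁⟩ := ih.weaken d₁ d₁' w₁ w₁'
    obtain ⟨rfl, h₂⟩ := ih'.weaken d₂ d₂' w₂ w₂'
    refine ⟨rfl, heq_of_eq ?_⟩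
    simp only [Model.den]
    refine (Category.id_comp _).symm.trans ((tensor_natural (𝓜.split_weaken h t) _ _).symm.trans
      (Eq.trans ?_ ((tensor_natural (𝓜.split_weaken h' t) _ _).trans (Category.id_comp _))))
    exact congrArg₂ (fun z z' => _ ≫ (z ⊗ₘ z')) (eq_of_heq h₁) (eq_of_heq h₂)
  | letPair m n ih ih' =>
    intro Γ Q A A' d d'
    cases d with
    | letPair s t d₁ d₂ =>
    cases d' with
    | letPair s' t' d₁' d₂' =>
    obtain ⟨rfl, rfl, Δ₁, Δ₂, ŝ, w₁, w₂, w₁', w₂', h, h'⟩ :=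
      𝓜.exists_common_split s t s' t' d₁ d₁'
    obtain rfl := LabelCtx.Split.subsingleton t t'
    obtain ⟨e, h₁⟩ := ih.weaken d₁ d₁' w₁ w₁'
    cases e
    obtain ⟨rfl, h₂⟩ := ih'.weaken d₂ d₂' (.keep _ (.keep _ w₂)) (.keep _ (.keep _ w₂'))
    refine ⟨rfl, heq_of_eq ?_⟩
    simp only [Model.den]
    refine (Category.id_comp _).symm.trans ((whisker_natural (𝓜.split_weaken h t) _ _).symm.trans
      (Eq.trans ?_ ((whisker_natural (𝓜.split_weaken h' t) _ _).trans (Category.id_comp _))))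
    refine congrArg₂ (fun z z' => _ ≫ (z ▷ _) ≫ z') (eq_of_heq h₁) ?_
    have key' : ∀ {A B X Y Q Z : C} (w : X ⟶ Y) (r : (B ⊗ A ⊗ Y) ⊗ Q ⟶ Z),
        ((A ⊗ B) ◁ (w ▷ Q)) ≫ ((β_ A B).hom ▷ _) ≫ (α_ _ _ _).hom ≫ (_ ◁ (α_ _ _ _).inv) ≫
          (α_ _ _ _).inv ≫ r =
        ((β_ A B).hom ▷ _) ≫ (α_ _ _ _).hom ≫ (_ ◁ (α_ _ _ _).inv) ≫
          (α_ _ _ _).inv ≫ ((B ◁ A ◁ w) ▷ Q) ≫ r := by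
      intro A B X Y Q Z w r
      rw [whisker_exchange_assoc]
      simp
    exact (key' _ _).trans ((congrArg (fun z => _ ≫ _ ≫ _ ≫ _ ≫ z) (eq_of_heq h₂)).trans
      (key' _ _).symm)
  | app m n ih ih' =>
    intro Γ Q A A' d d'
    cases d with
    | app s t d₁ d₂ =>
    cases d' with
    | app s' t' d₁' d₂' =>
    obtain ⟨rfl, rfl, Δ₁, Δ₂, ŝ, w₁, w₂, w₁', w₂', h, h'⟩ :=
      𝓜.exists_common_split s t s' t' d₁ d₁'
    obtain rfl := LabelCtx.Split.subsingleton t t'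
    obtain ⟨e, h₁⟩ := ih.weaken d₁ d₁' w₁ w₁'
    cases e
    obtain ⟨-, h₂⟩ := ih'.weaken d₂ d₂' w₂ w₂'
    refine ⟨rfl, heq_of_eq ?_⟩
    simp only [Model.den]
    refine (Category.id_comp _).symm.trans ((tensor_natural_assoc (𝓜.split_weaken h t) _ _ _).symm.trans
      (Eq.trans ?_ ((tensor_natural_assoc (𝓜.split_weaken h' t) _ _ _).trans (Category.id_comp _))))
    exact congrArg₂ (fun z z' => _ ≫ (z ⊗ₘ z') ≫ _) (eq_of_heq h₁) (eq_of_heq h₂)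
  | apply m n ih ih' =>
    intro Γ Q A A' d d'
    cases d with
    | apply s t d₁ d₂ =>
    cases d' with
    | apply s' t' d₁' d₂' =>
    obtain ⟨rfl, rfl, Δ₁, Δ₂, ŝ, w₁, w₂, w₁', w₂', h, h'⟩ :=
      𝓜.exists_common_split s t s' t' d₁ d₁'
    obtain rfl := LabelCtx.Split.subsingleton t t'
    obtain ⟨e, h₁⟩ := ih.weaken d₁ d₁' w₁ w₁'
    cases e
    obtain ⟨-, h₂⟩ := ih'.weaken d₂ d₂' w₂ w₂'
    refine ⟨rfl, heq_of_eq ?_⟩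
    simp only [Model.den]
    refine (Category.id_comp _).symm.trans ((tensor_natural_assoc (𝓜.split_weaken h t) _ _ _).symm.trans
      (Eq.trans ?_ ((tensor_natural_assoc (𝓜.split_weaken h' t) _ _ _).trans (Category.id_comp _))))
    refine congrArg₂ (fun z z' => _ ≫ (z ⊗ₘ z') ≫ _) ?_ (eq_of_heq h₂)
    exact (Category.assoc _ _ _).symm.trans
      ((congrArg (· ≫ _) (eq_of_heq h₁)).trans (Category.assoc _ _ _))

/-- The interpretation of a typing judgement does not depend on the choice of its derivation. -/
theorem Model.den_eq (K : 𝓜.Constants Sg) {Γ : Ctx Sg.W} {Q : LabelCtx Sg.W} {m : Term Sg}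
    {A : Ty Sg.W} (d d' : Typing Γ Q m A) : Model.den K d = Model.den K d' :=
  eq_of_heq (coherent K m d d').2

end Coherence

/-! ### Splitting an environment -/

section EnvironmentLemmas

variable {C : Type u} [Category.{v} C] [MonoidalCategory C] [SymmetricCategory C]

theorem swap_tensorμ_assoc (D₁ D₂ Q P₁ P₂ : C) :
    ((D₁ ⊗ D₂) ◁ (α_ Q P₁ P₂).inv) ≫ tensorμ D₁ D₂ (Q ⊗ P₁) P₂ ≫
      ((swapIso D₁ Q P₁).hom ▷ (D₂ ⊗ P₂)) =
    (swapIso (D₁ ⊗ D₂) Q (P₁ ⊗ P₂)).hom ≫ (Q ◁ tensorμ D₁ D₂ P₁ P₂) ≫ (α_ _ _ _).inv := by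
  have := SymHom.coherence (atoms₅ D₁ D₂ Q P₁ P₂)
    (T := .tensor (.tensor (.wire 0) (.wire 1)) (.tensor (.wire 2) (.tensor (.wire 3) (.wire 4))))
    (.comp (.whiskerLeft _ (.assocInv _ _ _))
      (.comp (SymHom.interchange _ _ _ _) (.whiskerRight (SymHom.swap _ _ _) _)))
    (.comp (SymHom.swap _ _ _) (.comp (.whiskerLeft _ (SymHom.interchange _ _ _ _))
      (.assocInv _ _ _))) (by simp [MTy.atoms])
  simp only [swapIso, tensorμ, Iso.trans_hom, Iso.symm_hom, whiskerRightIso_hom]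
  exact this

theorem swap_tensorμ_swap (D₁ D₂ Q P₁ P₂ : C) :
    ((D₁ ⊗ D₂) ◁ (swapIso Q P₁ P₂).hom) ≫ tensorμ D₁ D₂ P₁ (Q ⊗ P₂) ≫
      ((D₁ ⊗ P₁) ◁ (swapIso D₂ Q P₂).hom) =
    (swapIso (D₁ ⊗ D₂) Q (P₁ ⊗ P₂)).hom ≫ (Q ◁ tensorμ D₁ D₂ P₁ P₂) ≫
      (swapIso _ _ _).hom := by
  have := SymHom.coherence (atoms₅ D₁ D₂ Q P₁ P₂)
    (T := .tensor (.tensor (.wire 0) (.wire 1)) (.tensor (.wire 2) (.tensor (.wire 3) (.wire 4))))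
    (.comp (.whiskerLeft _ (SymHom.swap _ _ _))
      (.comp (SymHom.interchange _ _ _ _) (.whiskerLeft _ (SymHom.swap _ _ _))))
    (.comp (SymHom.swap _ _ _) (.comp (.whiskerLeft _ (SymHom.interchange _ _ _ _))
      (SymHom.swap _ _ _))) (by simp [MTy.atoms])
  simp only [swapIso, tensorμ, Iso.trans_hom, Iso.symm_hom, whiskerRightIso_hom]
  exact this

theorem tensorμ_swap (A D₁ D₂ P₁ P₂ : C) :
    (α_ A (D₁ ⊗ D₂) (P₁ ⊗ P₂)).hom ≫ (A ◁ tensorμ D₁ D₂ P₁ P₂) ≫ (swapIso _ _ _).hom =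
      ((swapIso A D₁ D₂).hom ▷ _) ≫ tensorμ D₁ (A ⊗ D₂) P₁ P₂ ≫ (_ ◁ (α_ _ _ _).hom) := by
  have := SymHom.coherence (atoms₅ A D₁ D₂ P₁ P₂)
    (T := .tensor (.tensor (.wire 0) (.tensor (.wire 1) (.wire 2))) (.tensor (.wire 3) (.wire 4)))
    (.comp (.assoc _ _ _) (.comp (.whiskerLeft _ (SymHom.interchange _ _ _ _))
      (SymHom.swap _ _ _)))
    (.comp (.whiskerRight (SymHom.swap _ _ _) _) (.comp (SymHom.interchange _ _ _ _)
      (.whiskerLeft _ (.assoc _ _ _)))) (by simp [MTy.atoms])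
  simp only [swapIso, tensorμ, Iso.trans_hom, Iso.symm_hom, whiskerRightIso_hom]
  exact this

theorem tensorμ_assoc (A D₁ D₂ P₁ P₂ : C) :
    (α_ A (D₁ ⊗ D₂) (P₁ ⊗ P₂)).hom ≫ (A ◁ tensorμ D₁ D₂ P₁ P₂) ≫ (α_ _ _ _).inv =
      ((α_ A D₁ D₂).inv ▷ _) ≫ tensorμ (A ⊗ D₁) D₂ P₁ P₂ ≫ ((α_ _ _ _).hom ▷ _) := by
  simp only [tensorμ]
  monoidal

theorem tensorμ_unit_left (X Y : C) :
    (λ_ (X ⊗ Y)).inv ≫ ((λ_ (𝟙_ C)).inv ▷ (X ⊗ Y)) ≫ tensorμ (𝟙_ C) (𝟙_ C) X Y =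
      (λ_ X).inv ⊗ₘ (λ_ Y).inv := by
  simp only [tensorμ, braiding_tensorUnit_left, MonoidalCategory.tensorHom_def]
  monoidal

section Value

variable {A D D₁ D₂ G G₁ G₂ P P₁ P₂ Q Q₁ X : C} {t : Q ⟶ Q₁ ⊗ P} {t' : P ⟶ P₁ ⊗ P₂}
  {φ : D ⊗ P ⟶ G} {s : G ⟶ G₁ ⊗ G₂} {s' : D ⟶ D₁ ⊗ D₂} {φ₁ : D₁ ⊗ P₁ ⟶ G₁}
  {φ₂ : D₂ ⊗ P₂ ⟶ G₂}

/-- An environment `c ⊗ φ`, whose first variable is replaced by a value with denotation `c`, over a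
splitting that sends this variable to the left part. -/
theorem value_split_left (c : Q₁ ⟶ A)
    (h : φ ≫ s = ((s' ⊗ₘ t') ≫ tensorμ _ _ _ _) ≫ (φ₁ ⊗ₘ φ₂)) {r : Q ⟶ X ⊗ P₂}
    {r' : X ⟶ Q₁ ⊗ P₁} (hr : t ≫ Q₁ ◁ t' ≫ (α_ _ _ _).inv = r ≫ r' ▷ _) :
    ((D ◁ t) ≫ (swapIso _ _ _).hom ≫ (c ⊗ₘ φ)) ≫ (A ◁ s) ≫ (α_ _ _ _).inv =
      ((s' ⊗ₘ r) ≫ tensorμ _ _ _ _) ≫ (((D₁ ◁ r') ≫ (swapIso _ _ _).hom ≫ (c ⊗ₘ φ₁)) ⊗ₘ φ₂) := by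
  have e₁ : (c ⊗ₘ φ) ≫ (A ◁ s) ≫ (α_ _ _ _).inv =
      (𝟙 _ ⊗ₘ (s' ⊗ₘ t')) ≫ (_ ◁ tensorμ _ _ _ _) ≫ (α_ _ _ _).inv ≫ ((c ⊗ₘ φ₁) ⊗ₘ φ₂) := by
    rw [← associator_inv_naturality, ← id_tensorHom, ← id_tensorHom, tensorHom_comp_tensorHom_assoc,
      tensorHom_comp_tensorHom_assoc, tensorHom_comp_tensorHom_assoc, h]
    simp
  have e₂ := swapIso_naturality s' (𝟙 Q₁) t'
  have e₃ : (((D₁ ◁ r') ≫ (swapIso _ _ _).hom ≫ (c ⊗ₘ φ₁)) ⊗ₘ φ₂) =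
      ((D₁ ◁ r') ▷ _) ≫ ((swapIso _ _ _).hom ▷ _) ≫ ((c ⊗ₘ φ₁) ⊗ₘ φ₂) := by
    simp [MonoidalCategory.tensorHom_def]
  have e₄ : tensorμ D₁ D₂ X P₂ ≫ ((D₁ ◁ r') ▷ (D₂ ⊗ P₂)) =
      (_ ◁ (r' ▷ _)) ≫ tensorμ D₁ D₂ (Q₁ ⊗ P₁) P₂ := by
    have := tensorμ_natural (𝟙 D₁) (𝟙 D₂) r' (𝟙 P₂)
    simpa using this.symm
  have e₅ : (D ◁ t) ≫ (s' ⊗ₘ (𝟙 Q₁ ⊗ₘ t')) ≫ ((D₁ ⊗ D₂) ◁ (α_ Q₁ P₁ P₂).inv) =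
      (s' ⊗ₘ r) ≫ ((D₁ ⊗ D₂) ◁ (r' ▷ _)) := by
    have := congrArg (fun z => (s' ▷ Q) ≫ ((D₁ ⊗ D₂) ◁ z)) hr
    simp only [whiskerLeft_comp] at this
    simp only [id_tensorHom, MonoidalCategory.tensorHom_def s', Category.assoc,
      whisker_exchange_assoc, this]
  rw [Category.assoc, Category.assoc, e₁, ← reassoc_of% e₂, e₃, Category.assoc, reassoc_of% e₄,
    ← reassoc_of% swap_tensorμ_assoc]
  simp only [reassoc_of% e₅]

/-- An environment `c ⊗ φ`, whose first variable is replaced by a value with denotation `c`, over a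
splitting that sends this variable to the right part. -/
theorem value_split_right (c : Q₁ ⟶ A)
    (h : φ ≫ s = ((s' ⊗ₘ t') ≫ tensorμ _ _ _ _) ≫ (φ₁ ⊗ₘ φ₂)) {r : Q ⟶ P₁ ⊗ X}
    {r' : X ⟶ Q₁ ⊗ P₂} (hr : t ≫ Q₁ ◁ t' ≫ (swapIso _ _ _).hom = r ≫ _ ◁ r') :
    ((D ◁ t) ≫ (swapIso _ _ _).hom ≫ (c ⊗ₘ φ)) ≫ (A ◁ s) ≫ (swapIso _ _ _).hom =
      ((s' ⊗ₘ r) ≫ tensorμ _ _ _ _) ≫ (φ₁ ⊗ₘ ((D₂ ◁ r') ≫ (swapIso _ _ _).hom ≫ (c ⊗ₘ φ₂))) := by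
  have e₁ : (c ⊗ₘ φ) ≫ (A ◁ s) ≫ (swapIso _ _ _).hom =
      (𝟙 _ ⊗ₘ (s' ⊗ₘ t')) ≫ (_ ◁ tensorμ _ _ _ _) ≫ (swapIso _ _ _).hom ≫
        (φ₁ ⊗ₘ (c ⊗ₘ φ₂)) := by
    rw [← swapIso_naturality, ← id_tensorHom, ← id_tensorHom, tensorHom_comp_tensorHom_assoc,
      tensorHom_comp_tensorHom_assoc, tensorHom_comp_tensorHom_assoc, h]
    simp
  have e₂ := swapIso_naturality s' (𝟙 Q₁) t'
  have e₃ : (φ₁ ⊗ₘ ((D₂ ◁ r') ≫ (swapIso _ _ _).hom ≫ (c ⊗ₘ φ₂))) =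
      (_ ◁ (D₂ ◁ r')) ≫ (_ ◁ (swapIso _ _ _).hom) ≫ (φ₁ ⊗ₘ (c ⊗ₘ φ₂)) := by
    simp [MonoidalCategory.tensorHom_def']
  have e₄ : tensorμ D₁ D₂ P₁ X ≫ ((D₁ ⊗ P₁) ◁ (D₂ ◁ r')) =
      (_ ◁ (_ ◁ r')) ≫ tensorμ D₁ D₂ P₁ (Q₁ ⊗ P₂) := by
    have := tensorμ_natural (𝟙 D₁) (𝟙 D₂) (𝟙 P₁) r'
    simpa using this.symm
  have e₅ : (D ◁ t) ≫ (s' ⊗ₘ (𝟙 Q₁ ⊗ₘ t')) ≫ ((D₁ ⊗ D₂) ◁ (swapIso Q₁ P₁ P₂).hom) =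
      (s' ⊗ₘ r) ≫ ((D₁ ⊗ D₂) ◁ (_ ◁ r')) := by
    have := congrArg (fun z => (s' ▷ Q) ≫ ((D₁ ⊗ D₂) ◁ z)) hr
    simp only [whiskerLeft_comp] at this
    simp only [id_tensorHom, MonoidalCategory.tensorHom_def s', Category.assoc,
      whisker_exchange_assoc, this]
  rw [Category.assoc, Category.assoc, e₁, ← reassoc_of% e₂, e₃, Category.assoc, reassoc_of% e₄,
    ← reassoc_of% swap_tensorμ_swap]
  simp only [reassoc_of% e₅]

/-- If the value that replaces the first variable uses no labels, no symmetry is needed. -/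
theorem swap_unit (c : 𝟙_ C ⟶ A) (φ : D ⊗ P ⟶ G) :
    (D ◁ (λ_ P).inv) ≫ (swapIso _ _ _).hom ≫ (c ⊗ₘ φ) = φ ≫ (λ_ _).inv ≫ (c ▷ G) := by
  have : (D ◁ (λ_ P).inv) ≫ (swapIso _ _ _).hom = (λ_ _).inv := by
    simp only [swapIso, Iso.trans_hom, Iso.symm_hom, whiskerRightIso_hom, braiding_tensorUnit_right]
    monoidal
  rw [reassoc_of% this, MonoidalCategory.tensorHom_def', leftUnitor_inv_naturality_assoc]

/-- An environment `c ⊗ φ` over a splitting that duplicates its first variable. The value that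
replaces this variable uses no labels, and its denotation `c` commutes with copying. -/
theorem value_split_both {c : 𝟙_ C ⟶ A} {cp : A ⟶ A ⊗ A} (hc : c ≫ cp = (λ_ _).inv ≫ (c ⊗ₘ c))
    (h : φ ≫ s = ((s' ⊗ₘ t') ≫ tensorμ _ _ _ _) ≫ (φ₁ ⊗ₘ φ₂)) :
    ((D ◁ (λ_ P).inv) ≫ (swapIso _ _ _).hom ≫ (c ⊗ₘ φ)) ≫ (cp ⊗ₘ s) ≫ tensorμ _ _ _ _ =
      ((s' ⊗ₘ t') ≫ tensorμ _ _ _ _) ≫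
        (((D₁ ◁ (λ_ P₁).inv) ≫ (swapIso _ _ _).hom ≫ (c ⊗ₘ φ₁)) ⊗ₘ
          ((D₂ ◁ (λ_ P₂).inv) ≫ (swapIso _ _ _).hom ≫ (c ⊗ₘ φ₂))) := by
  have e := tensor_split_both (a := 𝟙 _) (s := s) (s' := s) (a₁ := 𝟙 _) (a₂ := 𝟙 _) (by simp) hc
  rw [tensorHom_id, tensorHom_id, tensorHom_id] at e
  rw [swap_unit, swap_unit, swap_unit, ← tensorHom_comp_tensorHom, ← tensorHom_comp_tensorHom,
    ← tensorμ_unit_left]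
  simp only [Category.assoc] at e h ⊢
  rw [← reassoc_of% h, e, MonoidalCategory.tensorHom_def', leftUnitor_inv_naturality_assoc]
  simp

end Value

section Keep

variable {A D D₁ D₂ G G₁ G₂ P P₁ P₂ : C} {t' : P ⟶ P₁ ⊗ P₂}
  {φ : D ⊗ P ⟶ G} {s : G ⟶ G₁ ⊗ G₂} {s' : D ⟶ D₁ ⊗ D₂} {φ₁ : D₁ ⊗ P₁ ⟶ G₁}
  {φ₂ : D₂ ⊗ P₂ ⟶ G₂}

/-- An environment that keeps its first variable, over a splitting that sends this variable to the
left part. -/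
theorem keep_split_left (h : φ ≫ s = ((s' ⊗ₘ t') ≫ tensorμ _ _ _ _) ≫ (φ₁ ⊗ₘ φ₂)) :
    ((α_ A D P).hom ≫ A ◁ φ) ≫ (A ◁ s) ≫ (α_ _ _ _).inv =
      ((((A ◁ s') ≫ (α_ _ _ _).inv) ⊗ₘ t') ≫ tensorμ _ _ _ _) ≫
        (((α_ A D₁ P₁).hom ≫ A ◁ φ₁) ⊗ₘ φ₂) := by
  have e₁ : (A ◁ (φ₁ ⊗ₘ φ₂)) ≫ (α_ _ _ _).inv = (α_ _ _ _).inv ≫ ((A ◁ φ₁) ⊗ₘ φ₂) := by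
    simp [MonoidalCategory.tensorHom_def]
  have e₂ : (α_ A D P).hom ≫ (A ◁ (s' ⊗ₘ t')) = ((A ◁ s') ⊗ₘ t') ≫ (α_ _ _ _).hom := by
    simp [MonoidalCategory.tensorHom_def]
  have e₃ : ((A ◁ s') ≫ (α_ A D₁ D₂).inv) ⊗ₘ t' = ((A ◁ s') ⊗ₘ t') ≫ ((α_ _ _ _).inv ▷ _) := by
    simp [MonoidalCategory.tensorHom_def']
  rw [Category.assoc, ← whiskerLeft_comp_assoc, h, comp_tensorHom (α_ A D₁ P₁).hom, e₃]
  simp only [whiskerLeft_comp, Category.assoc, e₁, reassoc_of% e₂, ← reassoc_of% tensorμ_assoc]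

/-- An environment that keeps its first variable, over a splitting that sends this variable to the
right part. -/
theorem keep_split_right (h : φ ≫ s = ((s' ⊗ₘ t') ≫ tensorμ _ _ _ _) ≫ (φ₁ ⊗ₘ φ₂)) :
    ((α_ A D P).hom ≫ A ◁ φ) ≫ (A ◁ s) ≫ (swapIso _ _ _).hom =
      ((((A ◁ s') ≫ (swapIso _ _ _).hom) ⊗ₘ t') ≫ tensorμ _ _ _ _) ≫
        (φ₁ ⊗ₘ ((α_ A D₂ P₂).hom ≫ A ◁ φ₂)) := by
  have e₁ : (A ◁ (φ₁ ⊗ₘ φ₂)) ≫ (swapIso _ _ _).hom = (swapIso _ _ _).hom ≫ (φ₁ ⊗ₘ (A ◁ φ₂)) := by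
    have := swapIso_naturality (𝟙 A) φ₁ φ₂
    simpa only [id_tensorHom] using this
  have e₂ : (α_ A D P).hom ≫ (A ◁ (s' ⊗ₘ t')) = ((A ◁ s') ⊗ₘ t') ≫ (α_ _ _ _).hom := by
    simp [MonoidalCategory.tensorHom_def]
  have e₃ : ((A ◁ s') ≫ (swapIso A D₁ D₂).hom) ⊗ₘ t' =
      ((A ◁ s') ⊗ₘ t') ≫ ((swapIso _ _ _).hom ▷ _) := by
    simp [MonoidalCategory.tensorHom_def']
  rw [Category.assoc, ← whiskerLeft_comp_assoc, h, tensorHom_comp' _ (α_ A D₂ P₂).hom, e₃]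
  simp only [whiskerLeft_comp, Category.assoc, e₁, reassoc_of% e₂, ← reassoc_of% tensorμ_swap]

/-- An environment that keeps its first variable, over a splitting that duplicates this variable. -/
theorem keep_split_both (c : A ⟶ A ⊗ A)
    (h : φ ≫ s = ((s' ⊗ₘ t') ≫ tensorμ _ _ _ _) ≫ (φ₁ ⊗ₘ φ₂)) :
    ((α_ A D P).hom ≫ A ◁ φ) ≫ (c ⊗ₘ s) ≫ tensorμ _ _ _ _ =
      ((((c ⊗ₘ s') ≫ tensorμ _ _ _ _) ⊗ₘ t') ≫ tensorμ _ _ _ _) ≫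
        (((α_ A D₁ P₁).hom ≫ A ◁ φ₁) ⊗ₘ ((α_ A D₂ P₂).hom ≫ A ◁ φ₂)) := by
  have e₁ : (A ◁ φ) ≫ (c ⊗ₘ s) ≫ tensorμ _ _ _ _ =
      (c ⊗ₘ (s' ⊗ₘ t')) ≫ (_ ◁ tensorμ _ _ _ _) ≫ tensorμ _ _ _ _ ≫ ((A ◁ φ₁) ⊗ₘ (A ◁ φ₂)) := by
    have := tensorμ_natural (𝟙 A) (𝟙 A) φ₁ φ₂
    rw [← id_tensorHom A φ₁, ← id_tensorHom A φ₂, ← this, ← id_tensorHom, ← id_tensorHom,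
      tensorHom_comp_tensorHom_assoc, tensorHom_comp_tensorHom_assoc,
      tensorHom_comp_tensorHom_assoc, h]
    simp
  have e₂ : (((c ⊗ₘ s') ≫ tensorμ A A D₁ D₂) ⊗ₘ t') =
      ((c ⊗ₘ s') ⊗ₘ t') ≫ (tensorμ _ _ _ _ ▷ _) := by
    simp [MonoidalCategory.tensorHom_def']
  have e₃ := tensor_associativity A A D₁ D₂ P₁ P₂
  rw [← tensorHom_comp_tensorHom, e₂]
  simp only [Category.assoc, reassoc_of% e₃, e₁, associator_naturality_assoc]

end Keep

section Frame

variable {D D₁ D₂ G G₁ G₂ P P₁ P₂ Q Q₁ Q₂ X X₁ X₂ : C} {t' : P ⟶ P₁ ⊗ P₂}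
  {φ : D ⊗ P ⟶ G} {s : G ⟶ G₁ ⊗ G₂} {s' : D ⟶ D₁ ⊗ D₂} {φ₁ : D₁ ⊗ P₁ ⟶ G₁}
  {φ₂ : D₂ ⊗ P₂ ⟶ G₂}

/-- Adding further labels `Q`, which are split by `t`, to an environment compatible with a
splitting. -/
theorem frame_split (h : φ ≫ s = ((s' ⊗ₘ t') ≫ tensorμ _ _ _ _) ≫ (φ₁ ⊗ₘ φ₂)) {t : Q ⟶ Q₁ ⊗ Q₂}
    {r : X ⟶ P ⊗ Q} {r' : X ⟶ X₁ ⊗ X₂} {r₁ : X₁ ⟶ P₁ ⊗ Q₁} {r₂ : X₂ ⟶ P₂ ⊗ Q₂}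
    (hr : r ≫ (t' ⊗ₘ t) ≫ tensorμ _ _ _ _ = r' ≫ (r₁ ⊗ₘ r₂)) :
    ((D ◁ r) ≫ (α_ _ _ _).inv ≫ (φ ▷ Q)) ≫ (s ⊗ₘ t) ≫ tensorμ _ _ _ _ =
      ((s' ⊗ₘ r') ≫ tensorμ _ _ _ _) ≫
        (((D₁ ◁ r₁) ≫ (α_ _ _ _).inv ≫ (φ₁ ▷ Q₁)) ⊗ₘ
          ((D₂ ◁ r₂) ≫ (α_ _ _ _).inv ≫ (φ₂ ▷ Q₂))) := by
  have e₁ : (φ ▷ Q) ≫ (s ⊗ₘ t) ≫ tensorμ _ _ _ _ =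
      ((s' ⊗ₘ t') ⊗ₘ t) ≫ (tensorμ _ _ _ _ ▷ _) ≫ tensorμ _ _ _ _ ≫ ((φ₁ ▷ _) ⊗ₘ (φ₂ ▷ _)) := by
    have := tensorμ_natural φ₁ φ₂ (𝟙 Q₁) (𝟙 Q₂)
    rw [← tensorHom_id φ₁, ← tensorHom_id φ₂, ← this, ← tensorHom_id, ← tensorHom_id,
      tensorHom_comp_tensorHom_assoc, tensorHom_comp_tensorHom_assoc,
      tensorHom_comp_tensorHom_assoc, h]
    simp
  have e₂ : (D₁ ⊗ D₂) ◁ tensorμ P₁ P₂ Q₁ Q₂ ≫ tensorμ _ _ _ _ ≫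
      ((α_ D₁ P₁ Q₁).inv ⊗ₘ (α_ D₂ P₂ Q₂).inv) =
      (α_ _ _ _).inv ≫ (tensorμ _ _ _ _ ▷ _) ≫ tensorμ _ _ _ _ := by
    have := tensor_associativity D₁ D₂ P₁ P₂ Q₁ Q₂
    rw [Iso.eq_inv_comp, ← reassoc_of% this, tensorHom_comp_tensorHom]
    simp
  have e₃ : tensorμ D₁ D₂ X₁ X₂ ≫ ((D₁ ◁ r₁) ⊗ₘ (D₂ ◁ r₂)) = (_ ◁ (r₁ ⊗ₘ r₂)) ≫ tensorμ _ _ _ _ := by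
    have := tensorμ_natural (𝟙 D₁) (𝟙 D₂) r₁ r₂
    simpa using this.symm
  have e₄ : (D ◁ r) ≫ (s' ⊗ₘ (t' ⊗ₘ t)) ≫ (_ ◁ tensorμ _ _ _ _) =
      (s' ⊗ₘ r') ≫ (_ ◁ (r₁ ⊗ₘ r₂)) := by
    have := congrArg (fun z => (s' ▷ X) ≫ ((D₁ ⊗ D₂) ◁ z)) hr
    simp only [whiskerLeft_comp] at this
    simp only [MonoidalCategory.tensorHom_def s', Category.assoc, whisker_exchange_assoc, this]
  rw [← tensorHom_comp_tensorHom, ← tensorHom_comp_tensorHom, Category.assoc, Category.assoc, e₁,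
    Category.assoc, reassoc_of% e₃, ← reassoc_of% e₄, reassoc_of% e₂,
    associator_inv_naturality_assoc]

end Frame

end EnvironmentLemmas

/-! ### Values and closed terms -/

section Terms

variable {M : Type u₃} [Category.{v₃} M] [MonoidalCategory M] {Sg : Signature.{u₃, w, k} M}

theorem CtxSplit.length_left {W : Type w} {Γ Γ₁ Γ₂ : Ctx W} (s : CtxSplit Γ Γ₁ Γ₂) :
    Γ₁.length = Γ.length := by
  induction s <;> simp_all

theorem CtxSplit.length_right {W : Type w} {Γ Γ₁ Γ₂ : Ctx W} (s : CtxSplit Γ Γ₁ Γ₂) :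
    Γ₂.length = Γ.length := by
  induction s <;> simp_all

theorem VarAt.lt_length {W : Type w} {Γ : Ctx W} {i : ℕ} {A : Ty W} (x : VarAt Γ i A) :
    i < Γ.length := by
  induction x <;> simp_all

theorem Term.upr_eq {r : ℕ → ℕ} {n : ℕ} (hr : ∀ i < n, r i = i) :
    ∀ i < n + 1, Term.upr r i = i
  | 0, _ => rfl
  | i + 1, h => congrArg Nat.succ (hr i (by omega))

/-- A renaming that fixes the variables of the context fixes the term; in particular, closed terms
are fixed by all renamings. -/
theorem Typing.rename_eq {Γ : Ctx Sg.W} {Q : LabelCtx Sg.W} {m : Term Sg} {A : Ty Sg.W}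
    (d : Typing Γ Q m A) {r : ℕ → ℕ} (hr : ∀ i < Γ.length, r i = i) : m.rename r = m := by
  induction d generalizing r with
  | var x => exact congrArg _ (hr _ x.lt_length)
  | const | star | label | diag => rfl
  | initial _ _ ih | left _ _ _ ih | right _ _ _ ih | force _ ih | box _ ih | lift _ _ ih =>
    simp only [Term.rename, ih hr]
  | lam _ _ ih => simp only [Term.rename, ih (Term.upr_eq hr)]
  | seq s t d d₁ ih ih₁ | pair s t d d₁ ih ih₁ | app s t d d₁ ih ih₁ | apply s t d d₁ ih ih₁ =>
    simp only [Term.rename, ih (s.length_left ▸ hr), ih₁ (s.length_right ▸ hr)]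
  | let_ s t d d₁ ih ih₁ =>
    simp only [Term.rename, ih (s.length_left ▸ hr), ih₁ (Term.upr_eq (s.length_right ▸ hr))]
  | letPair s t d d₁ ih ih₁ =>
    simp only [Term.rename, ih (s.length_left ▸ hr),
      ih₁ (Term.upr_eq (Term.upr_eq (s.length_right ▸ hr)))]
  | case s t d d₁ d₂ ih ih₁ ih₂ =>
    simp only [Term.rename, ih (s.length_left ▸ hr), ih₁ (Term.upr_eq (s.length_right ▸ hr)),
      ih₂ (Term.upr_eq (s.length_right ▸ hr))]

/-- The values: the possible results of an evaluation. -/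
inductive Term.IsValue : Term Sg → Prop
  | const (c) : IsValue (.const c)
  | left (A B) {v} : IsValue v → IsValue (.left A B v)
  | right (A B) {v} : IsValue v → IsValue (.right A B v)
  | star : IsValue .star
  | pair {v w} : IsValue v → IsValue w → IsValue (.pair v w)
  | lam (A m) : IsValue (.lam A m)
  | lift (m) : IsValue (.lift m)
  | label (ℓ) : IsValue (.label ℓ)
  | diag (l S l') : IsValue (.diag l S l')

theorem LTuple.isValue_toTerm (l : LTuple) : (l.toTerm Sg).IsValue := by
  induction l with
  | label ℓ => exact .label ℓ
  | star => exact .star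
  | pair l l' h h' => exact .pair h h'

theorem Eval.isValue [SymmetricCategory M] {Q : LabelCtx Sg.W} {S S' : Diagram Sg Q}
    {m v : Term Sg} (h : Eval S m S' v) : v.IsValue := by
  induction h with
  | const c => exact .const c
  | left _ ih => exact .left _ _ ih
  | right _ ih => exact .right _ _ ih
  | star => exact .star
  | pair _ _ ih ih' => exact .pair ih ih'
  | lam A m => exact .lam A m
  | lift m => exact .lift m
  | label ℓ => exact .label ℓ
  | box => exact .diag _ _ _
  | apply => exact LTuple.isValue_toTerm _
  | diag l D l' => exact .diag l D l'
  | let_ _ _ _ ih | case_left _ _ _ ih | case_right _ _ _ ih | seq _ _ _ ih | letPair _ _ _ ih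
  | force _ _ _ ih => exact ih
  | app _ _ _ _ _ ih => exact ih

end Terms

/-! ### The interpretation of values -/

section Values

variable {V : Type u₁} [Category.{v₁} V] [CartesianMonoidalCategory V] [BraidedCategory V]
  [MonoidalClosed V] [HasFiniteCoproducts V]
  {C : Type u₂} [Category.{v₂} C] [EnrichedOrdinaryCategory V C] [MonoidalCategory C]
  [SymmetricCategory C] [MonoidalClosed C] [HasFiniteCoproducts C]

namespace EnrichedCLNLModel

variable (𝓜 : EnrichedCLNLModel V C) {A B : C} {X Y : V}

theorem isIntuitionistic_leftUnitor_inv (e : A ≅ 𝓜.F.obj X) :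
    𝓜.IsIntuitionistic e
      ((Functor.Monoidal.εIso 𝓜.F ⊗ᵢ e) ≪≫ Functor.Monoidal.μIso 𝓜.F (𝟙_ V) X) (λ_ A).inv := by
  refine ⟨(λ_ X).inv, ?_⟩
  simp only [Iso.trans_inv, tensorIso_inv, Functor.Monoidal.μIso_inv, Functor.Monoidal.εIso_inv,
    MonoidalCategory.tensorHom_def]
  rw [← Functor.OplaxMonoidal.left_unitality_assoc, ← leftUnitor_inv_naturality,
    Iso.hom_inv_id_assoc]

variable {𝓜} in
theorem IsIntuitionistic.of_eq {e : A ≅ 𝓜.F.obj X} {e' : B ≅ 𝓜.F.obj Y} {f g : A ⟶ B}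
    (hf : 𝓜.IsIntuitionistic e e' f) (h : f = g) : 𝓜.IsIntuitionistic e e' g :=
  h ▸ hf

theorem isIntuitionistic_copy (e : A ≅ 𝓜.F.obj X) :
    𝓜.IsIntuitionistic e ((e ⊗ᵢ e) ≪≫ Functor.Monoidal.μIso 𝓜.F X X) (𝓜.copy e) :=
  ⟨CartesianMonoidalCategory.lift (𝟙 X) (𝟙 X), by simp [copy]⟩

theorem inl_sumIso (X Y : V) : coprod.inl ≫ (𝓜.sumIso X Y).hom = 𝓜.F.map coprod.inl := by
  have := 𝓜.adj.isLeftAdjoint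
  simp only [sumIso, PreservesColimitPair.iso_hom, coprodComparison_inl]

theorem inr_sumIso (X Y : V) : coprod.inr ≫ (𝓜.sumIso X Y).hom = 𝓜.F.map coprod.inr := by
  have := 𝓜.adj.isLeftAdjoint
  simp only [sumIso, PreservesColimitPair.iso_hom, coprodComparison_inr]

theorem isIntuitionistic_inl (e : A ≅ 𝓜.F.obj X) (e' : B ≅ 𝓜.F.obj Y) :
    𝓜.IsIntuitionistic e (coprod.mapIso e e' ≪≫ 𝓜.sumIso X Y) coprod.inl :=
  ⟨coprod.inl, by
    rw [← Category.assoc, Iso.eq_comp_inv, ← 𝓜.inl_sumIso]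
    simp⟩

theorem isIntuitionistic_inr (e : A ≅ 𝓜.F.obj X) (e' : B ≅ 𝓜.F.obj Y) :
    𝓜.IsIntuitionistic e' (coprod.mapIso e e' ≪≫ 𝓜.sumIso X Y) coprod.inr :=
  ⟨coprod.inr, by
    rw [← Category.assoc, Iso.eq_comp_inv, ← 𝓜.inr_sumIso]
    simp⟩

end EnrichedCLNLModel

variable {M : Type u₃} [Category.{v₃} M] [MonoidalCategory M] [SymmetricCategory M]
  {𝓜 : Model V C M} {Sg : Signature.{u₃, w, k} M}

/-- The interpretation `⟦Q⟧ ⟶ ⟦A⟧` of a derivation of `∅; Q ⊢ m : A`. -/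
noncomputable def Model.closedDen (K : 𝓜.Constants Sg) {Q : LabelCtx Sg.W} {m : Term Sg}
    {A : Ty Sg.W} (d : Typing [] Q m A) : 𝓜.labelCtx Sg Q ⟶ 𝓜.ty Sg A :=
  (λ_ (𝓜.labelCtx Sg Q)).inv ≫ Model.den K d

omit [MonoidalClosed C] [HasFiniteCoproducts C] in
theorem leftUnitor_inv_split {Q₁ Q₂ Q Z : C} (t : Q ⟶ Q₁ ⊗ Q₂)
    (r : (𝟙_ C ⊗ Q₁) ⊗ (𝟙_ C ⊗ Q₂) ⟶ Z) :
    (λ_ Q).inv ≫ (((λ_ (𝟙_ C)).inv ⊗ₘ t) ≫ tensorμ _ _ _ _) ≫ r =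
      t ≫ ((λ_ Q₁).inv ⊗ₘ (λ_ Q₂).inv) ≫ r := by
  rw [← tensorμ_unit_left, MonoidalCategory.tensorHom_def']
  simp

/-- The splitting of a closed context. -/
theorem Model.leftUnitor_inv_split {Q Q₁ Q₂ : LabelCtx Sg.W} (t : Q.Split Q₁ Q₂) {Z : C}
    (r : (𝓜.ctx Sg [] ⊗ 𝓜.labelCtx Sg Q₁) ⊗ (𝓜.ctx Sg [] ⊗ 𝓜.labelCtx Sg Q₂) ⟶ Z) :
    (λ_ (𝓜.labelCtx Sg Q)).inv ≫ Model.split CtxSplit.nil t ≫ r =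
      (𝓜.splitLabels Sg t).hom ≫ ((λ_ _).inv ⊗ₘ (λ_ _).inv) ≫ r :=
  ECLNL.leftUnitor_inv_split _ _

theorem Model.closedDen_pair (K : 𝓜.Constants Sg) {Q Q₁ Q₂ : LabelCtx Sg.W} {m n : Term Sg}
    {A B : Ty Sg.W} (t : Q.Split Q₁ Q₂) (d : Typing [] Q₁ m A) (d' : Typing [] Q₂ n B) :
    Model.closedDen K (.pair .nil t d d') =
      (𝓜.splitLabels Sg t).hom ≫ (Model.closedDen K d ⊗ₘ Model.closedDen K d') := by
  simp only [Model.closedDen, Model.den]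
  exact (Model.leftUnitor_inv_split t _).trans
    (congrArg (_ ≫ ·) (tensorHom_comp_tensorHom _ _ _ _))

/-- Lifting in the empty context is intuitionistic. -/
theorem Model.liftCtx_nil (h : Ctx.IsInt (W := Sg.W) []) :
    𝓜.IsIntuitionistic (X := 𝟙_ V) (Y := 𝓜.G.obj (𝟙_ C)) (Functor.Monoidal.εIso 𝓜.F) (Iso.refl _)
      (𝓜.liftCtx Sg [] h) := by
  refine ⟨𝓜.adj.unit.app (𝟙_ V) ≫ 𝓜.G.map (Functor.Monoidal.εIso 𝓜.F).inv, ?_⟩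
  rw [Functor.map_comp, Category.assoc]
  exact congrArg (fun z => _ ≫ _ ≫ z) (Category.comp_id _).symm

/-- The interpretation of a closed value of intuitionistic type is intuitionistic, and such a value
has no free labels. -/
theorem Term.IsValue.isIntuitionistic (K : 𝓜.Constants Sg) {v : Term Sg} (hv : v.IsValue)
    {Q : LabelCtx Sg.W} {P : Ty Sg.W} (d : Typing [] Q v P) (hP : P.IsInt) :
    ∃ e : LabelCtx.empty = Q,
      𝓜.IsIntuitionistic (A := 𝓜.labelCtx Sg .empty) (X := 𝟙_ V) (Functor.Monoidal.εIso 𝓜.F)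
        (𝓜.intIso Sg P hP).2 (eqToHom (congrArg (𝓜.labelCtx Sg) e) ≫ Model.closedDen K d) := by
  have key : ∀ {Z : C} (r : 𝟙_ C ⟶ Z), (λ_ (𝟙_ C)).inv ≫ (ρ_ (𝟙_ C)).hom ≫ r = r := by
    intro Z r
    rw [← unitors_equal, Iso.inv_hom_id_assoc]
  have hd : 𝓜.discardCtx Sg [] trivial = 𝟙 (𝟙_ C) := 𝓜.discard_εIso
  have key' : ∀ {Z : C} (r : 𝟙_ C ⟶ Z) (d : 𝟙_ C ⟶ 𝟙_ C), d = 𝟙 _ →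
      𝟙 (𝟙_ C) ≫ (λ_ (𝟙_ C)).inv ≫ (ρ_ (𝟙_ C)).hom ≫ d ≫ r = r := by
    rintro Z r _ rfl
    rw [Category.id_comp, key, Category.id_comp]
  induction hv generalizing Q P with
  | const c =>
    cases d with
    | const h c =>
      refine ⟨rfl, ?_⟩
      have := K.intuitionistic c hP
      exact this.of_eq (key' (K.den c) _ hd).symm
  | left A B hv ih =>
    cases d with
    | left _ _ d =>
      obtain ⟨rfl, h⟩ := ih d hP.1
      refine ⟨rfl, ?_⟩
      exact (h.comp (𝓜.isIntuitionistic_inl (𝓜.intIso Sg A hP.1).2 (𝓜.intIso Sg B hP.2).2)).of_eq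
        ((congrArg (· ≫ _) (Category.id_comp _)).trans
          ((Category.assoc _ _ _).trans (Category.id_comp _).symm))
  | right A B hv ih =>
    cases d with
    | right _ _ d =>
      obtain ⟨rfl, h⟩ := ih d hP.2
      refine ⟨rfl, ?_⟩
      exact (h.comp (𝓜.isIntuitionistic_inr (𝓜.intIso Sg A hP.1).2 (𝓜.intIso Sg B hP.2).2)).of_eq
        ((congrArg (· ≫ _) (Category.id_comp _)).trans
          ((Category.assoc _ _ _).trans (Category.id_comp _).symm))
  | star =>
    cases d with
    | star h =>
      refine ⟨rfl, ?_⟩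
      refine (𝓜.isIntuitionistic_id (Functor.Monoidal.εIso 𝓜.F)).of_eq ?_
      exact (key' (𝟙 _) _ hd).symm.trans (congrArg (fun z => _ ≫ _ ≫ _ ≫ z) (Category.comp_id _))
  | pair hv hv' ih ih' =>
    cases d with
    | pair s t d d' =>
      cases s
      obtain ⟨rfl, h⟩ := ih d hP.1
      obtain ⟨rfl, h'⟩ := ih' d' hP.2
      obtain rfl := LabelCtx.Split.eq_of_left_empty t
      refine ⟨rfl, ?_⟩
      rw [Model.closedDen_pair]
      have ht : (𝓜.splitLabels Sg t).hom = (λ_ _).inv := LabelCtx.splitIso_left_empty _ t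
      refine ((𝓜.isIntuitionistic_copy (Functor.Monoidal.εIso 𝓜.F)).comp (h.tensor h')).of_eq ?_
      rw [𝓜.copy_εIso, ht]
      exact (congrArg₂ (fun z z' => _ ≫ (z ⊗ₘ z')) (Category.id_comp _) (Category.id_comp _)).trans
        (Category.id_comp _).symm
  | lam A m =>
    cases d
    exact hP.elim
  | lift m =>
    cases d with
    | lift h d =>
      refine ⟨rfl, ?_⟩
      refine ((𝓜.liftCtx_nil h).comp (e'' := Iso.refl _)
        (g := 𝓜.F.map (𝓜.G.map ((ρ_ _).inv ≫ Model.den K d)))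
        ⟨𝓜.G.map ((ρ_ _).inv ≫ Model.den K d), ?_⟩).of_eq ?_
      · exact ((Category.id_comp _).trans (Category.comp_id _)).symm
      · exact (key _).symm.trans (Category.id_comp _).symm
  | label ℓ =>
    cases d
    exact hP.elim
  | diag l S l' =>
    cases d with
    | diag h hl hl' =>
      refine ⟨rfl, ?_⟩
      have : 𝓜.IsIntuitionistic (Functor.Monoidal.εIso 𝓜.F) (Iso.refl _)
        (Functor.LaxMonoidal.ε 𝓜.F ≫ 𝓜.F.map (𝓜.psi (𝓜.phi Sg hl hl'))) := ⟨_, by simp; rfl⟩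
      refine this.of_eq (key' (Functor.LaxMonoidal.ε 𝓜.F ≫ _) _ hd).symm

end Values

/-! ### Substitution of closed values -/

section Environments

variable {V : Type u₁} [Category.{v₁} V] [CartesianMonoidalCategory V] [BraidedCategory V]
  [MonoidalClosed V] [HasFiniteCoproducts V]
  {C : Type u₂} [Category.{v₂} C] [EnrichedOrdinaryCategory V C] [MonoidalCategory C]
  [SymmetricCategory C] [MonoidalClosed C] [HasFiniteCoproducts C]
  {M : Type u₃} [Category.{v₃} M] [MonoidalCategory M] [SymmetricCategory M]
  {𝓜 : Model V C M} {Sg : Signature.{u₃, w, k} M}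

/-- `Env K σ φ`, for `φ : ⟦Δ⟧ ⊗ ⟦Q⟧ ⟶ ⟦Γ⟧`: the substitution `σ` replaces some of the variables of
`Γ` by closed values, which together use the labels `Q`, and keeps the other variables, which form
the context `Δ`; its interpretation is `φ`. -/
inductive Env (K : 𝓜.Constants Sg) : ∀ {Γ Δ : Ctx Sg.W} {Q : LabelCtx Sg.W}, (ℕ → Term Sg) →
    (𝓜.ctx Sg Δ ⊗ 𝓜.labelCtx Sg Q ⟶ 𝓜.ctx Sg Γ) → Prop
  | nil (σ : ℕ → Term Sg) : Env K (Γ := []) (Δ := []) (Q := .empty) σ (λ_ (𝟙_ C)).hom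
  | absent {Γ Δ : Ctx Sg.W} {Q : LabelCtx Sg.W} {σ : ℕ → Term Sg}
      {φ : 𝓜.ctx Sg Δ ⊗ 𝓜.labelCtx Sg Q ⟶ 𝓜.ctx Sg Γ} (v : Term Sg) (h : Env K σ φ) :
      Env K (Γ := none :: Γ) (Term.scons v σ) φ
  | value {Γ Δ : Ctx Sg.W} {Q Q₁ Q₂ : LabelCtx Sg.W} {σ : ℕ → Term Sg} {v : Term Sg} {A : Ty Sg.W}
      {φ : 𝓜.ctx Sg Δ ⊗ 𝓜.labelCtx Sg Q₂ ⟶ 𝓜.ctx Sg Γ} (hv : v.IsValue) (d : Typing [] Q₁ v A)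
      (t : Q.Split Q₁ Q₂) (h : Env K σ φ) :
      Env K (Γ := some A :: Γ) (Q := Q) (Term.scons v σ)
        ((𝓜.ctx Sg Δ ◁ (𝓜.splitLabels Sg t).hom) ≫ (swapIso _ _ _).hom ≫
          (Model.closedDen K d ⊗ₘ φ))
  | keepAbsent {Γ Δ : Ctx Sg.W} {Q : LabelCtx Sg.W} {σ : ℕ → Term Sg}
      {φ : 𝓜.ctx Sg Δ ⊗ 𝓜.labelCtx Sg Q ⟶ 𝓜.ctx Sg Γ} (h : Env K σ φ) :
      Env K (Γ := none :: Γ) (Δ := none :: Δ) (Term.ups σ) φ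
  | keep {Γ Δ : Ctx Sg.W} {Q : LabelCtx Sg.W} {σ : ℕ → Term Sg}
      {φ : 𝓜.ctx Sg Δ ⊗ 𝓜.labelCtx Sg Q ⟶ 𝓜.ctx Sg Γ} (A : Ty Sg.W) (h : Env K σ φ) :
      Env K (Γ := some A :: Γ) (Δ := some A :: Δ) (Q := Q) (Term.ups σ)
        ((α_ (𝓜.ty Sg A) (𝓜.ctx Sg Δ) (𝓜.labelCtx Sg Q)).hom ≫ (𝓜.ty Sg A ◁ φ))

variable {K : 𝓜.Constants Sg}

/-- In an environment for an intuitionistic context, the values use no labels and the interpretation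
is intuitionistic. -/
theorem Env.int {Γ Δ : Ctx Sg.W} {Q : LabelCtx Sg.W} {σ : ℕ → Term Sg}
    {φ : 𝓜.ctx Sg Δ ⊗ 𝓜.labelCtx Sg Q ⟶ 𝓜.ctx Sg Γ} (h : Env K σ φ) (hΓ : Γ.IsInt) :
    ∃ (hΔ : Δ.IsInt) (e : Q = .empty) (f : 𝓜.ctx Sg Δ ⟶ 𝓜.ctx Sg Γ),
      𝓜.IsIntuitionistic (𝓜.ctxIntIso Sg Δ hΔ).2 (𝓜.ctxIntIso Sg Γ hΓ).2 f ∧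
        φ = (_ ◁ eqToHom (congrArg (𝓜.labelCtx Sg) e)) ≫ (ρ_ _).hom ≫ f := by
  have key : ∀ {X Y : C} (f : X ⟶ Y), (X ◁ 𝟙 (𝟙_ C)) ≫ (ρ_ X).hom ≫ f = (ρ_ X).hom ≫ f := by
    intros
    simp
  induction h with
  | nil σ =>
    refine ⟨hΓ, rfl, 𝟙 _, 𝓜.isIntuitionistic_id _, ?_⟩
    exact (unitors_equal.trans (Category.comp_id _).symm).trans (key _).symm
  | absent v h ih => exact ih hΓ
  | keepAbsent h ih => exact ih hΓ
  | value hv d t h ih =>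
    obtain ⟨hΔ, rfl, f, hf, rfl⟩ := ih hΓ.2
    obtain ⟨rfl, hc⟩ := hv.isIntuitionistic K d hΓ.1
    obtain rfl := LabelCtx.Split.eq_of_left_empty t
    have ht : (𝓜.splitLabels Sg t).hom = (λ_ _).inv := LabelCtx.splitIso_left_empty _ t
    refine ⟨hΔ, rfl, _, hf.comp ((𝓜.isIntuitionistic_leftUnitor_inv _).comp
      (hc.tensor (𝓜.isIntuitionistic_id _))), ?_⟩
    have key' : ∀ {X Y A : C} (f : X ⟶ Y) (c : 𝟙_ C ⟶ A),
        (X ◁ (λ_ (𝟙_ C)).inv) ≫ (swapIso _ _ _).hom ≫ (c ⊗ₘ ((X ◁ 𝟙 (𝟙_ C)) ≫ (ρ_ X).hom ≫ f)) =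
        (X ◁ 𝟙 (𝟙_ C)) ≫ (ρ_ X).hom ≫ f ≫ (λ_ Y).inv ≫ ((𝟙 (𝟙_ C) ≫ c) ⊗ₘ 𝟙 Y) := by
      intros
      rw [swap_unit]
      simp
    rw [ht]
    exact key' _ _
  | keep A h ih =>
    obtain ⟨hΔ, rfl, f, hf, rfl⟩ := ih hΓ.2
    refine ⟨⟨hΓ.1, hΔ⟩, rfl, _, (𝓜.isIntuitionistic_id (𝓜.intIso Sg A hΓ.1).2).tensor hf, ?_⟩
    have key' : ∀ {X Y A : C} (f : X ⟶ Y),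
        (α_ A X (𝟙_ C)).hom ≫ (A ◁ ((X ◁ 𝟙 (𝟙_ C)) ≫ (ρ_ X).hom ≫ f)) =
        ((A ⊗ X) ◁ 𝟙 (𝟙_ C)) ≫ (ρ_ (A ⊗ X)).hom ≫ (𝟙 A ⊗ₘ f) := by
      intros
      simp
    exact key' f

/-- Looking up a variable in an environment gives a variable that was kept or the value that
replaces it; the rest of the environment is discarded. -/
theorem Env.lookup {Γ Δ : Ctx Sg.W} {Q : LabelCtx Sg.W} {σ : ℕ → Term Sg}
    {φ : 𝓜.ctx Sg Δ ⊗ 𝓜.labelCtx Sg Q ⟶ 𝓜.ctx Sg Γ} (h : Env K σ φ) {i : ℕ} {A : Ty Sg.W}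
    (x : VarAt Γ i A) :
    (∃ (j : ℕ) (x' : VarAt Δ j A) (e : Q = .empty), σ i = .var j ∧
      φ ≫ 𝓜.lookup Sg x =
        (_ ◁ eqToHom (congrArg (𝓜.labelCtx Sg) e)) ≫ (ρ_ _).hom ≫ 𝓜.lookup Sg x') ∨
    ∃ (v : Term Sg) (hΔ : Δ.IsInt) (d : Typing [] Q v A), σ i = v ∧
      φ ≫ 𝓜.lookup Sg x = (𝓜.discardCtx Sg Δ hΔ ▷ _) ≫ Model.den K d := by
  induction h generalizing i with
  | nil σ => cases x
  | absent v h ih =>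
    cases x with
    | absent x => exact ih x
  | @value Γ Δ Q Q₁ Q₂ σ v B φ hv d t h ih =>
    cases x with
    | here _ hΓ =>
      right
      -- The other values are discarded, so that they use no labels.
      obtain ⟨hΔ, rfl, f, hf, rfl⟩ := h.int hΓ
      obtain rfl := LabelCtx.Split.eq_of_right_empty t
      refine ⟨v, hΔ, d, rfl, ?_⟩
      have ht : (𝓜.splitLabels Sg t).hom = (ρ_ _).inv := LabelCtx.splitIso_right_empty _ t
      rw [ht]
      have key : ∀ {X Y Q A : C} {f : X ⟶ Y} {dY : Y ⟶ 𝟙_ C} {dX : X ⟶ 𝟙_ C}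
          (d : 𝟙_ C ⊗ Q ⟶ A), f ≫ dY = dX →
          ((X ◁ (ρ_ Q).inv) ≫ (swapIso _ _ _).hom ≫ (((λ_ Q).inv ≫ d) ⊗ₘ
            ((X ◁ 𝟙 (𝟙_ C)) ≫ (ρ_ X).hom ≫ f))) ≫ (A ◁ dY) ≫ (ρ_ A).hom = (dX ▷ Q) ≫ d := by
        rintro X Y Q A f dY _ d rfl
        have e := swapIso_naturality (f ≫ dY) (𝟙 Q) (𝟙 (𝟙_ C))
        have e' : (((λ_ Q).inv ≫ d) ⊗ₘ ((X ◁ 𝟙 (𝟙_ C)) ≫ (ρ_ X).hom ≫ f)) ≫ (A ◁ dY) ≫ (ρ_ A).hom =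
            (𝟙 Q ⊗ₘ ((f ≫ dY) ⊗ₘ 𝟙 (𝟙_ C))) ≫ (Q ◁ (λ_ _).hom) ≫ (ρ_ Q).hom ≫ (λ_ Q).inv ≫ d := by
          have e₀ : ((X ◁ 𝟙 (𝟙_ C)) ≫ (ρ_ X).hom ≫ f) ≫ dY =
              ((f ≫ dY) ▷ 𝟙_ C) ≫ (λ_ (𝟙_ C)).hom := by
            simp [unitors_equal]
          rw [← id_tensorHom A dY, tensorHom_comp_tensorHom_assoc, Category.comp_id, e₀,
            MonoidalCategory.tensorHom_def', Category.assoc, rightUnitor_naturality, tensorHom_id,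
            whiskerLeft_comp, id_tensorHom, Category.assoc]
        rw [Category.assoc, Category.assoc, e', ← reassoc_of% e]
        simp only [swapIso, Iso.trans_hom, Iso.symm_hom, whiskerRightIso_hom,
          braiding_tensorUnit_left]
        rw [MonoidalCategory.tensorHom_def]
        monoidal
      exact key _ hf.comp_discard
    | skip _ hP x =>
      obtain ⟨rfl, hc⟩ := hv.isIntuitionistic K d hP
      obtain rfl := LabelCtx.Split.eq_of_left_empty t
      have ht : (𝓜.splitLabels Sg t).hom = (λ_ _).inv := LabelCtx.splitIso_left_empty _ t
      rw [ht]
      have hc' := hc.comp_discard.trans 𝓜.discard_εIso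
      have key : ∀ {X Y Q A Z : C} {φ : X ⊗ Q ⟶ Y} {c : 𝟙_ C ⟶ A} {d : A ⟶ 𝟙_ C} (r : Y ⟶ Z),
          (𝟙 (𝟙_ C) ≫ c) ≫ d = 𝟙 (𝟙_ C) →
          ((X ◁ (λ_ Q).inv) ≫ (swapIso _ _ _).hom ≫ (c ⊗ₘ φ)) ≫ (d ▷ Y) ≫ (λ_ Y).hom ≫ r =
            φ ≫ r := by
        intro X Y Q A Z φ c d r h
        rw [Category.id_comp] at h
        rw [swap_unit, Category.assoc, Category.assoc, ← comp_whiskerRight_assoc, h]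
        simp
      have e := key (𝓜.lookup Sg x) (φ := φ) hc'
      rcases ih x with ⟨j, x', rfl, hj, hx⟩ | ⟨v, hΔ, d', hv, hx⟩
      · exact .inl ⟨j, x', rfl, hj, e.trans hx⟩
      · exact .inr ⟨v, hΔ, d', hv, e.trans hx⟩
  | keepAbsent h ih =>
    cases x with
    | absent x =>
      rcases ih x with ⟨j, x', rfl, hj, hx⟩ | ⟨v, hΔ, d', hv, hx⟩
      · exact .inl ⟨j + 1, .absent x', rfl, congrArg (Term.rename Nat.succ) hj, hx⟩
      · exact .inr ⟨v, hΔ, d', (congrArg (Term.rename Nat.succ) hv).trans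
          (d'.rename_eq (by simp)), hx⟩
  | @keep Γ Δ Q σ φ B h ih =>
    cases x with
    | here _ hΓ =>
      left
      obtain ⟨hΔ, rfl, f, hf, rfl⟩ := h.int hΓ
      refine ⟨0, .here _ hΔ, rfl, rfl, ?_⟩
      have key : ∀ {X Y A : C} {f : X ⟶ Y} {dY : Y ⟶ 𝟙_ C} {dX : X ⟶ 𝟙_ C}, f ≫ dY = dX →
          ((α_ A X (𝟙_ C)).hom ≫ (A ◁ ((X ◁ 𝟙 (𝟙_ C)) ≫ (ρ_ X).hom ≫ f))) ≫ (A ◁ dY) ≫ (ρ_ A).hom =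
            ((A ⊗ X) ◁ 𝟙 (𝟙_ C)) ≫ (ρ_ (A ⊗ X)).hom ≫ (A ◁ dX) ≫ (ρ_ A).hom := by
        rintro X Y A f dY _ rfl
        simp
      exact key hf.comp_discard
    | skip _ hP x =>
      rcases ih x with ⟨j, x', rfl, hj, hx⟩ | ⟨v, hΔ, d', hv, hx⟩
      · refine .inl ⟨j + 1, .skip _ hP x', rfl, congrArg (Term.rename Nat.succ) hj, ?_⟩
        have key : ∀ {X Y A Z : C} {φ : X ⊗ 𝟙_ C ⟶ Y} {d : A ⟶ 𝟙_ C} {l : Y ⟶ Z} {l' : X ⟶ Z},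
            φ ≫ l = (X ◁ 𝟙 (𝟙_ C)) ≫ (ρ_ X).hom ≫ l' →
            ((α_ A X (𝟙_ C)).hom ≫ (A ◁ φ)) ≫ (d ▷ Y) ≫ (λ_ Y).hom ≫ l =
              ((A ⊗ X) ◁ 𝟙 (𝟙_ C)) ≫ (ρ_ (A ⊗ X)).hom ≫ (d ▷ X) ≫ (λ_ X).hom ≫ l' := by
          intro X Y A Z φ d l l' h
          simp only [Category.assoc, whisker_exchange_assoc, leftUnitor_naturality_assoc, h]
          monoidal
        exact key hx
      · refine .inr ⟨v, ⟨hP, hΔ⟩, d', (congrArg (Term.rename Nat.succ) hv).trans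
          (d'.rename_eq (by simp)), ?_⟩
        have key : ∀ {X Y Q A Z : C} {φ : X ⊗ Q ⟶ Y} {d : A ⟶ 𝟙_ C} {l : Y ⟶ Z} {dX : X ⟶ 𝟙_ C}
            {r : 𝟙_ C ⊗ Q ⟶ Z}, φ ≫ l = (dX ▷ Q) ≫ r →
            ((α_ A X Q).hom ≫ (A ◁ φ)) ≫ (d ▷ Y) ≫ (λ_ Y).hom ≫ l =
              (((d ▷ X) ≫ (λ_ X).hom ≫ dX) ▷ Q) ≫ r := by
          intro X Y Q A Z φ d l dX r h
          simp only [Category.assoc, whisker_exchange_assoc, leftUnitor_naturality_assoc, h]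
          simp
        exact (key hx).trans (congrArg (fun z => (z ▷ _) ≫ Model.den K d')
          (𝓜.discardCtx_some Sg B Δ ⟨hP, hΔ⟩).symm)

/-- Environments are compatible with splitting contexts. Values for variables that go to both parts
have intuitionistic type, so that they use no labels and can be copied. -/
theorem Env.split {Γ Γ₁ Γ₂ Δ : Ctx Sg.W} {Q : LabelCtx Sg.W} {σ : ℕ → Term Sg}
    {φ : 𝓜.ctx Sg Δ ⊗ 𝓜.labelCtx Sg Q ⟶ 𝓜.ctx Sg Γ} (h : Env K σ φ) (s : CtxSplit Γ Γ₁ Γ₂) :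
    ∃ (Δ₁ Δ₂ : Ctx Sg.W) (Q₁ Q₂ : LabelCtx Sg.W) (s' : CtxSplit Δ Δ₁ Δ₂) (t' : Q.Split Q₁ Q₂)
      (φ₁ : 𝓜.ctx Sg Δ₁ ⊗ 𝓜.labelCtx Sg Q₁ ⟶ 𝓜.ctx Sg Γ₁)
      (φ₂ : 𝓜.ctx Sg Δ₂ ⊗ 𝓜.labelCtx Sg Q₂ ⟶ 𝓜.ctx Sg Γ₂),
      Env K σ φ₁ ∧ Env K σ φ₂ ∧
        φ ≫ 𝓜.splitCtx Sg s = Model.split s' t' ≫ (φ₁ ⊗ₘ φ₂) := by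
  induction h generalizing Γ₁ Γ₂ with
  | nil σ =>
    cases s
    refine ⟨[], [], .empty, .empty, .nil, (Shuffle.nil : Shuffle [] [] []), _, _, .nil σ, .nil σ, ?_⟩
    have key : (λ_ (𝟙_ C)).hom ≫ (λ_ (𝟙_ C)).inv =
        (((λ_ (𝟙_ C)).inv ⊗ₘ (λ_ (𝟙_ C)).inv) ≫ tensorμ _ _ _ _) ≫
          ((λ_ (𝟙_ C)).hom ⊗ₘ (λ_ (𝟙_ C)).hom) := by
      simp only [tensorμ, braiding_tensorUnit_left, MonoidalCategory.tensorHom_def]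
      monoidal
    exact key
  | absent v h ih =>
    cases s with
    | absent s =>
      obtain ⟨Δ₁, Δ₂, Q₁, Q₂, s', t', φ₁, φ₂, h₁, h₂, hφ⟩ := ih s
      exact ⟨Δ₁, Δ₂, Q₁, Q₂, s', t', φ₁, φ₂, .absent v h₁, .absent v h₂, hφ⟩
  | keepAbsent h ih =>
    cases s with
    | absent s =>
      obtain ⟨Δ₁, Δ₂, Q₁, Q₂, s', t', φ₁, φ₂, h₁, h₂, hφ⟩ := ih s
      exact ⟨_, _, Q₁, Q₂, .absent s', t', φ₁, φ₂, .keepAbsent h₁, .keepAbsent h₂, hφ⟩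
  | keep A h ih =>
    cases s with
    | left _ s =>
      obtain ⟨Δ₁, Δ₂, Q₁, Q₂, s', t', φ₁, φ₂, h₁, h₂, hφ⟩ := ih s
      exact ⟨_, _, Q₁, Q₂, .left A s', t', _, _, .keep A h₁, .keepAbsent h₂, keep_split_left hφ⟩
    | right _ s =>
      obtain ⟨Δ₁, Δ₂, Q₁, Q₂, s', t', φ₁, φ₂, h₁, h₂, hφ⟩ := ih s
      exact ⟨_, _, Q₁, Q₂, .right A s', t', _, _, .keepAbsent h₁, .keep A h₂, keep_split_right hφ⟩
    | both _ hA s =>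
      obtain ⟨Δ₁, Δ₂, Q₁, Q₂, s', t', φ₁, φ₂, h₁, h₂, hφ⟩ := ih s
      exact ⟨_, _, Q₁, Q₂, .both A hA s', t', _, _, .keep A h₁, .keep A h₂, keep_split_both _ hφ⟩
  | @value Γ Δ Q P₁ P₂ σ v A φ hv d t h ih =>
    cases s with
    | left _ s =>
      obtain ⟨Δ₁, Δ₂, Q₁, Q₂, s', t', φ₁, φ₂, h₁, h₂, hφ⟩ := ih s
      obtain ⟨X, r, r', hr⟩ := LabelCtx.Split.exists_assoc_inv (𝓜.wire Sg) t t'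
      exact ⟨_, _, X, Q₂, s', r, _, _, .value hv d r' h₁, .absent v h₂, value_split_left _ hφ hr⟩
    | right _ s =>
      obtain ⟨Δ₁, Δ₂, Q₁, Q₂, s', t', φ₁, φ₂, h₁, h₂, hφ⟩ := ih s
      obtain ⟨X, r, r', hr⟩ := LabelCtx.Split.exists_swap (𝓜.wire Sg) t t'
      exact ⟨_, _, Q₁, X, s', r, _, _, .absent v h₁, .value hv d r' h₂, value_split_right _ hφ hr⟩
    | both _ hA s =>
      obtain ⟨Δ₁, Δ₂, Q₁, Q₂, s', t', φ₁, φ₂, h₁, h₂, hφ⟩ := ih s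
      obtain ⟨rfl, hc⟩ := hv.isIntuitionistic K d hA
      obtain rfl := LabelCtx.Split.eq_of_left_empty t
      obtain ⟨t₁⟩ := LabelCtx.exists_split_left_empty Q₁
      obtain ⟨t₂⟩ := LabelCtx.exists_split_left_empty Q₂
      refine ⟨_, _, Q₁, Q₂, s', t', _, _, .value hv d t₁ h₁, .value hv d t₂ h₂, ?_⟩
      have ht : (𝓜.splitLabels Sg t).hom = (λ_ _).inv := LabelCtx.splitIso_left_empty _ t
      have ht₁ : (𝓜.splitLabels Sg t₁).hom = (λ_ _).inv := LabelCtx.splitIso_left_empty _ t₁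
      have ht₂ : (𝓜.splitLabels Sg t₂).hom = (λ_ _).inv := LabelCtx.splitIso_left_empty _ t₂
      rw [ht, ht₁, ht₂]
      have hc' := hc.comp_copy.trans (congrArg (· ≫ _) 𝓜.copy_εIso)
      have key : ∀ {c : 𝟙_ C ⟶ 𝓜.ty Sg A} {cp : 𝓜.ty Sg A ⟶ 𝓜.ty Sg A ⊗ 𝓜.ty Sg A},
          (𝟙 (𝟙_ C) ≫ c) ≫ cp = (λ_ (𝟙_ C)).inv ≫ ((𝟙 (𝟙_ C) ≫ c) ⊗ₘ (𝟙 (𝟙_ C) ≫ c)) →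
          c ≫ cp = (λ_ (𝟙_ C)).inv ≫ (c ⊗ₘ c) := by
        intro c cp h
        simpa only [Category.id_comp] using h
      exact value_split_both (key hc') hφ

/-- The class of substitutions of closed values for some of the variables, in the presence of
further labels `Q`. -/
inductive EnvRel (K : 𝓜.Constants Sg) : ∀ {Γ Δ : Ctx Sg.W} {Q Q' : LabelCtx Sg.W},
    (ℕ → Term Sg) → (𝓜.ctx Sg Δ ⊗ 𝓜.labelCtx Sg Q' ⟶ 𝓜.ctx Sg Γ ⊗ 𝓜.labelCtx Sg Q) → Prop
  | mk {Γ Δ : Ctx Sg.W} {Q Q' P : LabelCtx Sg.W} {σ : ℕ → Term Sg}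
      {φ : 𝓜.ctx Sg Δ ⊗ 𝓜.labelCtx Sg P ⟶ 𝓜.ctx Sg Γ} (h : Env K σ φ) (t : Q'.Split P Q) :
      EnvRel K (Q := Q) (Q' := Q') σ
        ((_ ◁ (𝓜.splitLabels Sg t).hom) ≫ (α_ _ _ _).inv ≫ (φ ▷ _))

/-- Substitutions of closed values form a class of interpreted substitutions. -/
theorem isSubstClass_env (K : 𝓜.Constants Sg) : IsSubstClass K (EnvRel K) where
  var h i A x := by
    cases h with
    | mk h t =>
    obtain rfl := LabelCtx.Split.eq_of_right_empty t
    have ht : (𝓜.splitLabels Sg t).hom = (ρ_ _).inv := LabelCtx.splitIso_right_empty _ t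
    rw [ht]
    have key : ∀ {X Y Q Z : C} (φ : X ⊗ Q ⟶ Y) (l : Y ⟶ Z),
        ((X ◁ (ρ_ Q).inv) ≫ (α_ _ _ _).inv ≫ (φ ▷ 𝟙_ C)) ≫ (ρ_ Y).hom ≫ l = φ ≫ l := by
      intros
      simp
    rcases h.lookup x with ⟨j, x', rfl, hj, hx⟩ | ⟨v, hΔ, d, hv, hx⟩
    · rw [hj]
      refine ⟨.var x', Eq.trans ?_ (key _ _).symm⟩
      rw [hx]
      have key' : ∀ {X Z : C} (l : X ⟶ Z),
          (ρ_ X).hom ≫ l = (X ◁ 𝟙 (𝟙_ C)) ≫ (ρ_ X).hom ≫ l := by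
        intros
        simp
      exact key' _
    · rw [hv]
      obtain ⟨d', hd'⟩ := d.exists_weaken K (.nil hΔ)
      exact ⟨d', (hd'.trans hx.symm).trans (key _ _).symm⟩
  int h hΓ := by
    cases h with
    | mk h t =>
    obtain ⟨hΔ, rfl, f, hf, rfl⟩ := h.int hΓ
    obtain rfl := LabelCtx.Split.eq_of_left_empty t
    have ht : (𝓜.splitLabels Sg t).hom = (λ_ _).inv := LabelCtx.splitIso_left_empty _ t
    rw [ht]
    refine ⟨hΔ, rfl, f, hf, ?_⟩
    have key : ∀ {X Y Q : C} (f : X ⟶ Y),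
        (X ◁ (λ_ Q).inv) ≫ (α_ _ _ _).inv ≫ (((X ◁ 𝟙 (𝟙_ C)) ≫ (ρ_ X).hom ≫ f) ▷ Q) =
          f ⊗ₘ 𝟙 Q := by
      intros
      simp
    exact key f
  split h s t := by
    cases h with
    | mk h u =>
    obtain ⟨Δ₁, Δ₂, Q₁, Q₂, s', t', φ₁, φ₂, h₁, h₂, hφ⟩ := h.split s
    obtain ⟨X₁, X₂, r', r₁, r₂, hr⟩ := LabelCtx.Split.exists_interchange (𝓜.wire Sg) u t' t
    exact ⟨Δ₁, Δ₂, X₁, X₂, s', r', _, _, .mk h₁ r₁, .mk h₂ r₂, frame_split hφ hr⟩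
  bind h A := by
    cases h with
    | mk h t =>
    convert EnvRel.mk (h.keep A) t using 1
    have key : ∀ {A X Y P Q Q' : C} (t : Q' ⟶ P ⊗ Q) (φ : X ⊗ P ⟶ Y),
        (α_ A X Q').hom ≫ (A ◁ ((X ◁ t) ≫ (α_ _ _ _).inv ≫ (φ ▷ Q))) ≫ (α_ A Y Q).inv =
          ((A ⊗ X) ◁ t) ≫ (α_ _ _ _).inv ≫ (((α_ A X P).hom ≫ (A ◁ φ)) ▷ Q) := by
      intros
      simp
    exact key _ _

omit [MonoidalClosed C] [HasFiniteCoproducts C] in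
/-- The environment for a single value. -/
theorem leftUnitor_inv_env {A Z P Q X : C} (t : X ⟶ P ⊗ Q) (t' : P ⟶ P ⊗ 𝟙_ C)
    (ht' : t' = (ρ_ P).inv) (c : P ⟶ A) (r : (A ⊗ 𝟙_ C) ⊗ Q ⟶ Z) :
    (λ_ X).inv ≫ ((𝟙_ C ◁ t) ≫ (α_ _ _ _).inv ≫
      (((𝟙_ C ◁ t') ≫ (swapIso _ _ _).hom ≫ (c ⊗ₘ (λ_ (𝟙_ C)).hom)) ▷ Q)) ≫ r =
      t ≫ (c ▷ _) ≫ (A ◁ (λ_ Q).inv) ≫ (α_ A (𝟙_ C) Q).inv ≫ r := by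
  subst ht'
  simp only [swapIso, Iso.trans_hom, Iso.symm_hom, whiskerRightIso_hom, braiding_tensorUnit_left,
    MonoidalCategory.tensorHom_def]
  monoidal

/-- Substitution of a closed value for the only variable. -/
theorem Typing.exists_inst (K : 𝓜.Constants Sg) {Q P R : LabelCtx Sg.W} {n v : Term Sg}
    {A B : Ty Sg.W} (hv : v.IsValue) (t : Q.Split P R) (d : Typing [] P v A)
    (d' : Typing [some A] R n B) :
    ∃ d'' : Typing [] Q (n.inst v) B, Model.closedDen K d'' =
      (𝓜.splitLabels Sg t).hom ≫ (Model.closedDen K d ▷ _) ≫ (_ ◁ (λ_ _).inv) ≫ (α_ _ _ _).inv ≫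
        Model.den K d' := by
  obtain ⟨t₀⟩ := LabelCtx.exists_split_left_empty P
  obtain ⟨t'⟩ := LabelCtx.Split.symm t₀
  obtain ⟨d'', hd⟩ := (isSubstClass_env K).exists_typing d' (.mk (.value hv d t' (.nil .var)) t)
  exact ⟨d'', (congrArg ((λ_ _).inv ≫ ·) hd).trans
    (leftUnitor_inv_env _ _ (LabelCtx.splitIso_right_empty _ t') _ _)⟩

omit [MonoidalClosed C] [HasFiniteCoproducts C] in
/-- The environment for two values, whose labels are those of a pair. -/
theorem leftUnitor_inv_env₂ {A B Z P P₁ P₂ Q X : C} (t : X ⟶ P ⊗ Q) (t' : P ⟶ P₁ ⊗ P₂)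
    (t'' : P ⟶ P₂ ⊗ P₁) (ht'' : t'' = t' ≫ (β_ _ _).hom)
    (t₁ : P₁ ⟶ P₁ ⊗ 𝟙_ C) (ht₁ : t₁ = (ρ_ _).inv) (c : P₁ ⟶ A) (c' : P₂ ⟶ B)
    (r : (B ⊗ A ⊗ 𝟙_ C) ⊗ Q ⟶ Z) :
    (λ_ X).inv ≫ ((𝟙_ C ◁ t) ≫ (α_ _ _ _).inv ≫
      (((𝟙_ C ◁ t'') ≫ (swapIso _ _ _).hom ≫
        (c' ⊗ₘ ((𝟙_ C ◁ t₁) ≫ (swapIso _ _ _).hom ≫ (c ⊗ₘ (λ_ (𝟙_ C)).hom)))) ▷ Q)) ≫ r =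
      t ≫ ((t' ≫ (c ⊗ₘ c')) ▷ _) ≫ (_ ◁ (λ_ Q).inv) ≫ ((β_ A B).hom ▷ _) ≫ (α_ _ _ _).hom ≫
        (_ ◁ (α_ _ _ _).inv) ≫ (α_ _ _ _).inv ≫ r := by
  subst ht₁ ht''
  have e : (t' ≫ (c ⊗ₘ c')) ▷ Q ≫ (_ ◁ (λ_ Q).inv) ≫ ((β_ A B).hom ▷ _) =
      (t' ≫ (β_ _ _).hom ≫ (c' ⊗ₘ c)) ▷ Q ≫ (_ ◁ (λ_ Q).inv) := by
    rw [whisker_exchange, ← comp_whiskerRight_assoc, Category.assoc,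
      BraidedCategory.braiding_naturality]
  rw [reassoc_of% e]
  simp only [swapIso, Iso.trans_hom, Iso.symm_hom, whiskerRightIso_hom, braiding_tensorUnit_left,
    MonoidalCategory.tensorHom_def]
  monoidal

/-- Substitution of closed values for the only two variables. -/
theorem Typing.exists_inst₂ (K : 𝓜.Constants Sg) {Q P P₁ P₂ R : LabelCtx Sg.W}
    {n v v' : Term Sg} {A A' B : Ty Sg.W} (hv : v.IsValue) (hv' : v'.IsValue) (t : Q.Split P R)
    (t' : P.Split P₁ P₂) (d : Typing [] P₁ v A) (d' : Typing [] P₂ v' A')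
    (d₀ : Typing [some A', some A] R n B) :
    ∃ d'' : Typing [] Q (n.inst₂ v v') B, Model.closedDen K d'' =
      (𝓜.splitLabels Sg t).hom ≫ (Model.closedDen K (.pair .nil t' d d') ▷ _) ≫
        (_ ◁ (λ_ _).inv) ≫ ((β_ _ _).hom ▷ _) ≫ (α_ _ _ _).hom ≫
        (_ ◁ (α_ _ _ _).inv) ≫ (α_ _ _ _).inv ≫ Model.den K d₀ := by
  obtain ⟨t₀⟩ := LabelCtx.exists_split_left_empty P₁
  obtain ⟨t₁⟩ := LabelCtx.Split.symm t₀
  obtain ⟨t'', ht''⟩ := LabelCtx.Split.exists_symm (𝓜.wire Sg) t'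
  obtain ⟨d'', hd⟩ := (isSubstClass_env K).exists_typing d₀
    (.mk (.value hv' d' t'' (.value hv d t₁ (.nil .var))) t)
  refine ⟨d'', (congrArg ((λ_ _).inv ≫ ·) hd).trans ?_⟩
  rw [Model.closedDen_pair]
  exact leftUnitor_inv_env₂ _ _ _ ht'' _ (LabelCtx.splitIso_right_empty _ t₁) _ _ _

end Environments

/-! ### Strong monoidal functors and label contexts -/

section StrongMonoidal

variable {D : Type u} [Category.{v} D] [MonoidalCategory D] {D' : Type u₁} [Category.{v₁} D']
  [MonoidalCategory D'] (E : D ⥤ D')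

open Functor.LaxMonoidal in
/-- The inductive step of `tensorListIso_shuffle` for an entry that goes to the left part. -/
theorem map_associator_inv_tensor [E.Monoidal] {a x y z : D} {X' Y' Z' : D'} (s : x ⟶ y ⊗ z)
    (s' : X' ⟶ Y' ⊗ Z') (ix : X' ⟶ E.obj x) (iy : Y' ⟶ E.obj y) (iz : Z' ⟶ E.obj z)
    (h : s' ≫ (iy ⊗ₘ iz) ≫ μ E y z = ix ≫ E.map s) :
    ((E.obj a ◁ s') ≫ (α_ _ _ _).inv) ≫ (((E.obj a ◁ iy) ≫ μ E a y) ⊗ₘ iz) ≫ μ E (a ⊗ y) z =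
      ((E.obj a ◁ ix) ≫ μ E a x) ≫ E.map ((a ◁ s) ≫ (α_ _ _ _).inv) := by
  have e : ((E.obj a ◁ iy) ≫ μ E a y) ⊗ₘ iz = ((E.obj a ◁ iy) ⊗ₘ iz) ≫ (μ E a y ▷ _) := by
    simp [MonoidalCategory.tensorHom_def']
  rw [e]
  simp only [Functor.map_comp, Category.assoc]
  rw [← μ_natural_right_assoc, ← whiskerLeft_comp_assoc, ← h, whiskerLeft_comp_assoc, whiskerLeft_comp_assoc,
    associativity_inv, ← id_tensorHom (E.obj a) iy, ← associator_inv_naturality_assoc, id_tensorHom]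

variable [SymmetricCategory D] [SymmetricCategory D'] [E.Braided]

open Functor.LaxMonoidal in
theorem map_swapIso_hom (x y z : D) :
    (E.obj x ◁ μ E y z) ≫ μ E x (y ⊗ z) ≫ E.map (swapIso x y z).hom =
      (swapIso _ _ _).hom ≫ (E.obj y ◁ μ E x z) ≫ μ E y (x ⊗ z) := by
  have h : μ E x y ▷ _ ≫ μ E (x ⊗ y) z ≫ E.map ((β_ x y).hom ▷ z) =
      (β_ _ _).hom ▷ _ ≫ μ E y x ▷ _ ≫ μ E (y ⊗ x) z := by
    rw [← μ_natural_left, ← comp_whiskerRight_assoc, ← comp_whiskerRight_assoc,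
      Functor.LaxBraided.braided]
  simp only [swapIso, Iso.trans_hom, Iso.symm_hom, whiskerRightIso_hom, Functor.map_comp,
    Category.assoc]
  rw [associativity_inv_assoc, reassoc_of% h, associativity]

open Functor.LaxMonoidal in
/-- The inductive step of `tensorListIso_shuffle` for an entry that goes to the right part. -/
theorem map_swapIso_tensor {a x y z : D} {X' Y' Z' : D'} (s : x ⟶ y ⊗ z)
    (s' : X' ⟶ Y' ⊗ Z') (ix : X' ⟶ E.obj x) (iy : Y' ⟶ E.obj y) (iz : Z' ⟶ E.obj z)
    (h : s' ≫ (iy ⊗ₘ iz) ≫ μ E y z = ix ≫ E.map s) :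
    ((E.obj a ◁ s') ≫ (swapIso _ _ _).hom) ≫ (iy ⊗ₘ ((E.obj a ◁ iz) ≫ μ E a z)) ≫ μ E y (a ⊗ z) =
      ((E.obj a ◁ ix) ≫ μ E a x) ≫ E.map ((a ◁ s) ≫ (swapIso _ _ _).hom) := by
  have e : iy ⊗ₘ ((E.obj a ◁ iz) ≫ μ E a z) = (iy ⊗ₘ (E.obj a ◁ iz)) ≫ (_ ◁ μ E a z) := by
    simp [MonoidalCategory.tensorHom_def]
  have e₁ := swapIso_naturality (𝟙 (E.obj a)) iy iz
  rw [e]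
  simp only [Functor.map_comp, Category.assoc]
  rw [← μ_natural_right_assoc, ← whiskerLeft_comp_assoc, ← h, whiskerLeft_comp_assoc, whiskerLeft_comp_assoc,
    map_swapIso_hom, ← id_tensorHom (E.obj a) iz, ← id_tensorHom (E.obj a) (iy ⊗ₘ iz)]
  rw [reassoc_of% e₁]

open Functor.LaxMonoidal in
/-- A braided strong monoidal functor preserves the interpretation of shuffles. -/
theorem tensorListIso_shuffle {α : Type w} (f : α → D) {l l₁ l₂ : List α} (s : Shuffle l l₁ l₂) :
    (s.iso (fun a => E.obj (f a))).hom ≫ ((tensorListIso E f l₁).hom ⊗ₘ (tensorListIso E f l₂).hom) ≫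
        μ E _ _ =
      (tensorListIso E f l).hom ≫ E.map (s.iso f).hom := by
  induction s with
  | nil =>
    have key : (λ_ (𝟙_ D')).inv ≫ (ε E ⊗ₘ ε E) ≫ μ E (𝟙_ D) (𝟙_ D) = ε E ≫ E.map (λ_ (𝟙_ D)).inv := by
      rw [← left_unitality_inv]
      simp [MonoidalCategory.tensorHom_def']
    exact key
  | left a s ih => exact map_associator_inv_tensor E _ _ _ _ _ ih
  | right a s ih => exact map_swapIso_tensor E _ _ _ _ _ ih

/-- A strong monoidal functor preserves the interpretation of M-types. -/
def mtyDenIso {W : Type w} (f : W → D) : (T : MTy W) →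
    (T.den (fun a => E.obj (f a)) ≅ E.obj (T.den f))
  | .wire α => Iso.refl (E.obj (f α))
  | .unit => Functor.Monoidal.εIso E
  | .tensor T U => (mtyDenIso f T ⊗ᵢ mtyDenIso f U) ≪≫ Functor.Monoidal.μIso E _ _

open Functor.LaxMonoidal in
/-- A braided strong monoidal functor preserves the interpretation of label tuples. -/
theorem tensorListIso_iso {W : Type w} (f : W → D) {Q : LabelCtx W} {l : LTuple} {T : MTy W}
    (h : LTyping Q l T) :
    (h.iso (fun a => E.obj (f a))).hom ≫ (mtyDenIso E f T).hom =
      (tensorListIso E (fun e : ℕ × W => f e.2) Q.entries).hom ≫ E.map (h.iso f).hom := by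
  induction h with
  | label ℓ α =>
    have key : ∀ x : D, (ρ_ (E.obj x)).hom ≫ 𝟙 _ = ((E.obj x ◁ ε E) ≫ μ E x (𝟙_ D)) ≫
        E.map (ρ_ x).hom := by
      intro x
      rw [Category.comp_id, Category.assoc, right_unitality]
    exact key _
  | star =>
    have key : 𝟙 _ ≫ ε E = ε E ≫ E.map (𝟙 (𝟙_ D)) := by simp
    exact key
  | pair s h h' ih ih' =>
    have key : ∀ {x y z y' z' : D} {X Y Z Y' Z' : D'} {ix : X ⟶ E.obj x} {iy : Y ⟶ E.obj y}
        {iz : Z ⟶ E.obj z} {iy' : Y' ⟶ E.obj y'} {iz' : Z' ⟶ E.obj z'} {s : x ⟶ y ⊗ z}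
        {s' : X ⟶ Y ⊗ Z} {g : Y ⟶ Y'} {g' : Z ⟶ Z'} {p : y ⟶ y'} {p' : z ⟶ z'},
        s' ≫ (iy ⊗ₘ iz) ≫ μ E y z = ix ≫ E.map s → g ≫ iy' = iy ≫ E.map p →
        g' ≫ iz' = iz ≫ E.map p' →
        (s' ≫ (g ⊗ₘ g')) ≫ (iy' ⊗ₘ iz') ≫ μ E y' z' = ix ≫ E.map (s ≫ (p ⊗ₘ p')) := by
      intro x y z y' z' X Y Z Y' Z' ix iy iz iy' iz' s s' g g' p p' h h₁ h₂
      rw [Functor.map_comp, ← reassoc_of% h, ← μ_natural, tensorHom_comp_tensorHom_assoc,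
        Category.assoc, tensorHom_comp_tensorHom_assoc, h₁, h₂]
    exact key (tensorListIso_shuffle E (fun e : ℕ × W => f e.2) s) ih ih'

end StrongMonoidal

/-! ### The interpretation of diagrams -/

section Diagrams

variable {V : Type u₁} [Category.{v₁} V] [CartesianMonoidalCategory V] [BraidedCategory V]
  [MonoidalClosed V] [HasFiniteCoproducts V]
  {C : Type u₂} [Category.{v₂} C] [EnrichedOrdinaryCategory V C] [MonoidalCategory C]
  [SymmetricCategory C] [MonoidalClosed C] [HasFiniteCoproducts C]
  {M : Type u₃} [Category.{v₃} M] [MonoidalCategory M] [SymmetricCategory M]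
  (𝓜 : Model V C M) {Sg : Signature.{u₃, w, k} M}

theorem Model.diagram_id (Q : LabelCtx Sg.W) : 𝓜.diagram Sg (𝟙 (Q.den Sg.wire)) = 𝟙 _ := by
  simp only [Model.diagram]
  have key : ∀ {x : M} {X : C} (i : X ≅ 𝓜.E.obj x), i.hom ≫ 𝓜.E.map (𝟙 x) ≫ i.inv = 𝟙 X := by
    simp
  exact key _

/-- The interpretation of the diagram built by `Append`: the appended diagram acts on the wires of
the argument through its interpretation `⟦ℓ⃗'⟧ ∘ ⟦D⟧ ∘ ⟦ℓ⃗⟧⁻¹`. -/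
theorem Model.diagram_append {Q Q' Qk Qr Qk' R : LabelCtx Sg.W} (S : DiagramHom Sg Q Q')
    {kt lt lt' kt' : LTuple} {D : LDiagram Sg} {T U : MTy Sg.W}
    (s : Q'.Split Qk Qr) (s' : R.Split Qk' Qr) (hk : LTyping Qk kt T) (hl : LTyping D.dom lt T)
    (hl' : LTyping D.cod lt' U) (hk' : LTyping Qk' kt' U) :
    𝓜.diagram Sg (Q := Q) (Q' := R) (S ≫ (LabelCtx.splitIso Sg.wire s).hom ≫
      (((hk.iso Sg.wire).hom ≫ (hl.iso Sg.wire).inv ≫ D.hom ≫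
        (hl'.iso Sg.wire).hom ≫ (hk'.iso Sg.wire).inv) ▷ Qr.den Sg.wire) ≫
      (LabelCtx.splitIso Sg.wire s').inv) ≫ (𝓜.splitLabels Sg s').hom =
    𝓜.diagram Sg S ≫ (𝓜.splitLabels Sg s).hom ≫
      (((hk.iso (𝓜.wire Sg)).hom ≫ 𝓜.phi Sg hl hl' ≫ (hk'.iso (𝓜.wire Sg)).inv) ▷ _) := by
  have e := tensorListIso_shuffle 𝓜.E (fun e : ℕ × Sg.W => Sg.wire e.2) s
  have e' := tensorListIso_shuffle 𝓜.E (fun e : ℕ × Sg.W => Sg.wire e.2) s'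
  have ek := tensorListIso_iso 𝓜.E Sg.wire hk
  have el := tensorListIso_iso 𝓜.E Sg.wire hl
  have ek' := tensorListIso_iso 𝓜.E Sg.wire hk'
  have el' := tensorListIso_iso 𝓜.E Sg.wire hl'
  have key : ∀ {E : M ⥤ C} [E.Braided] {q q' k r k' x d c t u : M} {Q Q' K R K' X D D' T U : C}
      (iq : Q ≅ E.obj q) (iq' : Q' ≅ E.obj q') (ik : K ≅ E.obj k) (ir : R ≅ E.obj r)
      (ik' : K' ≅ E.obj k') (ix : X ≅ E.obj x) (id : D ≅ E.obj d) (ic : D' ≅ E.obj c)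
      (it : T ≅ E.obj t) (iu : U ≅ E.obj u) (S : q ⟶ q') (s : q' ≅ k ⊗ r) (s' : x ≅ k' ⊗ r)
      (hk : k ≅ t) (hl : d ≅ t) (hl' : c ≅ u) (hk' : k' ≅ u) (h : d ⟶ c)
      (cs : Q' ≅ K ⊗ R) (cs' : X ≅ K' ⊗ R)
      (ck : K ≅ T) (cl : D ≅ T) (cl' : D' ≅ U) (ck' : K' ≅ U),
      cs.hom ≫ (ik.hom ⊗ₘ ir.hom) ≫ Functor.LaxMonoidal.μ E k r = iq'.hom ≫ E.map s.hom →
      cs'.hom ≫ (ik'.hom ⊗ₘ ir.hom) ≫ Functor.LaxMonoidal.μ E k' r = ix.hom ≫ E.map s'.hom →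
      ck.hom ≫ it.hom = ik.hom ≫ E.map hk.hom → cl.hom ≫ it.hom = id.hom ≫ E.map hl.hom →
      ck'.hom ≫ iu.hom = ik'.hom ≫ E.map hk'.hom → cl'.hom ≫ iu.hom = ic.hom ≫ E.map hl'.hom →
      (iq.hom ≫ E.map (S ≫ s.hom ≫ ((hk.hom ≫ hl.inv ≫ h ≫ hl'.hom ≫ hk'.inv) ▷ r) ≫ s'.inv) ≫
        ix.inv) ≫ cs'.hom =
      (iq.hom ≫ E.map S ≫ iq'.inv) ≫ cs.hom ≫ ((ck.hom ≫ (cl.inv ≫ (id.hom ≫ E.map h ≫ ic.inv) ≫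
        cl'.hom) ≫ ck'.inv) ▷ R) := by
    intro E _ q q' k r k' x d c t u Q Q' K R K' X D D' T U iq iq' ik ir ik' ix id ic it iu S s s'
      hk hl hl' hk' h cs cs' ck cl cl' ck' e e' ek el ek' el'
    have e₁ : cs.hom = iq'.hom ≫ E.map s.hom ≫ Functor.OplaxMonoidal.δ E k r ≫
        (ik.inv ⊗ₘ ir.inv) := by
      rw [← reassoc_of% e]
      simp
    have e₂ : cs'.hom = ix.hom ≫ E.map s'.hom ≫ Functor.OplaxMonoidal.δ E k' r ≫
        (ik'.inv ⊗ₘ ir.inv) := by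
      rw [← reassoc_of% e']
      simp
    have e₃ : ck.hom = ik.hom ≫ E.map hk.hom ≫ it.inv := by
      rw [← reassoc_of% ek]; simp
    have e₄ : cl.inv = it.hom ≫ E.map hl.inv ≫ id.inv := by
      rw [← cancel_epi cl.hom, reassoc_of% el, ← Functor.map_comp_assoc]
      simp
    have e₅ : cl'.hom = ic.hom ≫ E.map hl'.hom ≫ iu.inv := by
      rw [← reassoc_of% el']; simp
    have e₆ : ck'.inv = iu.hom ≫ E.map hk'.inv ≫ ik'.inv := by
      rw [← cancel_epi ck'.hom, reassoc_of% ek', ← Functor.map_comp_assoc]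
      simp
    -- Everything is expressed through morphisms in the image of `E`.
    rw [e₁, e₂, e₃, e₄, e₅, e₆]
    have e₇ := Functor.OplaxMonoidal.δ_natural_left E (hk.hom ≫ hl.inv ≫ h ≫ hl'.hom ≫ hk'.inv) r
    have e₈ : (ik.hom ≫ E.map hk.hom ≫ it.inv) ≫ ((it.hom ≫ E.map hl.inv ≫ id.inv) ≫
        (id.hom ≫ E.map h ≫ ic.inv) ≫ ic.hom ≫ E.map hl'.hom ≫ iu.inv) ≫
        iu.hom ≫ E.map hk'.inv ≫ ik'.inv =
        ik.hom ≫ E.map (hk.hom ≫ hl.inv ≫ h ≫ hl'.hom ≫ hk'.inv) ≫ ik'.inv := by simp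
    rw [e₈]
    generalize hk.hom ≫ hl.inv ≫ h ≫ hl'.hom ≫ hk'.inv = z at e₇ ⊢
    have e₉ : (ik.inv ⊗ₘ ir.inv) ≫ ((ik.hom ≫ E.map z ≫ ik'.inv) ▷ R) =
        (E.map z ▷ E.obj r) ≫ (ik'.inv ⊗ₘ ir.inv) := by
      rw [← tensorHom_id, ← tensorHom_id, tensorHom_comp_tensorHom, tensorHom_comp_tensorHom]
      simp
    have e₁₀ : E.map (S ≫ s.hom ≫ z ▷ r ≫ s'.inv) ≫ E.map s'.hom =
        E.map S ≫ E.map s.hom ≫ E.map (z ▷ r) := by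
      rw [← Functor.map_comp, ← Functor.map_comp, ← Functor.map_comp]
      simp
    simp only [Category.assoc, Iso.inv_hom_id_assoc, e₉, reassoc_of% e₇, reassoc_of% e₁₀]
  exact key (E := 𝓜.E) (tensorListIso 𝓜.E (fun e : ℕ × Sg.W => Sg.wire e.2) Q.entries)
    (tensorListIso 𝓜.E (fun e : ℕ × Sg.W => Sg.wire e.2) Q'.entries)
    (tensorListIso 𝓜.E (fun e : ℕ × Sg.W => Sg.wire e.2) Qk.entries)
    (tensorListIso 𝓜.E (fun e : ℕ × Sg.W => Sg.wire e.2) Qr.entries)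
    (tensorListIso 𝓜.E (fun e : ℕ × Sg.W => Sg.wire e.2) Qk'.entries)
    (tensorListIso 𝓜.E (fun e : ℕ × Sg.W => Sg.wire e.2) R.entries)
    (tensorListIso 𝓜.E (fun e : ℕ × Sg.W => Sg.wire e.2) D.dom.entries)
    (tensorListIso 𝓜.E (fun e : ℕ × Sg.W => Sg.wire e.2) D.cod.entries)
    (mtyDenIso 𝓜.E Sg.wire T) (mtyDenIso 𝓜.E Sg.wire U) _ _ _ _ _ _ _ _ _ _ _ _ _ _ e e' ek el
    ek' el'

end Diagrams

/-! ### Boxes and label tuples -/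

section Boxes

variable {V : Type u₁} [Category.{v₁} V] [CartesianMonoidalCategory V] [BraidedCategory V]
  [MonoidalClosed V] [HasFiniteCoproducts V]
  {C : Type u₂} [Category.{v₂} C] [EnrichedOrdinaryCategory V C] [MonoidalCategory C]
  [SymmetricCategory C] [MonoidalClosed C] [HasFiniteCoproducts C]
  {M : Type u₃} [Category.{v₃} M] [MonoidalCategory M] [SymmetricCategory M]

/-- The naturality of `Ψ`, for those isomorphisms `i` and `j` that are identities up to equality of
objects. It is only used for `Model.mtyIso`. -/
theorem EnrichedCLNLModel.psi_congr (𝓜 : EnrichedCLNLModel V C) {A A' B B' : C} (i : A' ≅ A)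
    (j : B' ≅ B) (hi : ∃ p, i = eqToIso p) (hj : ∃ p, j = eqToIso p) (f : A ⟶ B) :
    𝓜.psi f = 𝓜.adj.homEquiv (𝟙_ V) ((ihom A').obj B')
        (Functor.OplaxMonoidal.η 𝓜.F ≫
          MonoidalClosed.curry ((ρ_ A').hom ≫ i.hom ≫ f ≫ j.inv)) ≫
      (𝓜.homIso A' B' ≪≫ Iso.eHomCongr V i j).hom := by
  obtain ⟨rfl, rfl⟩ := hi
  obtain ⟨rfl, rfl⟩ := hj
  simp [psi]

/-- `I ≅ F 1 ⟶ F (G A) ⟶ A` recovers a morphism `I ⟶ A` from its transpose. -/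
theorem EnrichedCLNLModel.ε_map_homEquiv_counit (𝓜 : EnrichedCLNLModel V C) {A : C}
    (g : 𝟙_ C ⟶ A) :
    Functor.LaxMonoidal.ε 𝓜.F ≫
      𝓜.F.map (𝓜.adj.homEquiv (𝟙_ V) A (Functor.OplaxMonoidal.η 𝓜.F ≫ g)) ≫
        𝓜.adj.counit.app A = g := by
  refine (congrArg (_ ≫ ·) (𝓜.adj.homEquiv_counit _ _ _).symm).trans ?_
  simp

variable (𝓜 : Model V C M) {Sg : Signature.{u₃, w, k} M}

theorem Model.mtyIso_eq_eqToIso (T : MTy Sg.W) : ∃ p, 𝓜.mtyIso Sg T = eqToIso p := by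
  induction T with
  | wire α => exact ⟨rfl, rfl⟩
  | unit => exact ⟨rfl, rfl⟩
  | tensor T U ih ih' =>
    have key : ∀ {X X' Y Y' : C} (i : X ≅ X') (j : Y ≅ Y'), (∃ p, i = eqToIso p) →
        (∃ p, j = eqToIso p) → ∃ p, i ⊗ᵢ j = eqToIso p := by
      rintro X X' Y Y' _ _ ⟨rfl, rfl⟩ ⟨rfl, rfl⟩
      exact ⟨rfl, by ext; simp⟩
    exact key _ _ ih ih'

/-- The morphism that interprets a boxed diagram, as the transpose of a curried morphism followed by
the isomorphism `!(T ⊸ U) ≅ Diag(T, U)`. -/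
theorem Model.psi_eq {T U : MTy Sg.W} (f : T.den (𝓜.wire Sg) ⟶ U.den (𝓜.wire Sg)) :
    𝓜.F.map (𝓜.psi f) = 𝓜.F.map (𝓜.adj.homEquiv (𝟙_ V) ((ihom _).obj _)
        (Functor.OplaxMonoidal.η 𝓜.F ≫ MonoidalClosed.curry
          ((ρ_ _).hom ≫ (𝓜.mtyIso Sg T).hom ≫ f ≫ (𝓜.mtyIso Sg U).inv))) ≫
      (𝓜.boxIso Sg T U).hom := by
  have e := 𝓜.psi_congr (𝓜.mtyIso Sg T) (𝓜.mtyIso Sg U) (𝓜.mtyIso_eq_eqToIso T)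
    (𝓜.mtyIso_eq_eqToIso U) f
  exact (congrArg 𝓜.F.map e).trans (𝓜.F.map_comp _ _)

omit [HasFiniteCoproducts C] in
theorem uncurry_eq_evMap {A B : C} (g : 𝟙_ C ⟶ (ihom A).obj B) :
    (λ_ A).inv ≫ (g ▷ A) ≫ evMap A B = (ρ_ A).inv ≫ MonoidalClosed.uncurry g := by
  rw [evMap, MonoidalClosed.uncurry_eq, BraidedCategory.braiding_naturality_left_assoc,
    braiding_tensorUnit_left]
  simp

variable {𝓜} (K : 𝓜.Constants Sg)

theorem Model.leftUnitor_inv_discardCtx {Z : C} (h : Ctx.IsInt (W := Sg.W) []) (r : 𝟙_ C ⟶ Z) :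
    (λ_ (𝟙_ C)).inv ≫ (ρ_ (𝟙_ C)).hom ≫ 𝓜.discardCtx Sg [] h ≫ r = r := by
  have hd : 𝓜.discardCtx Sg [] h = 𝟙 (𝟙_ C) := 𝓜.discard_εIso
  have key : ∀ d : 𝟙_ C ⟶ 𝟙_ C, d = 𝟙 _ → (λ_ (𝟙_ C)).inv ≫ (ρ_ (𝟙_ C)).hom ≫ d ≫ r = r := by
    rintro _ rfl
    rw [← unitors_equal, Iso.inv_hom_id_assoc, Category.id_comp]
  exact key _ hd

theorem Model.closedDen_diag {l l' : LTuple} {S : LDiagram Sg} {T U : MTy Sg.W}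
    (h : Ctx.IsInt (W := Sg.W) []) (hl : LTyping S.dom l T) (hl' : LTyping S.cod l' U) :
    Model.closedDen K (.diag h hl hl') =
      Functor.LaxMonoidal.ε 𝓜.F ≫ 𝓜.F.map (𝓜.psi (𝓜.phi Sg hl hl')) := by
  simp only [Model.closedDen, Model.den]
  exact Model.leftUnitor_inv_discardCtx h _

/-- The interpretation of a closed lifted term is the transpose of that of the term. -/
theorem Model.closedDen_lift {m : Term Sg} {A : Ty Sg.W} (h : Ctx.IsInt (W := Sg.W) [])
    (d : Typing [] .empty m A) :
    Model.closedDen K (.lift h d) = Functor.LaxMonoidal.ε 𝓜.F ≫ 𝓜.F.map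
      (𝓜.adj.homEquiv (𝟙_ V) _ (Functor.OplaxMonoidal.η 𝓜.F ≫ Model.closedDen K d)) := by
  simp only [Model.closedDen, Model.den]
  have key : ∀ {A : C} (g : 𝟙_ C ⊗ 𝟙_ C ⟶ A), (λ_ (𝟙_ C)).inv ≫ (ρ_ (𝟙_ C)).hom ≫
      𝓜.lift (Functor.Monoidal.εIso 𝓜.F) ≫ 𝓜.F.map (𝓜.G.map ((ρ_ _).inv ≫ g)) =
      Functor.LaxMonoidal.ε 𝓜.F ≫ 𝓜.F.map
        (𝓜.adj.homEquiv (𝟙_ V) _ (Functor.OplaxMonoidal.η 𝓜.F ≫ (λ_ _).inv ≫ g)) := by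
    intro A g
    rw [← unitors_equal, Iso.inv_hom_id_assoc, unitors_inv_equal, Adjunction.homEquiv_unit]
    generalize (ρ_ (𝟙_ C)).inv ≫ g = z
    rw [Functor.map_comp 𝓜.G, Functor.map_comp 𝓜.F, Functor.map_comp 𝓜.F, EnrichedCLNLModel.lift,
      Category.assoc, Category.assoc]
    rfl
  exact key _

/-- The `β`-law for `lift` and `force`, a triangle identity of the adjunction. -/
theorem Model.closedDen_force_lift {m : Term Sg} {A : Ty Sg.W} (h : Ctx.IsInt (W := Sg.W) [])
    (d : Typing [] .empty m A) :
    Model.closedDen K (.lift h d) ≫ 𝓜.adj.counit.app _ = Model.closedDen K d := by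
  refine (congrArg (· ≫ _) (Model.closedDen_lift K h d)).trans ?_
  exact (Category.assoc _ _ _).trans (𝓜.ε_map_homEquiv_counit _)

theorem Model.closedDen_apply {Q Q₁ Q₂ : LabelCtx Sg.W} {m n : Term Sg} {T U : MTy Sg.W}
    (t : Q.Split Q₁ Q₂) (d : Typing [] Q₁ m (.diag T U)) (d' : Typing [] Q₂ n T.toTy) :
    Model.closedDen K (.apply .nil t d d') = (𝓜.splitLabels Sg t).hom ≫
      ((Model.closedDen K d ≫ (𝓜.boxIso Sg _ _).inv ≫ 𝓜.adj.counit.app _) ⊗ₘ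
        Model.closedDen K d') ≫ evMap _ _ := by
  simp only [Model.closedDen, Model.den]
  have key : ∀ {X X' Y Y' Z Z' Z'' W S : C} (f : X ⟶ Y) (f' : X' ⟶ Y') (d : Y ⟶ Z) (d' : Y' ⟶ Z')
      (b : Z ⟶ Z'') (c : Z'' ⟶ W) (h : W ⊗ Z' ⟶ S),
      (f ⊗ₘ f') ≫ ((d ≫ b ≫ c) ⊗ₘ d') ≫ h = (((f ≫ d) ≫ b ≫ c) ⊗ₘ (f' ≫ d')) ≫ h := by
    simp
  exact (Model.leftUnitor_inv_split t _).trans (congrArg (_ ≫ ·) (key _ _ _ _ _ _ _))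

/-- A label tuple is a well-typed term, whose interpretation is the isomorphism given by the tuple.
-/
theorem LTyping.exists_typing {Q : LabelCtx Sg.W} {l : LTuple} {T : MTy Sg.W}
    (h : LTyping Q l T) : ∃ d : Typing [] Q (l.toTerm Sg) T.toTy,
      Model.closedDen K d = (h.iso (𝓜.wire Sg)).hom ≫ (𝓜.mtyIso Sg T).inv := by
  have hd : 𝓜.discardCtx Sg [] trivial = 𝟙 (𝟙_ C) := 𝓜.discard_εIso
  induction h with
  | label ℓ α =>
    refine ⟨.label (Φ := []) trivial ℓ α, ?_⟩
    simp only [Model.closedDen, Model.den]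
    have key : ∀ {A : C} (d : 𝟙_ C ⟶ 𝟙_ C), d = 𝟙 _ → (λ_ (A ⊗ 𝟙_ C)).inv ≫ (d ▷ _) ≫ (λ_ _).hom ≫
        (ρ_ A).hom = (ρ_ A).hom ≫ 𝟙 _ := by
      rintro A _ rfl
      simp
    exact key _ hd
  | star =>
    refine ⟨.star (Φ := []) trivial, ?_⟩
    simp only [Model.closedDen, Model.den]
    have key : ∀ (d : 𝟙_ C ⟶ 𝟙_ C), d = 𝟙 _ → (λ_ (𝟙_ C)).inv ≫ (ρ_ _).hom ≫ d = 𝟙 _ ≫ 𝟙 _ := by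
      rintro _ rfl
      rw [← unitors_equal, Iso.inv_hom_id_assoc, Category.id_comp]
    exact key _ hd
  | pair s h h' ih ih' =>
    obtain ⟨d, hd⟩ := ih
    obtain ⟨d', hd'⟩ := ih'
    refine ⟨.pair .nil s d d', ?_⟩
    refine (Model.closedDen_pair K s d d').trans ?_
    rw [hd, hd']
    have key : ∀ {X Y Y' Z Z' W W' : C} (s : X ⟶ Y ⊗ Y') (f : Y ⟶ Z) (g : Z ⟶ W) (f' : Y' ⟶ Z')
        (g' : Z' ⟶ W'), s ≫ ((f ≫ g) ⊗ₘ (f' ≫ g')) = (s ≫ (f ⊗ₘ f')) ≫ (g ⊗ₘ g') := by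
      simp
    exact key _ _ _ _ _

omit [SymmetricCategory M] in
/-- A label tuple can have only M-types. -/
theorem LTuple.exists_lTyping {Q : LabelCtx Sg.W} {l : LTuple} {A : Ty Sg.W}
    (d : Typing [] Q (l.toTerm Sg) A) : ∃ T : MTy Sg.W, A = T.toTy ∧ Nonempty (LTyping Q l T) := by
  induction l generalizing Q A with
  | label ℓ =>
    cases d with
    | label h ℓ α => exact ⟨.wire α, rfl, ⟨.label ℓ α⟩⟩
  | star =>
    cases d
    exact ⟨.unit, rfl, ⟨.star⟩⟩
  | pair l l' ih ih' =>
    cases d with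
    | pair s t d d' =>
      cases s
      obtain ⟨T, rfl, ⟨h⟩⟩ := ih d
      obtain ⟨U, rfl, ⟨h'⟩⟩ := ih' d'
      exact ⟨.tensor T U, rfl, ⟨.pair t h h'⟩⟩

/-- Every derivation for a label tuple denotes the isomorphism given by the tuple, by coherence. -/
theorem LTyping.closedDen_eq {Q : LabelCtx Sg.W} {l : LTuple} {T : MTy Sg.W} (h : LTyping Q l T)
    (d : Typing [] Q (l.toTerm Sg) T.toTy) :
    Model.closedDen K d = (h.iso (𝓜.wire Sg)).hom ≫ (𝓜.mtyIso Sg T).inv := by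
  obtain ⟨d', h'⟩ := h.exists_typing K
  rw [← h', Model.closedDen, Model.closedDen, Model.den_eq K d d']

end Boxes

/-! ### Soundness of evaluation -/

section Soundness

variable {V : Type u₁} [Category.{v₁} V] [CartesianMonoidalCategory V] [BraidedCategory V]
  [MonoidalClosed V] [HasFiniteCoproducts V]
  {C : Type u₂} [Category.{v₂} C] [EnrichedOrdinaryCategory V C] [MonoidalCategory C]
  [SymmetricCategory C] [MonoidalClosed C] [HasFiniteCoproducts C]
  {M : Type u₃} [Category.{v₃} M] [MonoidalCategory M] [SymmetricCategory M]
  {𝓜 : Model V C M} {Sg : Signature.{u₃, w, k} M} (K : 𝓜.Constants Sg)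

/-- The composite `⟦Q⟧ ⟶ ⟦Q''⟧ ⊗ ⟦Q'⟧ ⟶ X ⊗ ⟦Q'⟧` of a diagram with a morphism out of some of its
outputs. -/
noncomputable def Model.run {Q : LabelCtx Sg.W} (S : Diagram Sg Q) {Q'' Q' : LabelCtx Sg.W}
    (s : S.cod.Split Q'' Q') {X : C} (f : 𝓜.labelCtx Sg Q'' ⟶ X) :
    𝓜.labelCtx Sg Q ⟶ X ⊗ 𝓜.labelCtx Sg Q' :=
  𝓜.diagram Sg S.hom ≫ (𝓜.splitLabels Sg s).hom ≫ (f ▷ 𝓜.labelCtx Sg Q')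

theorem Model.run_comp {Q : LabelCtx Sg.W} (S : Diagram Sg Q) {Q'' Q' : LabelCtx Sg.W}
    (s : S.cod.Split Q'' Q') {X Y : C} (f : 𝓜.labelCtx Sg Q'' ⟶ X) (g : X ⟶ Y) :
    Model.run S s (f ≫ g) = Model.run S s f ≫ (g ▷ _) := by
  simp [Model.run]

theorem Model.run_comp_eq {Q : LabelCtx Sg.W} {S S' : Diagram Sg Q} {P P' Q' : LabelCtx Sg.W}
    {s : S.cod.Split P Q'} {s' : S'.cod.Split P' Q'} {X Y : C} {f : 𝓜.labelCtx Sg P ⟶ X}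
    {f' : 𝓜.labelCtx Sg P' ⟶ X} (h : Model.run S s f = Model.run S' s' f') (g : X ⟶ Y) :
    Model.run S s (f ≫ g) = Model.run S' s' (f' ≫ g) := by
  rw [Model.run_comp, h, ← Model.run_comp]

/-- With no remaining outputs, the frame can be removed. -/
theorem Model.run_right_empty {Q : LabelCtx Sg.W} {S S' : Diagram Sg Q}
    (s : S.cod.Split S.cod .empty) (s' : S'.cod.Split S'.cod .empty) {X : C}
    {f : 𝓜.labelCtx Sg S.cod ⟶ X} {f' : 𝓜.labelCtx Sg S'.cod ⟶ X}
    (h : Model.run S s f = Model.run S' s' f') :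
    𝓜.diagram Sg S.hom ≫ f = 𝓜.diagram Sg S'.hom ≫ f' := by
  have key : ∀ {A B B' : C} {a : A ⟶ B} {a' : A ⟶ B'} {b : B ⟶ B ⊗ 𝟙_ C} {b' : B' ⟶ B' ⊗ 𝟙_ C}
      {f : B ⟶ X} {f' : B' ⟶ X}, a ≫ b ≫ (f ▷ _) = a' ≫ b' ≫ (f' ▷ _) → b = (ρ_ _).inv →
      b' = (ρ_ _).inv → a ≫ f = a' ≫ f' := by
    rintro A B B' a a' _ _ f f' h rfl rfl
    simpa using h
  exact key h (LabelCtx.splitIso_right_empty _ s) (LabelCtx.splitIso_right_empty _ s')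

/-- Soundness of a single evaluation: for every way of splitting off the outputs used by the term,
the result can be typed with the same remaining outputs and has the same interpretation. The
derivation of the result is chosen here; by coherence, the choice does not matter. -/
def Preserves (K : 𝓜.Constants Sg) {Q : LabelCtx Sg.W} (S : Diagram Sg Q) (m : Term Sg)
    (S' : Diagram Sg Q) (v : Term Sg) : Prop :=
  ∀ ⦃A : Ty Sg.W⦄ ⦃Q'' Q' : LabelCtx Sg.W⦄ (s : S.cod.Split Q'' Q') (d : Typing [] Q'' m A),
    ∃ (P : LabelCtx Sg.W) (s' : S'.cod.Split P Q') (d' : Typing [] P v A),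
      Model.run S s (Model.closedDen K d) = Model.run S' s' (Model.closedDen K d')

variable {K} {Q : LabelCtx Sg.W} {S S' S'' : Diagram Sg Q} {m n v w : Term Sg}

/-- Evaluation of a term that uses only the labels `Q₁`, in the presence of further labels `Q₂`: the
labels `Q₂` are moved to the outputs that do not take part, by associativity. -/
theorem Preserves.frame_left (h : Preserves K S m S' v) {A : Ty Sg.W}
    {Q'' Q' Q₁ Q₂ : LabelCtx Sg.W} (s : S.cod.Split Q'' Q') (t : Q''.Split Q₁ Q₂)
    (d : Typing [] Q₁ m A) :
    ∃ (P P₁ : LabelCtx Sg.W) (s' : S'.cod.Split P Q') (t' : P.Split P₁ Q₂)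
      (d' : Typing [] P₁ v A), ∀ {X : C} (r : 𝓜.ty Sg A ⊗ 𝓜.labelCtx Sg Q₂ ⟶ X),
        Model.run S s ((𝓜.splitLabels Sg t).hom ≫ (Model.closedDen K d ▷ _) ≫ r) =
          Model.run S' s' ((𝓜.splitLabels Sg t').hom ≫ (Model.closedDen K d' ▷ _) ≫ r) := by
  obtain ⟨R, s₁, t₁, e₁⟩ := LabelCtx.Split.exists_assoc (𝓜.wire Sg) s t
  obtain ⟨P₁, s₂, d', e₂⟩ := h s₁ d
  obtain ⟨P, s', t', e₃⟩ := LabelCtx.Split.exists_assoc_inv (𝓜.wire Sg) s₂ t₁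
  refine ⟨P, P₁, s', t', d', fun {X} r => ?_⟩
  have key : ∀ {D D' Y Y' L₁ L₁' L₂ L₃ L₂₃ L A : C} {i : D ⟶ Y} {i' : D ⟶ Y'} {s : Y ⟶ L ⊗ L₃}
      {t : L ⟶ L₁ ⊗ L₂} {s₁ : Y ⟶ L₁ ⊗ L₂₃} {t₁ : L₂₃ ⟶ L₂ ⊗ L₃} {f : L₁ ⟶ A}
      {s₂ : Y' ⟶ L₁' ⊗ L₂₃} {f' : L₁' ⟶ A} {s' : Y' ⟶ D' ⊗ L₃} {t' : D' ⟶ L₁' ⊗ L₂}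
      (r : A ⊗ L₂ ⟶ X), s ≫ (t ▷ _) ≫ (α_ _ _ _).hom = s₁ ≫ (_ ◁ t₁) →
      i ≫ s₁ ≫ (f ▷ _) = i' ≫ s₂ ≫ (f' ▷ _) →
      s₂ ≫ (_ ◁ t₁) ≫ (α_ _ _ _).inv = s' ≫ (t' ▷ _) →
      i ≫ s ≫ ((t ≫ (f ▷ _) ≫ r) ▷ _) = i' ≫ s' ≫ ((t' ≫ (f' ▷ _) ≫ r) ▷ _) := by
    intro D D' Y Y' L₁ L₁' L₂ L₃ L₂₃ L A i i' s t s₁ t₁ f s₂ f' s' t' r h₁ h₂ h₃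
    have h₁' : s ≫ (t ▷ _) = s₁ ≫ (_ ◁ t₁) ≫ (α_ _ _ _).inv := by
      rw [← reassoc_of% h₁]; simp
    have e : ∀ {Y L : C} (f : L ⟶ A) (s₁ : Y ⟶ L ⊗ L₂₃),
        s₁ ≫ (_ ◁ t₁) ≫ (α_ _ _ _).inv ≫ ((f ▷ _) ▷ _) =
        (s₁ ≫ (f ▷ _)) ≫ (_ ◁ t₁) ≫ (α_ _ _ _).inv := by
      intro Y L f s₁
      rw [Category.assoc, ← whisker_exchange_assoc, associator_inv_naturality_left]
    simp only [comp_whiskerRight]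
    rw [reassoc_of% h₁', ← reassoc_of% h₃, reassoc_of% (e f s₁), reassoc_of% (e f' s₂),
      reassoc_of% h₂]
  exact key r e₁ e₂ e₃

/-- The mirror image of `Preserves.frame_left`. -/
theorem Preserves.frame_right (h : Preserves K S m S' v) {A : Ty Sg.W}
    {Q'' Q' Q₁ Q₂ : LabelCtx Sg.W} (s : S.cod.Split Q'' Q') (t : Q''.Split Q₁ Q₂)
    (d : Typing [] Q₂ m A) :
    ∃ (P P₂ : LabelCtx Sg.W) (s' : S'.cod.Split P Q') (t' : P.Split Q₁ P₂)
      (d' : Typing [] P₂ v A), ∀ {X : C} (r : 𝓜.labelCtx Sg Q₁ ⊗ 𝓜.ty Sg A ⟶ X),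
        Model.run S s ((𝓜.splitLabels Sg t).hom ≫ (_ ◁ Model.closedDen K d) ≫ r) =
          Model.run S' s' ((𝓜.splitLabels Sg t').hom ≫ (_ ◁ Model.closedDen K d') ≫ r) := by
  obtain ⟨t₁, e₁⟩ := t.exists_symm (𝓜.wire Sg)
  obtain ⟨P, P₂, s', t₂, d', h⟩ := h.frame_left s t₁ d
  obtain ⟨t', e₂⟩ := t₂.exists_symm (𝓜.wire Sg)
  refine ⟨P, P₂, s', t', d', fun {X} r => ?_⟩
  have key : ∀ {L L₁ L₂ A : C} {t : L ⟶ L₁ ⊗ L₂} {t' : L ⟶ L₂ ⊗ L₁} (f : L₂ ⟶ A)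
      (r : L₁ ⊗ A ⟶ X), t' = t ≫ (β_ _ _).hom →
      t ≫ (_ ◁ f) ≫ r = t' ≫ (f ▷ _) ≫ (β_ _ _).hom ≫ r := by
    rintro L L₁ L₂ A t _ f r rfl
    simp
  have key' : ∀ {L L₁ L₂ A : C} {t : L ⟶ L₁ ⊗ L₂} {t' : L ⟶ L₂ ⊗ L₁} (f : L₂ ⟶ A)
      (r : L₁ ⊗ A ⟶ X), t = t' ≫ (β_ _ _).hom →
      t ≫ (_ ◁ f) ≫ r = t' ≫ (f ▷ _) ≫ (β_ _ _).hom ≫ r := by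
    rintro L L₁ L₂ A _ t f r rfl
    simp
  exact (congrArg _ (key _ r e₁)).trans ((h _).trans (congrArg _ (key' _ r e₂).symm))

/-- Two successive evaluations of terms that use disjoint labels. -/
theorem Preserves.frame (h : Preserves K S m S' v) (h' : Preserves K S' n S'' w) {A B : Ty Sg.W}
    {Q'' Q' Q₁ Q₂ : LabelCtx Sg.W} (s : S.cod.Split Q'' Q') (t : Q''.Split Q₁ Q₂)
    (d₁ : Typing [] Q₁ m A) (d₂ : Typing [] Q₂ n B) :
    ∃ (P P₁ P₂ : LabelCtx Sg.W) (s' : S''.cod.Split P Q') (t' : P.Split P₁ P₂)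
      (d₁' : Typing [] P₁ v A) (d₂' : Typing [] P₂ w B),
      ∀ {X : C} (r : 𝓜.ty Sg A ⊗ 𝓜.ty Sg B ⟶ X),
        Model.run S s ((𝓜.splitLabels Sg t).hom ≫
            (Model.closedDen K d₁ ⊗ₘ Model.closedDen K d₂) ≫ r) =
          Model.run S'' s' ((𝓜.splitLabels Sg t').hom ≫
            (Model.closedDen K d₁' ⊗ₘ Model.closedDen K d₂') ≫ r) := by
  obtain ⟨P', P₁, s₁, t₁, d₁', e₁⟩ := h.frame_left s t d₁
  obtain ⟨P, P₂, s', t', d₂', e₂⟩ := h'.frame_right s₁ t₁ d₂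
  refine ⟨P, P₁, P₂, s', t', d₁', d₂', fun {X} r => ?_⟩
  rw [MonoidalCategory.tensorHom_def, Category.assoc, e₁, ← whisker_exchange_assoc, e₂,
    MonoidalCategory.tensorHom_def', Category.assoc]

omit [SymmetricCategory C] [MonoidalClosed C] [HasFiniteCoproducts C] in
theorem tensorHom_whiskerRight_assoc {X X' Y Y' Z W : C} (a : X ⟶ X') (b : Y ⟶ Y') (f : X' ⟶ Z)
    (r : Z ⊗ Y' ⟶ W) : (a ⊗ₘ b) ≫ (f ▷ _) ≫ r = ((a ≫ f) ▷ _) ≫ (_ ◁ b) ≫ r := by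
  rw [MonoidalCategory.tensorHom_def', Category.assoc, whisker_exchange_assoc]
  simp [whisker_exchange_assoc]

section ClosedTerms

variable (K) {Q₁ Q₂ : LabelCtx Sg.W} {A B : Ty Sg.W} (t : Q.Split Q₁ Q₂)

theorem Model.closedDen_left (A B : Ty Sg.W) (d : Typing [] Q m A) :
    Model.closedDen K (.left A B d) =
      Model.closedDen K d ≫ (coprod.inl : 𝓜.ty Sg A ⟶ 𝓜.ty Sg A ⨿ 𝓜.ty Sg B) :=
  (Category.assoc _ _ _).symm

theorem Model.closedDen_right (A B : Ty Sg.W) (d : Typing [] Q m B) :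
    Model.closedDen K (.right A B d) =
      Model.closedDen K d ≫ (coprod.inr : 𝓜.ty Sg B ⟶ 𝓜.ty Sg A ⨿ 𝓜.ty Sg B) :=
  (Category.assoc _ _ _).symm

theorem Model.closedDen_force (d : Typing [] Q m (.bang A)) :
    Model.closedDen K (.force d) = Model.closedDen K d ≫ 𝓜.adj.counit.app _ :=
  (Category.assoc _ _ _).symm

theorem Model.closedDen_box {T U : MTy Sg.W} (d : Typing [] Q m (.bang (.lolli T.toTy U.toTy))) :
    Model.closedDen K (.box d) = Model.closedDen K d ≫ (𝓜.boxIso Sg _ _).hom :=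
  (Category.assoc _ _ _).symm

theorem Model.closedDen_let (d : Typing [] Q₁ m A) (d' : Typing [some A] Q₂ n B) :
    Model.closedDen K (.let_ .nil t d d') = (𝓜.splitLabels Sg t).hom ≫
      (Model.closedDen K d ▷ _) ≫ (_ ◁ (λ_ _).inv) ≫ (α_ _ _ _).inv ≫ Model.den K d' := by
  simp only [Model.closedDen, Model.den]
  exact (Model.leftUnitor_inv_split t _).trans
    (congrArg (_ ≫ ·) (tensorHom_whiskerRight_assoc _ _ _ _))

theorem Model.closedDen_case {p : Term Sg} {Z : Ty Sg.W} (d : Typing [] Q₁ m (.sum A B))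
    (d₁ : Typing [some A] Q₂ n Z) (d₂ : Typing [some B] Q₂ p Z) :
    Model.closedDen K (.case .nil t d d₁ d₂) = (𝓜.splitLabels Sg t).hom ≫
      (Model.closedDen K d ▷ _) ≫ (_ ◁ (λ_ _).inv) ≫
        caseMap ((α_ _ _ _).inv ≫ Model.den K d₁) ((α_ _ _ _).inv ≫ Model.den K d₂) := by
  simp only [Model.closedDen, Model.den]
  exact (Model.leftUnitor_inv_split t _).trans
    (congrArg (_ ≫ ·) (tensorHom_whiskerRight_assoc _ _ _ _))

theorem Model.closedDen_seq (d : Typing [] Q₁ m .unit) (d' : Typing [] Q₂ n B) :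
    Model.closedDen K (.seq .nil t d d') = (𝓜.splitLabels Sg t).hom ≫
      (Model.closedDen K d ▷ _) ≫ (λ_ _).hom ≫ Model.closedDen K d' := by
  simp only [Model.closedDen, Model.den]
  have key : ∀ {X Y : C} (f : 𝟙_ C ⊗ X ⟶ Y), ((𝟙_ C) ◁ (λ_ X).inv) ≫ (λ_ _).hom ≫ f =
      (λ_ _).hom ≫ (λ_ _).inv ≫ f := by
    simp
  exact (Model.leftUnitor_inv_split t _).trans
    (congrArg (_ ≫ ·) ((tensorHom_whiskerRight_assoc _ _ _ _).trans
      (congrArg (_ ≫ ·) (key _))))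

theorem Model.closedDen_letPair {Z : Ty Sg.W} (d : Typing [] Q₁ m (.tensor A B))
    (d' : Typing [some B, some A] Q₂ n Z) :
    Model.closedDen K (.letPair .nil t d d') = (𝓜.splitLabels Sg t).hom ≫
      (Model.closedDen K d ▷ _) ≫ (_ ◁ (λ_ _).inv) ≫ ((β_ _ _).hom ▷ _) ≫ (α_ _ _ _).hom ≫
        (_ ◁ (α_ _ _ _).inv) ≫ (α_ _ _ _).inv ≫ Model.den K d' := by
  simp only [Model.closedDen, Model.den]
  exact (Model.leftUnitor_inv_split t _).trans
    (congrArg (_ ≫ ·) (tensorHom_whiskerRight_assoc _ _ _ _))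

theorem Model.closedDen_app (d : Typing [] Q₁ m (.lolli A B)) (d' : Typing [] Q₂ n A) :
    Model.closedDen K (.app .nil t d d') = (𝓜.splitLabels Sg t).hom ≫
      (Model.closedDen K d ⊗ₘ Model.closedDen K d') ≫ evMap _ _ := by
  simp only [Model.closedDen, Model.den]
  exact (Model.leftUnitor_inv_split t _).trans
    (congrArg (_ ≫ ·) (tensorHom_comp_tensorHom_assoc _ _ _ _ _))

end ClosedTerms

omit [HasFiniteCoproducts C] in
/-- The `β`-law of the closed structure. -/
theorem curry_tensorHom_evMap {X Y A B : C} (g : A ⊗ (𝟙_ C ⊗ X) ⟶ B) (e : Y ⟶ A) :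
    (((λ_ X).inv ≫ MonoidalClosed.curry g) ⊗ₘ e) ≫ evMap A B =
      (β_ _ _).hom ≫ (e ▷ _) ≫ (_ ◁ (λ_ X).inv) ≫ g := by
  rw [evMap, BraidedCategory.braiding_naturality_assoc, MonoidalCategory.tensorHom_def]
  simp only [MonoidalCategory.whiskerLeft_comp, Category.assoc]
  rw [← MonoidalClosed.uncurry_eq, MonoidalClosed.uncurry_curry]

omit [HasFiniteCoproducts C] in
/-- Application of a function that uses no labels. -/
theorem leftUnitor_inv_tensorHom_evMap {X A B : C} (g : 𝟙_ C ⟶ (ihom A).obj B) (a : X ⟶ A) :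
    (λ_ X).inv ≫ (g ⊗ₘ a) ≫ evMap A B = a ≫ (ρ_ A).inv ≫ MonoidalClosed.uncurry g := by
  rw [← uncurry_eq_evMap, MonoidalCategory.tensorHom_def', Category.assoc,
    ← leftUnitor_inv_naturality_assoc]

omit [SymmetricCategory C] [MonoidalClosed C] [HasFiniteCoproducts C] in
theorem tensorHom_comp_left {X Y Z X' Y' W : C} (f : X ⟶ Y) (g : Y ⟶ Z) (f' : X' ⟶ Y')
    (r : Z ⊗ Y' ⟶ W) : ((f ≫ g) ⊗ₘ f') ≫ r = (f ⊗ₘ f') ≫ (g ▷ _) ≫ r := by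
  simp [MonoidalCategory.tensorHom_def']

/-- The function extracted from a boxed diagram by `apply`. -/
theorem Model.closedDen_diag_counit (K : 𝓜.Constants Sg) {l l' : LTuple} {S : LDiagram Sg}
    {T U : MTy Sg.W} (h : Ctx.IsInt (W := Sg.W) []) (hl : LTyping S.dom l T)
    (hl' : LTyping S.cod l' U) :
    Model.closedDen K (.diag h hl hl') ≫ (𝓜.boxIso Sg T U).inv ≫ 𝓜.adj.counit.app _ =
      MonoidalClosed.curry ((ρ_ _).hom ≫ (𝓜.mtyIso Sg T).hom ≫ 𝓜.phi Sg hl hl' ≫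
        (𝓜.mtyIso Sg U).inv) := by
  rw [Model.closedDen_diag, Model.psi_eq]
  have key : ∀ {X Y Z Z' W : C} (e : X ⟶ Y) (f : Y ⟶ Z) (b : Z ≅ Z') (c : Z ⟶ W),
      (e ≫ f ≫ b.hom) ≫ b.inv ≫ c = e ≫ f ≫ c := by
    simp
  exact (key _ _ _ _).trans (𝓜.ε_map_homEquiv_counit _)

theorem Preserves.let_ (hv : v.IsValue) (h : Preserves K S m S' v)
    (h' : Preserves K S' (n.inst v) S'' w) : Preserves K S (.let_ m n) S'' w := by
  intro A Q'' Q' s d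
  cases d with
  | let_ c t d₁ d₂ =>
    cases c
    obtain ⟨P, P₁, s₁, t₁, d₁', e₁⟩ := h.frame_left s t d₁
    obtain ⟨d₃, e₂⟩ := Typing.exists_inst K hv t₁ d₁' d₂
    obtain ⟨R, s₂, d₄, e₃⟩ := h' s₁ d₃
    refine ⟨R, s₂, d₄, ?_⟩
    rw [← e₃, e₂, ← e₁, Model.closedDen_let]

theorem Preserves.left {A B : Ty Sg.W} (h : Preserves K S m S' v) :
    Preserves K S (.left A B m) S' (.left A B v) := by
  intro Z Q'' Q' s d
  cases d with
  | left A B d =>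
    obtain ⟨P, s', d', e⟩ := h s d
    refine ⟨P, s', .left A B d', ?_⟩
    rw [Model.closedDen_left, Model.closedDen_left]
    exact Model.run_comp_eq e _

theorem Preserves.right {A B : Ty Sg.W} (h : Preserves K S m S' v) :
    Preserves K S (.right A B m) S' (.right A B v) := by
  intro Z Q'' Q' s d
  cases d with
  | right A B d =>
    obtain ⟨P, s', d', e⟩ := h s d
    refine ⟨P, s', .right A B d', ?_⟩
    rw [Model.closedDen_right, Model.closedDen_right]
    exact Model.run_comp_eq e _

theorem Preserves.case_left {A B : Ty Sg.W} {p : Term Sg} (hv : v.IsValue)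
    (h : Preserves K S m S' (.left A B v)) (h' : Preserves K S' (n.inst v) S'' w) :
    Preserves K S (.case m n p) S'' w := by
  intro Z Q'' Q' s d
  cases d with
  | case c t d d₁ d₂ =>
    cases c
    obtain ⟨P, P₁, s₁, t₁, d', e₁⟩ := h.frame_left s t d
    cases d' with
    | left _ _ d' =>
      obtain ⟨d₃, e₂⟩ := Typing.exists_inst K hv t₁ d' d₁
      obtain ⟨R, s₂, d₄, e₃⟩ := h' s₁ d₃
      refine ⟨R, s₂, d₄, ?_⟩
      rw [← e₃, e₂, Model.closedDen_case]
      refine (e₁ _).trans (congrArg _ (congrArg (_ ≫ ·) ?_))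
      have key : ∀ {L X A B Z : C} (u : 𝟙_ C ⊗ L ⟶ A) (f : A ⊗ (𝟙_ C ⊗ X) ⟶ Z)
          (g : B ⊗ (𝟙_ C ⊗ X) ⟶ Z),
          ((λ_ L).inv ≫ u ≫ coprod.inl) ▷ X ≫ ((A ⨿ B) ◁ (λ_ X).inv) ≫ caseMap f g =
            ((λ_ L).inv ≫ u) ▷ X ≫ (A ◁ (λ_ X).inv) ≫ f := by
        intro L X A B Z u f g
        conv_rhs => rw [← inl_caseMap f g, whisker_exchange_assoc]
        simp
      exact key _ _ _

theorem Preserves.case_right {A B : Ty Sg.W} {p : Term Sg} (hv : v.IsValue)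
    (h : Preserves K S m S' (.right A B v)) (h' : Preserves K S' (p.inst v) S'' w) :
    Preserves K S (.case m n p) S'' w := by
  intro Z Q'' Q' s d
  cases d with
  | case c t d d₁ d₂ =>
    cases c
    obtain ⟨P, P₁, s₁, t₁, d', e₁⟩ := h.frame_left s t d
    cases d' with
    | right _ _ d' =>
      obtain ⟨d₃, e₂⟩ := Typing.exists_inst K hv t₁ d' d₂
      obtain ⟨R, s₂, d₄, e₃⟩ := h' s₁ d₃
      refine ⟨R, s₂, d₄, ?_⟩
      rw [← e₃, e₂, Model.closedDen_case]
      refine (e₁ _).trans (congrArg _ (congrArg (_ ≫ ·) ?_))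
      have key : ∀ {L X A B Z : C} (u : 𝟙_ C ⊗ L ⟶ B) (f : A ⊗ (𝟙_ C ⊗ X) ⟶ Z)
          (g : B ⊗ (𝟙_ C ⊗ X) ⟶ Z),
          ((λ_ L).inv ≫ u ≫ coprod.inr) ▷ X ≫ ((A ⨿ B) ◁ (λ_ X).inv) ≫ caseMap f g =
            ((λ_ L).inv ≫ u) ▷ X ≫ (B ◁ (λ_ X).inv) ≫ g := by
        intro L X A B Z u f g
        conv_rhs => rw [← inr_caseMap f g, whisker_exchange_assoc]
        simp
      exact key _ _ _

theorem Preserves.seq (h : Preserves K S m S' .star) (h' : Preserves K S' n S'' v) :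
    Preserves K S (.seq m n) S'' v := by
  intro Z Q'' Q' s d
  cases d with
  | seq c t d₁ d₂ =>
    cases c
    obtain ⟨P, P₁, s₁, t₁, d', e₁⟩ := h.frame_left s t d₁
    cases d' with
    | star hΦ =>
      obtain rfl := t₁.eq_of_left_empty
      obtain ⟨R, s₂, d₄, e₃⟩ := h' s₁ d₂
      refine ⟨R, s₂, d₄, ?_⟩
      rw [← e₃, Model.closedDen_seq]
      refine (e₁ _).trans (congrArg _ ?_)
      have hd : Model.closedDen K (.star hΦ) = 𝟙 (𝟙_ C) := by
        have := Model.leftUnitor_inv_discardCtx (𝓜 := 𝓜) hΦ (𝟙 (𝟙_ C))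
        exact (congrArg (fun z => _ ≫ _ ≫ z) (Category.comp_id _).symm).trans this
      have ht : (𝓜.splitLabels Sg t₁).hom = (λ_ _).inv := LabelCtx.splitIso_left_empty _ t₁
      have key : ∀ {X Y : C} {u : 𝟙_ C ⟶ 𝟙_ C} {t : X ⟶ 𝟙_ C ⊗ X} (f : X ⟶ Y), u = 𝟙 _ →
          t = (λ_ _).inv → t ≫ (u ▷ _) ≫ (λ_ _).hom ≫ f = f := by
        rintro X Y _ _ f rfl rfl
        simp
      exact key _ hd ht

theorem Preserves.pair (h : Preserves K S m S' v) (h' : Preserves K S' n S'' w) :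
    Preserves K S (.pair m n) S'' (.pair v w) := by
  intro Z Q'' Q' s d
  cases d with
  | pair c t d₁ d₂ =>
    cases c
    obtain ⟨P, P₁, P₂, s', t', d₁', d₂', e⟩ := h.frame h' s t d₁ d₂
    refine ⟨P, s', .pair .nil t' d₁' d₂', ?_⟩
    rw [Model.closedDen_pair, Model.closedDen_pair]
    have e' := e (𝟙 _)
    rw [Category.comp_id, Category.comp_id] at e'
    exact e'

theorem Preserves.letPair {v' : Term Sg} (hv : v.IsValue) (hv' : v'.IsValue)
    (h : Preserves K S m S' (.pair v v')) (h' : Preserves K S' (n.inst₂ v v') S'' w) :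
    Preserves K S (.letPair m n) S'' w := by
  intro A Q'' Q' s d
  cases d with
  | letPair c t d₁ d₂ =>
    cases c
    obtain ⟨P, P₁, s₁, t₁, d', e₁⟩ := h.frame_left s t d₁
    cases d' with
    | pair c t' d₁' d₁'' =>
      cases c
      obtain ⟨d₃, e₂⟩ := Typing.exists_inst₂ K hv hv' t₁ t' d₁' d₁'' d₂
      obtain ⟨R, s₂, d₄, e₃⟩ := h' s₁ d₃
      refine ⟨R, s₂, d₄, ?_⟩
      rw [← e₃, e₂, Model.closedDen_letPair]
      exact e₁ _

theorem Preserves.app {A : Ty Sg.W} {S₃ : Diagram Sg Q} {m' : Term Sg} (hv : v.IsValue)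
    (h : Preserves K S m S' (.lam A m')) (h' : Preserves K S' n S'' v)
    (h₃ : Preserves K S'' (m'.inst v) S₃ w) : Preserves K S (.app m n) S₃ w := by
  intro B Q'' Q' s d
  cases d with
  | app c t d₁ d₂ =>
    cases c
    obtain ⟨P, P₁, P₂, s₁, t₁, d₁', d₂', e₁⟩ := h.frame h' s t d₁ d₂
    cases d₁' with
    | lam A d₁' =>
      obtain ⟨t₂, e₂⟩ := t₁.exists_symm (𝓜.wire Sg)
      obtain ⟨d₃, e₃⟩ := Typing.exists_inst K hv t₂ d₂' d₁'
      obtain ⟨R, s₂, d₄, e₄⟩ := h₃ s₁ d₃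
      refine ⟨R, s₂, d₄, ?_⟩
      rw [← e₄, e₃, Model.closedDen_app]
      refine (e₁ _).trans (congrArg _ ?_)
      have key : ∀ {L L₁ L₂ A B : C} {t : L ⟶ L₁ ⊗ L₂} {t' : L ⟶ L₂ ⊗ L₁} (e : L₂ ⟶ A)
          (g : A ⊗ (𝟙_ C ⊗ L₁) ⟶ B), t' = t ≫ (β_ _ _).hom →
          t ≫ (((λ_ L₁).inv ≫ MonoidalClosed.curry g) ⊗ₘ e) ≫ evMap A B =
            t' ≫ (e ▷ _) ≫ (_ ◁ (λ_ _).inv) ≫ g := by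
        rintro L L₁ L₂ A B t _ e g rfl
        rw [curry_tensorHom_evMap, Category.assoc]
      exact key _ _ e₂

theorem Preserves.force {m' : Term Sg} (h : Preserves K S m S' (.lift m'))
    (h' : Preserves K S' m' S'' v) : Preserves K S (.force m) S'' v := by
  intro A Q'' Q' s d
  cases d with
  | force d =>
    obtain ⟨P, s₁, d', e₁⟩ := h s d
    cases d' with
    | lift hΦ d' =>
      obtain ⟨R, s₂, d₄, e₂⟩ := h' s₁ d'
      refine ⟨R, s₂, d₄, ?_⟩
      rw [← e₂, Model.closedDen_force]
      exact (Model.run_comp_eq e₁ _).trans (congrArg _ (Model.closedDen_force_lift K hΦ d'))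

/-- The diagram built by applying the boxed function to labels denotes that function. The inner
evaluation starts from the identity diagram and leaves no outputs besides those of its result. -/
theorem Preserves.box {Q₀ : LabelCtx Sg.W} {D : Diagram Sg Q₀} {T : MTy Sg.W} {l l' : LTuple}
    (h : Preserves K S m S' (.lift n)) (hl : LTyping Q₀ l T)
    (h' : Preserves K (Diagram.id Sg Q₀) (.app n (l.toTerm Sg)) D (LTuple.toTerm Sg l')) :
    Preserves K S (.box T m) S' (.diag l ⟨Q₀, D.cod, D.hom⟩ l') := by
  intro A Q'' Q' s d
  cases d with
  | @box _ _ _ _ U d =>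
    obtain ⟨P, s₁, d', e₁⟩ := h s d
    cases d' with
    | lift hΦ d' =>
      obtain ⟨t⟩ := LabelCtx.exists_split_left_empty Q₀
      obtain ⟨t'⟩ := t.symm
      obtain ⟨dl, hdl⟩ := hl.exists_typing K
      obtain ⟨R, s₂, d₂, e₂⟩ := h' t' (.app .nil t d' dl)
      -- The inner evaluation has no frame, so that all of its outputs are labels of its result.
      obtain rfl := s₂.eq_of_right_empty
      obtain ⟨U', hU, ⟨hl'⟩⟩ := LTuple.exists_lTyping d₂
      obtain rfl := MTy.toTy_injective hU
      refine ⟨.empty, s₁, .diag (S := ⟨Q₀, D.cod, D.hom⟩) hΦ hl hl', ?_⟩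
      rw [Model.closedDen_box]
      refine (Model.run_comp_eq e₁ _).trans (congrArg _ ?_)
      rw [Model.closedDen_diag, Model.psi_eq]
      refine (congrArg (· ≫ _) (Model.closedDen_lift K hΦ d')).trans
        ((Category.assoc _ _ _).trans ?_)
      -- Both sides are transposes; it remains to compare the curried morphisms.
      refine congrArg (fun z => Functor.LaxMonoidal.ε 𝓜.F ≫ 𝓜.F.map (𝓜.adj.homEquiv (𝟙_ V) _
        (Functor.OplaxMonoidal.η 𝓜.F ≫ z)) ≫ (𝓜.boxIso Sg T U).hom) ?_
      have key : ∀ {X Y A A' B B' : C} {g : 𝟙_ C ⟶ (ihom A).obj B} {t : X ⟶ 𝟙_ C ⊗ X}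
          {c : X ≅ A'} {i : A ≅ A'} {D : X ⟶ Y} {c' : Y ≅ B'} {j : B ≅ B'} {a : X ⟶ A} {b : Y ⟶ B},
          𝟙 X ≫ (t ≫ (g ⊗ₘ a) ≫ evMap A B) = D ≫ b →
          t = (λ_ X).inv → a = c.hom ≫ i.inv → b = c'.hom ≫ j.inv →
          g = MonoidalClosed.curry ((ρ_ A).hom ≫ i.hom ≫ (c.inv ≫ D ≫ c'.hom) ≫ j.inv) := by
        rintro X Y A A' B B' g _ c i D c' j _ _ h rfl rfl rfl
        rw [Category.id_comp, leftUnitor_inv_tensorHom_evMap] at h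
        apply MonoidalClosed.uncurry_injective
        rw [MonoidalClosed.uncurry_curry, Category.assoc, Category.assoc, ← h]
        simp
      refine key (?_ : _ = 𝓜.diagram Sg D.hom ≫ _) (LabelCtx.splitIso_left_empty _ t) hdl
        (hl'.closedDen_eq K d₂)
      have e₃ := Model.run_right_empty (S := Diagram.id Sg Q₀) t' s₂ e₂
      rw [Model.closedDen_app] at e₃
      exact (congrArg (· ≫ _) (𝓜.diagram_id Q₀).symm).trans e₃

/-- Appending a boxed diagram is the same as evaluating the function that it denotes. -/
theorem Preserves.apply {S₃ : Diagram Sg Q} {D : LDiagram Sg} {l l' kt kt' : LTuple}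
    (h : Preserves K S m S' (.diag l D l')) (h' : Preserves K S' n S'' (LTuple.toTerm Sg kt))
    (ha : Append S'' kt l D l' S₃ kt') :
    Preserves K S (.apply m n) S₃ (LTuple.toTerm Sg kt') := by
  intro A Q'' Q' s d
  cases d with
  | apply c t d₁ d₂ =>
    cases c
    obtain ⟨P, P₁, P₂, s₁, t₁, d₁', d₂', e₁⟩ := h.frame h' s t d₁ d₂
    cases d₁' with
    | diag hΦ hl hl' =>
      -- The boxed diagram uses no labels.
      obtain rfl := t₁.eq_of_left_empty
      obtain ⟨_, _, ⟨h₂⟩⟩ := LTuple.exists_lTyping d₂'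
      cases ha with
      | mk s₂ s₃ hk hm hm' hk' fresh =>
        -- The typings of the label tuples that occur in `Append` are those given by the derivation.
        obtain rfl := hl.type_unique hm
        obtain rfl := hl'.type_unique hm'
        obtain rfl := hl.subsingleton hm
        obtain rfl := hl'.subsingleton hm'
        obtain rfl := LabelCtx.eq_of_labels_eq s₁.sublist_left s₂.sublist_left
          (h₂.labels_eq.trans hk.labels_eq.symm)
        obtain rfl := s₁.right_eq s₂
        obtain rfl := s₁.subsingleton s₂
        obtain ⟨d₃, e₃⟩ := hk'.exists_typing K
        refine ⟨_, s₃, d₃, ?_⟩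
        rw [e₃, Model.closedDen_apply]
        refine (congrArg (fun z => Model.run S s ((𝓜.splitLabels Sg t).hom ≫ z))
          (tensorHom_comp_left _ _ _ _)).trans ((e₁ _).trans ?_)
        have key : ∀ {X A A' B B' Z : C} {t : X ⟶ 𝟙_ C ⊗ X} {a : X ⟶ A} {k : X ⟶ A'} {i : A ≅ A'}
            {j : B ≅ B'} {p : A' ⟶ B'} {e : 𝟙_ C ⟶ Z} {z : Z ⟶ (ihom A).obj B},
            t = (λ_ X).inv → a = k ≫ i.inv →
            e ≫ z = MonoidalClosed.curry ((ρ_ A).hom ≫ i.hom ≫ p ≫ j.inv) →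
            t ≫ (e ⊗ₘ a) ≫ (z ▷ A) ≫ evMap A B = k ≫ p ≫ j.inv := by
          rintro X A A' B B' Z _ _ k i j p e z rfl rfl h
          rw [← tensorHom_comp_left, h, leftUnitor_inv_tensorHom_evMap,
            MonoidalClosed.uncurry_curry]
          simp
        have e₄ := key (LabelCtx.splitIso_left_empty _ t₁) (hk.closedDen_eq K d₂')
          (Model.closedDen_diag_counit K hΦ hl hl')
        refine (congrArg _ e₄).trans ?_
        have key' : ∀ {D Y Y' L L' A B R Z : C} {x : D ⟶ Y} {y : Y ⟶ L ⊗ R} {x' : D ⟶ Y'}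
            {y' : Y' ⟶ L' ⊗ R} {k : L' ⟶ A} {p : A ⟶ B} {b : L ≅ B} {j : B ⟶ Z},
            x ≫ y = x' ≫ y' ≫ ((k ≫ p ≫ b.inv) ▷ R) →
            x' ≫ y' ≫ ((k ≫ p ≫ j) ▷ R) = x ≫ y ≫ ((b.hom ≫ j) ▷ R) := by
          intro D Y Y' L L' A B R Z x y x' y' k p b j h
          rw [← Category.assoc x, h]
          simp only [Category.assoc, ← comp_whiskerRight, Iso.inv_hom_id_assoc]
        exact key' (𝓜.diagram_append _ s₁ s₃ hk hl hl' hk')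

/-- Soundness of evaluation, by induction on the evaluation. -/
theorem Eval.preserves (K : 𝓜.Constants Sg) (h : Eval S m S' v) : Preserves K S m S' v := by
  have refl : ∀ {Q : LabelCtx Sg.W} {S : Diagram Sg Q} {v : Term Sg}, Preserves K S v S v :=
    fun {_ _ _} _ Q'' _ s d => ⟨Q'', s, d, rfl⟩
  induction h with
  | const c => exact refl
  | let_ h h' ih ih' => exact ih.let_ h.isValue ih'
  | left h ih => exact ih.left
  | right h ih => exact ih.right
  | case_left h h' ih ih' =>
    cases h.isValue with
    | left _ _ hv => exact ih.case_left hv ih'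
  | case_right h h' ih ih' =>
    cases h.isValue with
    | right _ _ hv => exact ih.case_right hv ih'
  | star => exact refl
  | seq h h' ih ih' => exact ih.seq ih'
  | pair h h' ih ih' => exact ih.pair ih'
  | letPair h h' ih ih' =>
    cases h.isValue with
    | pair hv hv' => exact ih.letPair hv hv' ih'
  | lam A m => exact refl
  | app h h' h₃ ih ih' ih₃ => exact ih.app h'.isValue ih' ih₃
  | lift m => exact refl
  | force h h' ih ih' => exact ih.force ih'
  | label ℓ => exact refl
  | box h hl _ h' ih ih' => exact ih.box hl ih'
  | apply h h' ha ih ih' => exact ih.apply ih' ha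
  | diag l D l' => exact refl

/-- The interpretation of a configuration does not depend on the derivation of its typing. -/
theorem Model.config_eq (K : 𝓜.Constants Sg) {A : Ty Sg.W} {Q' : LabelCtx Sg.W}
    (d d' : ConfigTyping S m A Q') : Model.config K d = Model.config K d' := by
  obtain ⟨Q'', s, d⟩ := d
  obtain ⟨P, s', d'⟩ := d'
  obtain rfl := s.left_eq s'
  obtain rfl := s.subsingleton s'
  simp only [Model.config]
  rw [Model.den_eq K d d']

end Soundness

end ECLNL

theorem mainTheorem1
    {V : Type u₁} [Category.{v₁} V] [CartesianMonoidalCategory V] [BraidedCategory V]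
    [MonoidalClosed V] [HasFiniteCoproducts V]
    {C : Type u₂} [Category.{v₂} C] [EnrichedOrdinaryCategory V C] [MonoidalCategory C]
    [SymmetricCategory C] [MonoidalClosed C] [HasFiniteCoproducts C]
    {M : Type u₃} [Category.{v₃} M] [MonoidalCategory M] [SymmetricCategory M]
    (𝓜 : ECLNL.Model V C M) (Sg : ECLNL.Signature.{u₃, w, k} M) (K : 𝓜.Constants Sg)
    {Q Q' : ECLNL.LabelCtx Sg.W} {S S' : ECLNL.Diagram Sg Q} {m v : ECLNL.Term Sg}
    {A : ECLNL.Ty Sg.W}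
    (hm : Nonempty (ECLNL.ConfigTyping S m A Q')) (he : ECLNL.Eval S m S' v) :
    Nonempty (ECLNL.ConfigTyping S' v A Q') ∧
      ∀ (d : ECLNL.ConfigTyping S m A Q') (d' : ECLNL.ConfigTyping S' v A Q'),
        ECLNL.Model.config K d = ECLNL.Model.config K d' := by
  obtain ⟨Q'', s, d⟩ := hm
  obtain ⟨P, s', d', h⟩ := he.preserves K s d
  refine ⟨⟨P, s', d'⟩, fun e e' => ?_⟩
  rw [ECLNL.Model.config_eq K e ⟨Q'', s, d⟩, ECLNL.Model.config_eq K e' ⟨P, s', d'⟩]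
  exact h
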